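/- Let $\rho_0,\rho_1$ be two states (density operators) of $m$ bosonic modes, on $\mathcal H_m=L^2(\mathbb R^m)$, whose Wigner functions $W_i(x,p)=\pi^{-m}\operatorname{tr}\bigl(\rho_i D(x,p)(-1)^{N_1+\dots+N_m}D(x,p)^\dagger\bigr)$ are non-negative on $\mathbb R^{2m}$. Here $D(x,p)=e^{i(p\cdot X-x\cdot P)}$ are the displacement operators. For a class $\mathbb M$ of binary POVMs $(M,\mathbb 1-M)$, specified for every number of modes, define $\|\cdot\|_{\mathbb M}$ by $$\inf_{(M,\mathbb 1-M)\in\mathbb M}\Bigl(\tfrac12\operatorname{tr}\rho_0(\mathbb 1-M)+\tfrac12\operatorname{tr}\rho_1M\Bigr)=\tfrac12\Bigl(1-\tfrac12\|\rho_0-\rho_1\|_{\mathbb M}\Bigr),$$ and let $\xi_{\mathbb M}(\rho_0,\rho_1)\in[0,+\infty]$ be the limit of $-\frac1n\ln\bigl(1-\frac12\|\rho_0^{\otimes n}-\rho_1^{\otimes n}\|_{\mathbb M}\bigr)$ as $n\to\infty$, where $\ln 0=-\infty$. As it is not claimed that this limit exists, the inequalities below are asserted both with $\limsup$ and with $\liminf$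 in place of $\lim$; hence they hold for the limits whenever these exist. A binary POVM is a W+ POVM if the Wigner functions $W_M$ and $W_{\mathbb 1-M}$ are non-negative; for a bounded operator $M$, $W_M$ is the tempered distribution defined by $\operatorname{tr}(MT)=(2\pi)^m\int W_MW_T$ for all trace class operators $T$ with Schwartz Wigner function. A binary POVM is a GOCC POVM if it is implemented by a protocol of finitely many rounds, or is a strong limit of such POVMs. In each round some modes in the vacuum state are adjoined, a Gaussian unitary is applied, and the position quadratures of some of the modes are measured by homodyne detection; these choices may depend (measurably) on all earlier outcomes. In the last round all remaining modes are measured, and the final binary outcome is a measurable function of all measurement outcomes. Then $W_0$ and $W_1$ are probability densities, and $$\xi_{\mathrm{GOCC}}(\rho_0,\rho_1)\le\xi_{\mathrm{W+}}(\rho_0,\rho_1)\le\xi(W_0,W_1),$$ where $\xi(W_0,W_1)=\lim_{n\to\infty}-\frac1n\ln\bigl(1-\frac12\|W_0^{\otimes n}-W_1^{\otimes n}\|_{L^1}\bigr)$ is the classical Chernoff coefficient of $W_0$ and $W_1$. This limit exists in $[0,+\infty]$ and, by Chernoff's theorem, $$\xi(W_0,W_1)=-\ln\inf_{0<s<1}\int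 W_0(x,p)^sW_1(x,p)^{1-s}\,d^mx\,d^mp .$$ -/

import Mathlib

open MeasureTheory Filter Topology
open scoped ENNReal InnerProductSpace TensorProduct SchwartzMap

noncomputable section

namespace Bosonic

/-- Configuration space of `m` modes. -/
abbrev Conf (m : ℕ) : Type := Fin m → ℝ

/-- Phase space of `m` modes, with points `z = (x, p)`. -/
abbrev Phase (m : ℕ) : Type := (Fin m → ℝ) × (Fin m → ℝ)

/-- The Hilbert space of `m` bosonic modes in the Schrödinger representation, `L²(ℝᵐ)`. -/
abbrev H (m : ℕ) : Type := Lp ℂ 2 (volume : Measure (Conf m))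

/-! ### Traces, density operators -/

/-- Index set of a fixed orthonormal basis of `H m`. -/
def basisIdx (m : ℕ) : Set (H m) := (exists_hilbertBasis ℂ (H m)).choose

/-- A fixed orthonormal basis of `H m`. The trace of a trace class operator and the notion of a
positive trace class operator do not depend on it. -/
def onb (m : ℕ) : HilbertBasis (basisIdx m) ℂ (H m) :=
  (exists_hilbertBasis ℂ (H m)).choose_spec.choose

/-- The trace `tr T`, for `T` trace class. -/
def opTrace {m : ℕ} (T : H m →L[ℂ] H m) : ℂ := ∑' i, ⟪onb m i, T (onb m i)⟫_ℂ

/-- Positive operators of finite trace. -/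
def IsPosTraceClass {m : ℕ} (T : H m →L[ℂ] H m) : Prop :=
  T.IsPositive ∧ Summable fun i => ⟪onb m i, T (onb m i)⟫_ℂ

/-- Self-adjoint trace class operators, i.e. differences of two positive operators of finite
trace. -/
def IsSelfAdjointTraceClass {m : ℕ} (T : H m →L[ℂ] H m) : Prop :=
  ∃ A B : H m →L[ℂ] H m, IsPosTraceClass A ∧ IsPosTraceClass B ∧ T = A - B

/-- States of `m` modes: `ρ ≥ 0`, `tr ρ = 1`. -/
def IsDensityOperator {m : ℕ} (ρ : H m →L[ℂ] H m) : Prop :=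
  ρ.IsPositive ∧ HasSum (fun i => ⟪onb m i, ρ (onb m i)⟫_ℂ) 1

/-! ### Displacement operators, parity, Wigner functions -/

/-- Composition with a measure preserving map, as an isometry of `L²`. -/
def compIso {m : ℕ} (f : Conf m → Conf m) (hf : MeasurePreserving f volume volume) :
    H m →L[ℂ] H m :=
  (Lp.compMeasurePreservingₗᵢ ℂ f hf).toContinuousLinearMap

/-- The phase function `y ↦ exp (i (p ⬝ y - p ⬝ x / 2))`. -/
def phaseFun {m : ℕ} (z : Phase m) (y : Conf m) : ℂ :=
  Complex.exp (Complex.I * ((z.2 ⬝ᵥ y - z.2 ⬝ᵥ z.1 / 2 : ℝ) : ℂ))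

theorem norm_phaseFun {m : ℕ} (z : Phase m) (y : Conf m) : ‖phaseFun z y‖ = 1 := by
  rw [phaseFun, mul_comm, Complex.norm_exp_ofReal_mul_I]

theorem continuous_phaseFun {m : ℕ} (z : Phase m) : Continuous (phaseFun z) := by
  unfold phaseFun dotProduct
  fun_prop

theorem memLp_phaseFun_mul {m : ℕ} (z : Phase m) (f : H m) :
    MemLp (fun y => phaseFun z y * f y) 2 volume := by
  refine (Lp.memLp f).of_le
    ((continuous_phaseFun z).aestronglyMeasurable.mul (Lp.memLp f).1) ?_
  exact Eventually.of_forall fun y => by rw [norm_mul, norm_phaseFun, one_mul]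

/-- Multiplication by the phase function. -/
def phaseMul {m : ℕ} (z : Phase m) : H m →L[ℂ] H m :=
  LinearMap.mkContinuous
    { toFun := fun f => (memLp_phaseFun_mul z f).toLp _
      map_add' := fun f g => by
        rw [← MemLp.toLp_add, MemLp.toLp_eq_toLp_iff]
        filter_upwards [Lp.coeFn_add f g] with y hy
        simp only [hy, Pi.add_apply, mul_add]
      map_smul' := fun c f => by
        rw [RingHom.id_apply, ← MemLp.toLp_const_smul, MemLp.toLp_eq_toLp_iff]
        filter_upwards [Lp.coeFn_smul c f] with y hy
        simp only [hy, Pi.smul_apply, smul_eq_mul]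
        ring }
    1 (fun f => by
      rw [one_mul]
      refine Lp.norm_le_norm_of_ae_le ?_
      filter_upwards [(memLp_phaseFun_mul z f).coeFn_toLp] with y hy
      change ‖((memLp_phaseFun_mul z f).toLp _ : Conf m → ℂ) y‖ ≤ _
      rw [hy, norm_mul, norm_phaseFun, one_mul])

/-- The displacement operator
`(D(x, p) f)(y) = exp (i (p ⬝ y - p ⬝ x / 2)) f (y - x)`, i.e. `exp (i (p ⬝ X - x ⬝ P))`, which is
`D(α) = exp (α a† - conj α a)` with `α = (x + i p) / √2`. -/
def displacement {m : ℕ} (z : Phase m) : H m →L[ℂ] H m :=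
  phaseMul z ∘L compIso (fun y => y - z.1) (measurePreserving_sub_right volume z.1)

/-- The parity operator `(-1)^(N₁ + ⋯ + N_m)`, i.e. `(Π f)(y) = f (-y)`. -/
def parity (m : ℕ) : H m →L[ℂ] H m :=
  compIso (fun y => -y) (Measure.measurePreserving_neg volume)

/-- The displaced parity operator `D(z) Π D(z)†`. -/
def displacedParity {m : ℕ} (z : Phase m) : H m →L[ℂ] H m :=
  displacement z ∘L parity m ∘L ContinuousLinearMap.adjoint (displacement z)

/-- The Wigner function `W_T(x, p) = π⁻ᵐ tr (T D(x,p) Π D(x,p)†)` of a self-adjoint trace class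
operator (for which the trace is real). -/
def wigner {m : ℕ} (T : H m →L[ℂ] H m) (z : Phase m) : ℝ :=
  (Real.pi ^ m)⁻¹ * (opTrace (T ∘L displacedParity z)).re

/-- Non-negativity of the Wigner function `W_M` of a bounded self-adjoint operator `M`. In general
`W_M` is a tempered distribution, determined through `tr (M T) = (2π)ᵐ ∫ W_M W_T`: by this formula
it acts on a real Schwartz function `φ`, which is the Wigner function of a unique self-adjoint
trace class operator `T`. It is non-negative if it is so on non-negative test functions. -/
def HasNonnegWigner {m : ℕ} (M : H m →L[ℂ] H m) : Prop :=
  ∀ (φ : 𝓢(Phase m, ℝ)) (T : H m →L[ℂ] H m), IsSelfAdjointTraceClass T →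
    (∀ z, wigner T z = φ z) → (∀ z, 0 ≤ φ z) → 0 ≤ (opTrace (M ∘L T)).re

/-! ### Tensor products -/

/-- Splitting the coordinates of `m + k` modes. -/
def splitMap (m k : ℕ) (x : Conf (m + k)) : Conf m × Conf k :=
  (fun i => x (Fin.castAdd k i), fun j => x (Fin.natAdd m j))

/-- `Fin.append` as a measurable equivalence. -/
def appendMeq (m k : ℕ) : Conf m × Conf k ≃ᵐ Conf (m + k) where
  toEquiv := Fin.appendEquiv m k
  measurable_toFun := by
    refine measurable_pi_iff.2 fun i => ?_
    refine Fin.addCases (fun i => ?_) (fun j => ?_) i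
    · simp only [Fin.appendEquiv, Equiv.coe_fn_mk, Fin.append_left]
      fun_prop
    · simp only [Fin.appendEquiv, Equiv.coe_fn_mk, Fin.append_right]
      fun_prop
  measurable_invFun := by
    change Measurable (splitMap m k)
    unfold splitMap
    fun_prop

theorem measurePreserving_append (m k : ℕ) :
    MeasurePreserving (appendMeq m k) (volume.prod volume) volume := by
  refine ⟨(appendMeq m k).measurable, ?_⟩
  rw [volume_pi]
  refine (Measure.pi_eq fun s hs => ?_).symm
  rw [Measure.map_apply (appendMeq m k).measurable (MeasurableSet.univ_pi hs)]
  have : (appendMeq m k) ⁻¹' Set.univ.pi s =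
      (Set.univ.pi fun i => s (Fin.castAdd k i)) ×ˢ (Set.univ.pi fun j => s (Fin.natAdd m j)) := by
    ext ⟨a, b⟩
    simp only [Set.mem_preimage, Set.mem_pi, Set.mem_univ, true_implies, Set.mem_prod]
    constructor
    · intro h
      exact ⟨fun i => by simpa [appendMeq, Fin.appendEquiv] using h (Fin.castAdd k i),
        fun j => by simpa [appendMeq, Fin.appendEquiv] using h (Fin.natAdd m j)⟩
    · rintro ⟨h1, h2⟩ i
      refine Fin.addCases (fun i => ?_) (fun j => ?_) i
      · simpa [appendMeq, Fin.appendEquiv] using h1 i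
      · simpa [appendMeq, Fin.appendEquiv] using h2 j
  rw [this, Measure.prod_prod, Measure.pi_pi, volume_pi_pi, Fin.prod_univ_add]

theorem measurePreserving_split (m k : ℕ) :
    MeasurePreserving (splitMap m k) volume (volume.prod volume) :=
  (measurePreserving_append m k).symm

theorem memLp_prod {m k : ℕ} (f : H m) (g : H k) :
    MemLp (fun q : Conf m × Conf k => f q.1 * g q.2) 2 (volume.prod volume) := by
  have hm : AEStronglyMeasurable (fun q : Conf m × Conf k => f q.1 * g q.2)
      (volume.prod volume) := (Lp.aestronglyMeasurable f).comp_fst.mul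
        (Lp.aestronglyMeasurable g).comp_snd
  rw [memLp_two_iff_integrable_sq_norm hm]
  have h1 := (memLp_two_iff_integrable_sq_norm (Lp.aestronglyMeasurable f)).1 (Lp.memLp f)
  have h2 := (memLp_two_iff_integrable_sq_norm (Lp.aestronglyMeasurable g)).1 (Lp.memLp g)
  simpa only [norm_mul, mul_pow] using h1.mul_prod h2

theorem memLp_tensor {m k : ℕ} (f : H m) (g : H k) :
    MemLp (fun x => f (splitMap m k x).1 * g (splitMap m k x).2) 2 volume :=
  (memLp_prod f g).comp_measurePreserving (measurePreserving_split m k)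

/-- The product vector `f ⊗ g`, i.e. `(a, b) ↦ f a * g b`. -/
def tensorVec {m k : ℕ} (f : H m) (g : H k) : H (m + k) := (memLp_tensor f g).toLp _

theorem coeFn_tensorVec {m k : ℕ} (f : H m) (g : H k) :
    tensorVec f g =ᵐ[volume] fun x => f (splitMap m k x).1 * g (splitMap m k x).2 :=
  (memLp_tensor f g).coeFn_toLp

theorem ae_split_fst {m : ℕ} (k : ℕ) {P : Conf m → Prop} (h : ∀ᵐ a, P a) :
    ∀ᵐ x : Conf (m + k), P (splitMap m k x).1 :=
  (measurePreserving_split m k).quasiMeasurePreserving.ae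
    (Measure.quasiMeasurePreserving_fst.ae h)

theorem ae_split_snd (m : ℕ) {k : ℕ} {P : Conf k → Prop} (h : ∀ᵐ a, P a) :
    ∀ᵐ x : Conf (m + k), P (splitMap m k x).2 :=
  (measurePreserving_split m k).quasiMeasurePreserving.ae
    (Measure.quasiMeasurePreserving_snd.ae h)

/-- The bilinear map `(f, g) ↦ f ⊗ g`. -/
def tensorBilin (m k : ℕ) : H m →ₗ[ℂ] H k →ₗ[ℂ] H (m + k) :=
  LinearMap.mk₂ ℂ tensorVec
    (fun f f' g => by
      refine Lp.ext ?_
      filter_upwards [coeFn_tensorVec (f + f') g, coeFn_tensorVec f g, coeFn_tensorVec f' g,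
        Lp.coeFn_add (tensorVec f g) (tensorVec f' g),
        ae_split_fst k (Lp.coeFn_add f f')] with x h1 h2 h3 h4 h5
      rw [h1, h4, Pi.add_apply, h2, h3, h5, Pi.add_apply, add_mul])
    (fun c f g => by
      refine Lp.ext ?_
      filter_upwards [coeFn_tensorVec (c • f) g, coeFn_tensorVec f g,
        Lp.coeFn_smul c (tensorVec f g), ae_split_fst k (Lp.coeFn_smul c f)] with x h1 h2 h3 h4
      rw [h1, h3, Pi.smul_apply, h2, h4, Pi.smul_apply, smul_eq_mul, smul_eq_mul, mul_assoc])
    (fun f g g' => by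
      refine Lp.ext ?_
      filter_upwards [coeFn_tensorVec f (g + g'), coeFn_tensorVec f g, coeFn_tensorVec f g',
        Lp.coeFn_add (tensorVec f g) (tensorVec f g'),
        ae_split_snd m (Lp.coeFn_add g g')] with x h1 h2 h3 h4 h5
      rw [h1, h4, Pi.add_apply, h2, h3, h5, Pi.add_apply, mul_add])
    (fun c f g => by
      refine Lp.ext ?_
      filter_upwards [coeFn_tensorVec f (c • g), coeFn_tensorVec f g,
        Lp.coeFn_smul c (tensorVec f g), ae_split_snd m (Lp.coeFn_smul c g)] with x h1 h2 h3 h4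
      rw [h1, h3, Pi.smul_apply, h2, h4, Pi.smul_apply, smul_eq_mul, smul_eq_mul]
      ring)

theorem inner_tensorVec {m k : ℕ} (f f' : H m) (g g' : H k) :
    ⟪tensorVec f g, tensorVec f' g'⟫_ℂ = ⟪f, f'⟫_ℂ * ⟪g, g'⟫_ℂ := by
  rw [L2.inner_def, L2.inner_def, L2.inner_def, ← integral_prod_mul,
    ← (measurePreserving_append m k).integral_comp (appendMeq m k).measurableEmbedding]
  refine integral_congr_ae ?_
  have hp := (measurePreserving_append m k).quasiMeasurePreserving
  filter_upwards [hp.ae (coeFn_tensorVec f g), hp.ae (coeFn_tensorVec f' g')] with q h1 h2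
  have hs : splitMap m k (appendMeq m k q) = q := (appendMeq m k).symm_apply_apply q
  rw [h1, h2, hs]
  simp only [RCLike.inner_apply, map_mul]
  ring

/-- The isometric embedding of the algebraic tensor product into `H (m + k)`. -/
def tensorIso (m k : ℕ) : H m ⊗[ℂ] H k →ₗᵢ[ℂ] H (m + k) :=
  (TensorProduct.lift (tensorBilin m k)).isometryOfInner fun s t => by
    induction s with
    | zero => simp
    | add s s' hs hs' => rw [map_add, inner_add_left, inner_add_left, hs, hs']
    | tmul f g =>
      induction t with
      | zero => simp
      | add t t' ht ht' => rw [map_add, inner_add_right, inner_add_right, ht, ht']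
      | tmul f' g' => exact inner_tensorVec f f' g g'

theorem tensorIso_tmul {m k : ℕ} (f : H m) (g : H k) : tensorIso m k (f ⊗ₜ g) = tensorVec f g :=
  rfl

theorem denseRange_tensorIso (m k : ℕ) : DenseRange (tensorIso m k) := by
  have key : ∀ u : H (m + k), (∀ (f : H m) (g : H k), ⟪tensorVec f g, u⟫_ℂ = 0) → u = 0 := by
    intro u hu
    set G : Conf m × Conf k → ℂ := fun q => u (appendMeq m k q) with hG
    have hGL : MemLp G 2 (volume.prod volume) :=
      (Lp.memLp u).comp_measurePreserving (measurePreserving_append m k)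
    have rect : ∀ (s : Set (Conf m)) (t : Set (Conf k)), MeasurableSet s → MeasurableSet t →
        volume s ≠ ∞ → volume t ≠ ∞ → ∫ q in s ×ˢ t, G q ∂(volume.prod volume) = 0 := by
      intro s t hs ht hs' ht'
      have h := hu (indicatorConstLp 2 hs hs' 1) (indicatorConstLp 2 ht ht' 1)
      rw [L2.inner_def, ← (measurePreserving_append m k).integral_comp
        (appendMeq m k).measurableEmbedding] at h
      rw [← integral_indicator (hs.prod ht), ← h]
      refine integral_congr_ae ?_
      have hp := (measurePreserving_append m k).quasiMeasurePreserving
      have e1 := Measure.quasiMeasurePreserving_fst (μ := (volume : Measure (Conf m)))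
        (ν := (volume : Measure (Conf k))) |>.ae
          (indicatorConstLp_coeFn (p := 2) (hs := hs) (hμs := hs') (c := (1 : ℂ)))
      have e2 := Measure.quasiMeasurePreserving_snd (μ := (volume : Measure (Conf m)))
        (ν := (volume : Measure (Conf k))) |>.ae
          (indicatorConstLp_coeFn (p := 2) (hs := ht) (hμs := ht') (c := (1 : ℂ)))
      filter_upwards [hp.ae (coeFn_tensorVec (indicatorConstLp 2 hs hs' (1 : ℂ))
        (indicatorConstLp 2 ht ht' (1 : ℂ))), e1, e2] with q h1 h2 h3
      have hsq : splitMap m k (appendMeq m k q) = q := (appendMeq m k).symm_apply_apply q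
      rw [h1, hsq, h2, h3]
      by_cases a : q.1 ∈ s <;> by_cases b : q.2 ∈ t <;> simp [Set.indicator, a, b, hG]
    have ball : ∀ N : ℕ, ∀ᵐ q ∂(volume.prod volume : Measure (Conf m × Conf k)),
        q ∈ Metric.closedBall (0 : Conf m) N ×ˢ Metric.closedBall (0 : Conf k) N → G q = 0 := by
      intro N
      have hBm : MeasurableSet
          (Metric.closedBall (0 : Conf m) N ×ˢ Metric.closedBall (0 : Conf k) N) :=
        Metric.isClosed_closedBall.measurableSet.prod Metric.isClosed_closedBall.measurableSet
      have f1 : volume (Metric.closedBall (0 : Conf m) N) ≠ ∞ :=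
        (isCompact_closedBall _ _).measure_lt_top.ne
      have f2 : volume (Metric.closedBall (0 : Conf k) N) ≠ ∞ :=
        (isCompact_closedBall _ _).measure_lt_top.ne
      have hfin : (volume.prod volume : Measure (Conf m × Conf k))
          (Metric.closedBall (0 : Conf m) N ×ˢ Metric.closedBall (0 : Conf k) N) ≠ ∞ := by
        rw [Measure.prod_prod]
        exact ENNReal.mul_ne_top f1 f2
      set B := Metric.closedBall (0 : Conf m) N ×ˢ Metric.closedBall (0 : Conf k) N with hB
      have : IsFiniteMeasure ((volume.prod volume).restrict B) := ⟨by
        rw [Measure.restrict_apply_univ]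
        exact hfin.lt_top⟩
      have hint : Integrable G ((volume.prod volume).restrict B) :=
        (hGL.restrict B).integrable (by norm_num)
      rw [← ae_restrict_iff' hBm]
      refine hint.ae_eq_zero_of_forall_setIntegral_eq_zero fun s hs _ => ?_
      induction s, hs using MeasurableSpace.induction_on_inter generateFrom_prod.symm
        isPiSystem_prod with
      | empty => simp
      | basic s hs =>
        obtain ⟨a, ha, b, hb, rfl⟩ := hs
        replace ha : MeasurableSet a := ha
        replace hb : MeasurableSet b := hb
        rw [Measure.restrict_restrict (ha.prod hb), hB, Set.prod_inter_prod]
        refine rect _ _ (ha.inter Metric.isClosed_closedBall.measurableSet)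
          (hb.inter Metric.isClosed_closedBall.measurableSet) ?_ ?_
        · exact measure_ne_top_of_subset Set.inter_subset_right f1
        · exact measure_ne_top_of_subset Set.inter_subset_right f2
      | compl s hs ih =>
        have h1 := integral_add_compl hs hint
        rw [ih (measure_lt_top _ _), zero_add] at h1
        rw [h1]
        exact rect _ _ Metric.isClosed_closedBall.measurableSet
          Metric.isClosed_closedBall.measurableSet f1 f2
      | iUnion f hd hf ih =>
        rw [integral_iUnion hf hd hint.integrableOn]
        simp [fun i => ih i (measure_lt_top _ _)]
    have hG0 : G =ᵐ[volume.prod volume] 0 := by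
      filter_upwards [ae_all_iff.2 ball] with q hq
      obtain ⟨N, hN⟩ := exists_nat_ge (max ‖q.1‖ ‖q.2‖)
      exact hq N ⟨by simpa using (le_max_left _ _).trans hN,
        by simpa using (le_max_right _ _).trans hN⟩
    refine Lp.ext ?_
    have h1 := (measurePreserving_split m k).quasiMeasurePreserving.ae hG0
    filter_upwards [h1, Lp.coeFn_zero ℂ 2 (volume : Measure (Conf (m + k)))] with x hx h0
    have hx' : appendMeq m k (splitMap m k x) = x := (appendMeq m k).apply_symm_apply x
    rw [h0]
    simpa [hG, hx'] using hx
  have h := (Submodule.topologicalClosure_eq_top_iff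
    (K := LinearMap.range (tensorIso m k).toLinearMap)).2 <| by
      refine (Submodule.eq_bot_iff _).2 fun u hu => key u fun f g => ?_
      exact (Submodule.mem_orthogonal _ _).1 hu _ ⟨f ⊗ₜ g, rfl⟩
  have h2 := Submodule.dense_iff_topologicalClosure_eq_top.2 h
  intro u
  obtain h3 := h2 u
  exact closure_mono (by rintro _ ⟨t, rfl⟩; exact ⟨t, rfl⟩) h3

/-- The operator `A ⊗ B` on `H (m + k)`: the continuous extension of
`f ⊗ g ↦ A f ⊗ B g`. -/
def tensorOp {m k : ℕ} (A : H m →L[ℂ] H m) (B : H k →L[ℂ] H k) : H (m + k) →L[ℂ] H (m + k) :=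
  ((tensorIso m k).toContinuousLinearMap ∘L TensorProduct.mapL A B).extend
    (tensorIso m k).toContinuousLinearMap

theorem tensorOp_tensorVec {m k : ℕ} (A : H m →L[ℂ] H m) (B : H k →L[ℂ] H k) (f : H m) (g : H k) :
    tensorOp A B (tensorVec f g) = tensorVec (A f) (B g) :=
  ContinuousLinearMap.extend_eq _ (denseRange_tensorIso m k)
    (tensorIso m k).isometry.isUniformInducing (f ⊗ₜ g)

/-- The tensor power `ρ^{⊗ n}`, a state of `m * n` modes. -/
def tensorPow {m : ℕ} (ρ : H m →L[ℂ] H m) : (n : ℕ) → H (m * n) →L[ℂ] H (m * n)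
  | 0 => ContinuousLinearMap.id ℂ _
  | n + 1 => tensorOp (m := m * n) (k := m) (tensorPow ρ n) ρ

/-! ### Gaussian operations and classical computation -/

/-- The vacuum wave function of `k` modes, `π^(-k/4) exp (-|x|²/2)`. -/
def vacuumFun (k : ℕ) (x : Conf k) : ℂ :=
  ((∏ j, Real.pi ^ (-(1 / 4) : ℝ) * Real.exp (-(1 / 2) * x j ^ 2) : ℝ) : ℂ)

theorem memLp_vacuumFun (k : ℕ) : MemLp (vacuumFun k) 2 volume := by
  have hc : Continuous (vacuumFun k) := by
    unfold vacuumFun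
    fun_prop
  rw [memLp_two_iff_integrable_sq_norm hc.aestronglyMeasurable]
  have h1 : Integrable (fun t : ℝ => (Real.pi ^ (-(1 / 4) : ℝ)) ^ 2 * Real.exp (-1 * t ^ 2)) :=
    (integrable_exp_neg_mul_sq one_pos).const_mul _
  have h2 := Integrable.fintype_prod (𝕜 := ℝ) (ι := Fin k)
    (f := fun _ t => (Real.pi ^ (-(1 / 4) : ℝ)) ^ 2 * Real.exp (-1 * t ^ 2))
    (μ := fun _ => volume) (fun _ => h1)
  refine h2.congr (Eventually.of_forall fun x => ?_)
  simp only [vacuumFun, Complex.norm_real, Real.norm_eq_abs, sq_abs]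
  rw [← Finset.prod_pow]
  refine Finset.prod_congr rfl fun j _ => ?_
  rw [mul_pow, ← Real.exp_nat_mul]
  congr 2
  push_cast
  ring

/-- The vacuum state vector of `k` modes. -/
def vacuum (k : ℕ) : H k := (memLp_vacuumFun k).toLp _

/-- The symplectic form on phase space. -/
def symp {m : ℕ} (z w : Phase m) : ℝ := z.1 ⬝ᵥ w.2 - z.2 ⬝ᵥ w.1

/-- Gaussian unitaries: unitaries which map the linear span of `1, x_j, p_j` to itself. In terms of
the displacement operators (the exponentials of the elements of this span), `U D(z) U†` is
`D(S z)` up to a phase factor which is the exponential of a linear form, for a symplectic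
matrix `S`. -/
def IsGaussianUnitary {m : ℕ} (U : H m ≃ₗᵢ[ℂ] H m) : Prop :=
  ∃ (S : Phase m →ₗ[ℝ] Phase m) (d : Phase m), (∀ z w, symp (S z) (S w) = symp z w) ∧
    ∀ (z : Phase m) (f : H m), U (displacement z f) =
      Complex.exp (Complex.I * (symp d (S z) : ℂ)) • displacement (S z) (U f)

/-- A measurable family of Gaussian unitaries. -/
def IsGaussianUnitaryFamily {m : ℕ} {Y : Type} [MeasurableSpace Y] (U : Y → H m ≃ₗᵢ[ℂ] H m) :
    Prop :=
  (∀ y, IsGaussianUnitary (U y)) ∧ ∀ f g : H m, Measurable fun y => ⟪f, U y g⟫_ℂ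

open Classical in
/-- The (unnormalised) state vector `f (·, b)` of the first `m` of `n = m + l` modes which is left
after a homodyne detection of the position quadratures of the last `l` modes with outcome `b`. It
is in `L²` for almost all `b`. -/
def slice {m l n : ℕ} (h : m + l = n) (f : H n) (b : Conf l) : H m :=
  if hf : MemLp (fun a : Conf m => f (fun i => Fin.append a b (Fin.cast h.symm i))) 2 volume
  then hf.toLp _ else 0

/-- `GOCCFamily R m Y M`: the operators `M y` are the effects ("outcome 0") of binary measurements
of `m` modes by protocols of Gaussian operations and classical computation with `R` rounds, which
depend measurably on a parameter `y : Y`, the record of all earlier outcomes. Each round consists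
of adjoining `k` modes in the vacuum, a Gaussian unitary `U y`, and a homodyne detection of the
last `l` modes; the outcome is added to the record. The effects are given by their quadratic
forms, `⟨f, M y f⟩` being the probability of the outcome 0 for the state vector `f`. -/
inductive GOCCFamily : ℕ → (m : ℕ) → (Y : Type) → [MeasurableSpace Y] →
    (Y → H m →L[ℂ] H m) → Prop
  /-- The last round: all modes are measured, and the outcome is 0 if the record and the last
  outcome `x` lie in the measurable set `A`. -/
  | last {m : ℕ} {Y : Type} [MeasurableSpace Y] (k : ℕ) (U : Y → H (m + k) ≃ₗᵢ[ℂ] H (m + k))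
      (hU : IsGaussianUnitaryFamily U) (A : Set (Y × Conf (m + k))) (hA : MeasurableSet A)
      (M : Y → H m →L[ℂ] H m)
      (hM : ∀ y f, ⟪f, M y f⟫_ℂ =
        ((∫ x in {x | (y, x) ∈ A}, ‖U y (tensorVec f (vacuum k)) x‖ ^ 2 : ℝ) : ℂ)) :
      GOCCFamily 1 m Y M
  /-- A round which is followed by `R` further ones. -/
  | round {R m m' l : ℕ} {Y : Type} [MeasurableSpace Y] (k : ℕ) (h : m' + l = m + k)
      (U : Y → H (m + k) ≃ₗᵢ[ℂ] H (m + k)) (hU : IsGaussianUnitaryFamily U)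
      (N : Y × Conf l → H m' →L[ℂ] H m') (hN : GOCCFamily R m' (Y × Conf l) N)
      (M : Y → H m →L[ℂ] H m)
      (hM : ∀ y f, ⟪f, M y f⟫_ℂ =
        ∫ b : Conf l, ⟪slice h (U y (tensorVec f (vacuum k))) b,
          N (y, b) (slice h (U y (tensorVec f (vacuum k))) b)⟫_ℂ) :
      GOCCFamily (R + 1) m Y M
  /-- The numbers of modes which are adjoined and measured may depend on the record. -/
  | branch {R m : ℕ} {Y : Type} [MeasurableSpace Y] (c : Y → ℕ) (hc : Measurable c)
      (M : Y → H m →L[ℂ] H m)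
      (h : ∀ i, GOCCFamily R m {y // c y = i} fun y => M y.1) :
      GOCCFamily R m Y M

/-- Effects of binary measurements by protocols with finitely many rounds. -/
def IsGOCCProtocolEffect {m : ℕ} (M : H m →L[ℂ] H m) : Prop :=
  ∃ R, GOCCFamily R m Unit fun _ => M

/-- The effects `M` of the binary GOCC measurements `(M, 1 - M)`: effects of protocols with
finitely many rounds, and strong limits of such. -/
def gocc (m : ℕ) : Set (H m →L[ℂ] H m) :=
  {M | ∃ P : ℕ → H m →L[ℂ] H m, (∀ j, IsGOCCProtocolEffect (P j)) ∧
    ∀ f, Tendsto (fun j => P j f) atTop (𝓝 (M f))}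

/-- The effects `M` of the binary measurements `(M, 1 - M)` with non-negative Wigner functions
`W_M` and `W_{1 - M}`. -/
def wPlus (m : ℕ) : Set (H m →L[ℂ] H m) :=
  {M | M.IsPositive ∧ (1 - M).IsPositive ∧ HasNonnegWigner M ∧ HasNonnegWigner (1 - M)}

/-! ### State discrimination -/

/-- Error probability of the test `(M, 1 - M)` for two equiprobable states:
`P_e = tr ρ₀(1 - M) / 2 + tr ρ₁ M / 2`. -/
def errorProb {m : ℕ} (ρ₀ ρ₁ M : H m →L[ℂ] H m) : ℝ :=
  1 / 2 * (opTrace (ρ₀ ∘L (1 - M))).re + 1 / 2 * (opTrace (ρ₁ ∘L M)).re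

/-- The distinguishability norm `‖ρ₀ - ρ₁‖_C` for a class `C` of binary measurements, defined by
`inf P_e = (1 - ‖ρ₀ - ρ₁‖_C / 2) / 2`. -/
def distNorm {m : ℕ} (C : Set (H m →L[ℂ] H m)) (ρ₀ ρ₁ : H m →L[ℂ] H m) : ℝ :=
  2 * (1 - 2 * sInf (errorProb ρ₀ ρ₁ '' C))

/-- `- (1/n) ln e`, with `ln 0 = -∞`. -/
def rate (n : ℕ) (e : ℝ) : EReal := (-ENNReal.log (ENNReal.ofReal e)) / ((n : ℝ) : EReal)

/-- `- (1/n) ln (1 - ‖ρ₀^{⊗ n} - ρ₁^{⊗ n}‖_C / 2)`, the sequence whose limit is the Chernoff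
coefficient `ξ_C (ρ₀, ρ₁)` under the restriction to the measurements in `C`. -/
def chernoffSeq (C : (N : ℕ) → Set (H N →L[ℂ] H N)) {m : ℕ} (ρ₀ ρ₁ : H m →L[ℂ] H m) (n : ℕ) :
    EReal :=
  rate n (1 - distNorm (C (m * n)) (tensorPow ρ₀ n) (tensorPow ρ₁ n) / 2)

/-- The corresponding sequence for two probability densities:
`- (1/n) ln (1 - ‖p^{⊗ n} - q^{⊗ n}‖_{L¹} / 2)`. -/
def classicalChernoffSeq {m : ℕ} (p q : Phase m → ℝ) (n : ℕ) : EReal :=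
  rate n (1 - (∫ z : Fin n → Phase m, |∏ i, p (z i) - ∏ i, q (z i)|) / 2)

/-- `- ln inf_{0 < s < 1} ∫ p^s q^(1-s)`. -/
def chernoffCoeff {m : ℕ} (p q : Phase m → ℝ) : EReal :=
  -ENNReal.log (⨅ s ∈ Set.Ioo (0 : ℝ) 1, ∫⁻ z, ENNReal.ofReal (p z ^ s * q z ^ (1 - s)))

/-- Probability densities on phase space. -/
def IsProbDensity {m : ℕ} (p : Phase m → ℝ) : Prop :=
  (∀ z, 0 ≤ p z) ∧ Integrable p ∧ ∫ z, p z = 1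

end Bosonic

end

open Bosonic

open MeasureTheory Filter Topology
open scoped ENNReal InnerProductSpace TensorProduct SchwartzMap

noncomputable section

namespace Bosonic

/-! Heuristically tr ρM = ∫ W_ρ · (2π)^m W_M, where 0 ≤ (2π)^m W_M ≤ 1 if W_M and W_{1-M} are
non-negative. A W+ measurement is then a randomised test between the probability densities W₀ and W₁
and cannot beat the best classical test. Gaussian protocols act on phase space by classical
stochastic maps, so their effects are W+. The work lies in giving these sentences a meaning, and in
Chernoff's theorem.

Operators are handled as signed families ∑ ε_k |v_k⟩⟨v_k| with ∑ ‖v_k‖² < ∞. The Wigner function is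
the Fourier transform in s of the correlation ⟨v(x + s), v(x - s)⟩. Fourier inversion regularised by
Gaussians yields its marginals without any prior integrability (`tendsto_integral_gauss_mul_tsum`).
A non-negative Wigner function is then integrable by Fatou's lemma, and its symplectic Fourier
transform is the characteristic function.

GOCC inside W+: the induction over rounds needs a property stronger than W+, namely a non-negative
pairing with every signed family of non-negative Wigner function (`IsPosEffect`), because the
families met on the way need not have Schwartz Wigner functions. Such families are stable under each
step. Adjoining the vacuum multiplies by a Gaussian; a Gaussian unitary is an affine symplectic
change of variables, visible on the characteristic function (`IsPosFamily.gaussianUnitary`); a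
homodyne outcome b fixes the measured positions and integrates out the conjugate momenta
(`IsPosFamily.ae_slice`). The probabilities of the last round are integrals of the position
marginal. Enlarging the class of tests lowers the infimum.

W+ below classical (`errorProb_ge`): as W_M is only a distribution, M is tested on the displacements
of a self-adjoint operator L, not necessarily positive, whose Wigner function is a narrow Gaussian
(`exists_gaussian_wigner`). The function z ↦ tr(M D(z) L D(z)†) lies between 0 and the constant
obtained for M = 1. Its average over W_ρ pairs M with an operator of Wigner function W_ρ * Gaussian.
By injectivity of the Wigner transform (`IsSelfAdjointTraceClass.ext_wigner`) this operator is a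
Gaussian average of displaced copies of ρ, and after normalisation the pairing tends to tr ρM as the
Gaussian narrows. Wigner functions of tensor powers are products, up to a rearrangement of
coordinates.

Chernoff: min(a, b) ≤ a^s b^(1-s) gives one bound. For the other, where the log-likelihood ratio is
bounded, a pointwise inequality compares the minimum of the product densities with geometric means
at three exponents (`prod_indicator_le_min`). Each of these integrates to an n-th power, and at the
minimising s the two corrections are exponentially smaller than the main term. Dini's theorem
removes the truncation. -/

/-! ### Gaussian integrals on `ℝˡ` -/

/-- The Gaussian `exp (- t |s|²)`. -/
def gauss {l : ℕ} (t : ℝ) (s : Conf l) : ℝ := Real.exp (-(t * (s ⬝ᵥ s)))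

theorem gauss_pos {l : ℕ} (t : ℝ) (s : Conf l) : 0 < gauss t s := Real.exp_pos _

theorem dotProduct_self_nonneg' {l : ℕ} (s : Conf l) : 0 ≤ s ⬝ᵥ s :=
  Finset.sum_nonneg fun i _ => mul_self_nonneg (s i)

theorem gauss_le_one {l : ℕ} {t : ℝ} (ht : 0 ≤ t) (s : Conf l) : gauss t s ≤ 1 := by
  rw [gauss, Real.exp_le_one_iff, neg_nonpos]
  exact mul_nonneg ht (dotProduct_self_nonneg' s)

theorem gauss_neg {l : ℕ} (t : ℝ) (s : Conf l) : gauss t (-s) = gauss t s := by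
  simp [gauss]

@[fun_prop]
theorem continuous_dotProduct_of {α : Type*} [TopologicalSpace α] {l : ℕ} {f g : α → Conf l}
    (hf : Continuous f) (hg : Continuous g) : Continuous fun a => f a ⬝ᵥ g a := by
  unfold dotProduct
  fun_prop

@[fun_prop]
theorem continuous_gauss {l : ℕ} (t : ℝ) : Continuous (gauss t : Conf l → ℝ) := by
  unfold gauss
  fun_prop

theorem gauss_eq_prod {l : ℕ} (t : ℝ) (s : Conf l) :
    gauss t s = ∏ i, Real.exp (-t * s i ^ 2) := by
  rw [gauss, ← Real.exp_sum]
  congr 1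
  simp only [dotProduct, ← Finset.mul_sum, neg_mul, Finset.sum_neg_distrib, pow_two]

theorem integrable_gauss {l : ℕ} {t : ℝ} (ht : 0 < t) : Integrable (gauss t : Conf l → ℝ) := by
  have h2 := Integrable.fintype_prod (𝕜 := ℝ) (ι := Fin l)
    (f := fun _ x => Real.exp (-t * x ^ 2))
    (μ := fun _ => volume) (fun _ => integrable_exp_neg_mul_sq ht)
  exact h2.congr (Eventually.of_forall fun s => (gauss_eq_prod t s).symm)

/-- Completing the square. The constant √(π/t) is kept exactly: multiplied by its counterpart √(πt)
it makes the later bounds independent of t. -/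
theorem integral_gauss_mul_cexp {l : ℕ} {t : ℝ} (ht : 0 < t) (c : Conf l) :
    ∫ p : Conf l, (gauss t p : ℂ) * Complex.exp (Complex.I * ((p ⬝ᵥ c : ℝ) : ℂ)) =
      ((Real.sqrt (Real.pi / t) ^ l * gauss (1 / (4 * t)) c : ℝ) : ℂ) := by
  have h := GaussianFourier.integral_cexp_neg_mul_sum_add (b := (t : ℂ)) (by simpa using ht)
    (fun i => Complex.I * (c i : ℂ))
  have e1 : ∀ p : Conf l, (gauss t p : ℂ) * Complex.exp (Complex.I * ((p ⬝ᵥ c : ℝ) : ℂ)) =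
      Complex.exp (-(t : ℂ) * ∑ i, (p i : ℂ) ^ 2 + ∑ i, Complex.I * (c i : ℂ) * p i) := by
    intro p
    rw [gauss, Complex.ofReal_exp, ← Complex.exp_add]
    congr 1
    simp only [dotProduct]
    push_cast
    rw [Finset.mul_sum, Finset.mul_sum, Finset.mul_sum, ← Finset.sum_neg_distrib]
    congr 1
    · exact Finset.sum_congr rfl fun i _ => by ring
    · exact Finset.sum_congr rfl fun i _ => by ring
  simp_rw [e1]
  rw [h, Complex.ofReal_mul]
  congr 1
  · rw [Fintype.card_fin, Complex.ofReal_pow, Real.sqrt_eq_rpow, ← Complex.ofReal_div,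
      Complex.ofReal_cpow (by positivity), ← Complex.cpow_mul_nat]
    congr 1
    push_cast
    ring
  · rw [gauss, Complex.ofReal_exp]
    congr 1
    simp only [dotProduct, mul_pow, Complex.I_sq]
    push_cast
    rw [Finset.mul_sum, Finset.sum_div, ← Finset.sum_neg_distrib]
    refine Finset.sum_congr rfl fun i _ => ?_
    have : (t : ℂ) ≠ 0 := by exact_mod_cast ht.ne'
    field_simp

theorem integral_gauss {l : ℕ} {t : ℝ} (ht : 0 < t) :
    ∫ p : Conf l, gauss t p = Real.sqrt (Real.pi / t) ^ l := by
  have h := integral_gauss_mul_cexp (l := l) ht 0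
  have e : ∀ p : Conf l, (gauss t p : ℂ) * Complex.exp (Complex.I * ((p ⬝ᵥ (0 : Conf l) : ℝ) : ℂ))
      = ((gauss t p : ℝ) : ℂ) := fun p => by simp
  simp_rw [e] at h
  rw [integral_complex_ofReal] at h
  have h' := Complex.ofReal_injective h
  rw [h']
  simp [gauss]

theorem tendsto_gauss_zero {l : ℕ} (s : Conf l) :
    Tendsto (fun t : ℝ => gauss t s) (𝓝 0) (𝓝 1) := by
  have : Continuous fun t : ℝ => gauss t s := by unfold gauss; fun_prop
  simpa [gauss] using this.tendsto 0

/-- Gaussians form an approximate identity. -/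
theorem tendsto_integral_gauss_smul {l : ℕ} {Ψ : Conf l → ℂ} {C : ℝ} (hC : ∀ s, ‖Ψ s‖ ≤ C)
    (hm : AEStronglyMeasurable Ψ volume) (hc : ContinuousAt Ψ 0) :
    Tendsto (fun t : ℝ => ((Real.sqrt (Real.pi / t) ^ l : ℝ) : ℂ) *
        ∫ s, (gauss (1 / t) s : ℂ) * Ψ s)
      (𝓝[>] 0) (𝓝 ((Real.pi ^ l : ℝ) * Ψ 0)) := by
  -- The substitution s ↦ √t s freezes the Gaussian, which then dominates the integrand.
  have key : Tendsto (fun t : ℝ => ∫ s, (gauss 1 s : ℂ) * Ψ (Real.sqrt t • s))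
      (𝓝[>] 0) (𝓝 (∫ s : Conf l, (gauss 1 s : ℂ) * Ψ 0)) := by
    refine tendsto_integral_filter_of_dominated_convergence
      (fun s : Conf l => gauss 1 s * C) ?_ ?_ ?_ ?_
    · filter_upwards [self_mem_nhdsWithin] with t ht
      have h0 : Real.sqrt t ≠ 0 := (Real.sqrt_pos.2 ht).ne'
      refine ((Complex.continuous_ofReal.comp (continuous_gauss 1)).aestronglyMeasurable).mul ?_
      refine hm.comp_quasiMeasurePreserving ⟨by fun_prop, ?_⟩
      rw [Measure.map_addHaar_smul _ h0]
      exact Measure.smul_absolutelyContinuous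
    · refine Eventually.of_forall fun t => Eventually.of_forall fun s => ?_
      rw [norm_mul, Complex.norm_real, Real.norm_of_nonneg (gauss_pos _ _).le]
      exact mul_le_mul_of_nonneg_left (hC _) (gauss_pos _ _).le
    · exact (integrable_gauss one_pos).mul_const C
    · refine Eventually.of_forall fun s => Tendsto.const_mul _ ?_
      have h1 : Tendsto (fun t : ℝ => Real.sqrt t • s) (𝓝[>] 0) (𝓝 0) := by
        have : Continuous fun t : ℝ => Real.sqrt t • s := by fun_prop
        have h := this.tendsto 0
        rw [Real.sqrt_zero, zero_smul] at h
        exact h.mono_left nhdsWithin_le_nhds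
      exact hc.tendsto.comp h1
  have e0 : ∫ s : Conf l, (gauss 1 s : ℂ) * Ψ 0 = (Real.sqrt Real.pi ^ l : ℝ) * Ψ 0 := by
    rw [integral_mul_const, integral_complex_ofReal, integral_gauss one_pos, div_one]
  rw [e0] at key
  have key2 := key.const_mul ((Real.sqrt Real.pi ^ l : ℝ) : ℂ)
  have e1 : ((Real.sqrt Real.pi ^ l : ℝ) : ℂ) * ((Real.sqrt Real.pi ^ l : ℝ) * Ψ 0) =
      (Real.pi ^ l : ℝ) * Ψ 0 := by
    rw [← mul_assoc, ← Complex.ofReal_mul, ← mul_pow, Real.mul_self_sqrt Real.pi_pos.le]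
  rw [e1] at key2
  refine key2.congr' ?_
  filter_upwards [self_mem_nhdsWithin] with t ht
  have ht' : (0 : ℝ) < t := ht
  have hst : 0 < Real.sqrt t := Real.sqrt_pos.2 ht
  have e2 : ∀ s : Conf l, (gauss 1 s : ℂ) * Ψ (Real.sqrt t • s) =
      (fun s' : Conf l => (gauss (1 / t) s' : ℂ) * Ψ s') (Real.sqrt t • s) := by
    intro s
    simp only [gauss, smul_dotProduct, dotProduct_smul, smul_eq_mul]
    rw [← mul_assoc (√t), Real.mul_self_sqrt ht'.le, ← mul_assoc, one_div_mul_cancel ht'.ne']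
  simp_rw [e2]
  rw [Measure.integral_comp_smul volume (fun s' : Conf l => (gauss (1 / t) s' : ℂ) * Ψ s'),
    Real.sqrt_div Real.pi_pos.le, div_pow]
  simp only [Module.finrank_fintype_fun_eq_card, Fintype.card_fin]
  rw [abs_of_pos (by positivity), Complex.real_smul]
  push_cast
  ring

/-! ### Displacement operators, parity and displaced parity -/

theorem norm_compIso {m : ℕ} (f : Conf m → Conf m) (hf : MeasurePreserving f volume volume)
    (u : H m) : ‖compIso f hf u‖ = ‖u‖ :=
  (Lp.compMeasurePreservingₗᵢ ℂ f hf).norm_map u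

theorem coeFn_compIso {m : ℕ} (f : Conf m → Conf m) (hf : MeasurePreserving f volume volume)
    (u : H m) : compIso f hf u =ᵐ[volume] fun y => u (f y) :=
  Lp.coeFn_compMeasurePreserving u hf

theorem coeFn_phaseMul {m : ℕ} (z : Phase m) (u : H m) :
    phaseMul z u =ᵐ[volume] fun y => phaseFun z y * u y :=
  (memLp_phaseFun_mul z u).coeFn_toLp

theorem norm_eq_of_ae {m : ℕ} {u v : H m} (h : ∀ᵐ y, ‖u y‖ = ‖v y‖) : ‖u‖ = ‖v‖ :=
  le_antisymm (Lp.norm_le_norm_of_ae_le (h.mono fun _ h => h.le))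
    (Lp.norm_le_norm_of_ae_le (h.mono fun _ h => h.ge))

theorem norm_phaseMul {m : ℕ} (z : Phase m) (u : H m) : ‖phaseMul z u‖ = ‖u‖ := by
  refine norm_eq_of_ae ?_
  filter_upwards [coeFn_phaseMul z u] with y hy
  rw [hy, norm_mul, norm_phaseFun, one_mul]

theorem norm_displacement {m : ℕ} (z : Phase m) (u : H m) : ‖displacement z u‖ = ‖u‖ := by
  rw [displacement, ContinuousLinearMap.comp_apply, norm_phaseMul, norm_compIso]

theorem norm_parity {m : ℕ} (u : H m) : ‖parity m u‖ = ‖u‖ := norm_compIso _ _ u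

theorem coeFn_parity {m : ℕ} (u : H m) : parity m u =ᵐ[volume] fun y => u (-y) :=
  coeFn_compIso _ _ u

theorem coeFn_displacement {m : ℕ} (z : Phase m) (u : H m) :
    displacement z u =ᵐ[volume] fun y => phaseFun z y * u (y - z.1) := by
  filter_upwards [coeFn_phaseMul z (compIso (fun y => y - z.1)
    (measurePreserving_sub_right volume z.1) u), coeFn_compIso (fun y => y - z.1)
    (measurePreserving_sub_right volume z.1) u] with y h1 h2
  rw [displacement, ContinuousLinearMap.comp_apply, h1, h2]

theorem ae_sub {m : ℕ} (a : Conf m) {P : Conf m → Prop} (h : ∀ᵐ y, P y) : ∀ᵐ y, P (y - a) :=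
  (measurePreserving_sub_right volume a).quasiMeasurePreserving.ae h

theorem ae_neg {m : ℕ} {P : Conf m → Prop} (h : ∀ᵐ y, P y) : ∀ᵐ y, P (-y) :=
  (Measure.measurePreserving_neg volume).quasiMeasurePreserving.ae h

theorem displacement_displacement {m : ℕ} (z w : Phase m) (u : H m) :
    displacement z (displacement w u) =
      Complex.exp (Complex.I * ((-(symp z w) / 2 : ℝ) : ℂ)) • displacement (z + w) u := by
  refine Lp.ext ?_
  filter_upwards [coeFn_displacement z (displacement w u), coeFn_displacement (z + w) u,
    ae_sub z.1 (coeFn_displacement w u), Lp.coeFn_smul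
      (Complex.exp (Complex.I * ((-(symp z w) / 2 : ℝ) : ℂ))) (displacement (z + w) u)]
    with y h1 h2 h3 h4
  rw [h1, h3, h4, Pi.smul_apply, h2, smul_eq_mul, ← mul_assoc, ← mul_assoc]
  congr 1
  · rw [phaseFun, phaseFun, phaseFun, ← Complex.exp_add, ← Complex.exp_add, ← mul_add, ← mul_add]
    congr 2
    rw [← Complex.ofReal_add, ← Complex.ofReal_add]
    congr 1
    simp only [symp, Prod.fst_add, Prod.snd_add, add_dotProduct, dotProduct_add, dotProduct_sub]
    rw [dotProduct_comm z.1 w.2]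
    ring
  · rw [Prod.fst_add, sub_sub]

theorem displacement_zero {m : ℕ} (u : H m) : displacement 0 u = u := by
  refine Lp.ext ?_
  filter_upwards [coeFn_displacement 0 u] with y h1
  rw [h1]
  simp [phaseFun]

theorem symp_neg_self {m : ℕ} (z : Phase m) : symp z (-z) = 0 := by
  simp [symp, dotProduct_comm z.1 z.2]

theorem symp_self {m : ℕ} (z : Phase m) : symp z z = 0 := by
  simp [symp, dotProduct_comm z.1 z.2]

theorem displacement_neg_displacement {m : ℕ} (z : Phase m) (u : H m) :
    displacement z (displacement (-z) u) = u := by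
  rw [displacement_displacement, symp_neg_self, add_neg_cancel, displacement_zero]
  simp

/-- The displacement operator as an isometry. -/
def displacementIso {m : ℕ} (z : Phase m) : H m →ₗᵢ[ℂ] H m :=
  ⟨(displacement z).toLinearMap, norm_displacement z⟩

theorem inner_displacement {m : ℕ} (z : Phase m) (u v : H m) :
    ⟪displacement z u, displacement z v⟫_ℂ = ⟪u, v⟫_ℂ :=
  (displacementIso z).inner_map_map u v

theorem inner_displacement_left {m : ℕ} (z : Phase m) (u v : H m) :
    ⟪displacement z u, v⟫_ℂ = ⟪u, displacement (-z) v⟫_ℂ := by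
  conv_lhs => rw [← displacement_neg_displacement z v]
  exact inner_displacement z u _

theorem adjoint_displacement {m : ℕ} (z : Phase m) :
    ContinuousLinearMap.adjoint (displacement z) = displacement (-z) := by
  refine ((ContinuousLinearMap.eq_adjoint_iff _ _).2 fun u v => ?_).symm
  rw [inner_displacement_left, neg_neg]

theorem parity_parity {m : ℕ} (u : H m) : parity m (parity m u) = u := by
  refine Lp.ext ?_
  filter_upwards [coeFn_parity (parity m u), ae_neg (coeFn_parity u)] with y h1 h2
  rw [h1, h2, neg_neg]

theorem inner_parity_left {m : ℕ} (u v : H m) : ⟪parity m u, v⟫_ℂ = ⟪u, parity m v⟫_ℂ := by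
  have h : ⟪parity m u, parity m (parity m v)⟫_ℂ = ⟪u, parity m v⟫_ℂ :=
    (⟨(parity m).toLinearMap, norm_parity⟩ : H m →ₗᵢ[ℂ] H m).inner_map_map u (parity m v)
  rwa [parity_parity] at h

theorem parity_displacement {m : ℕ} (z : Phase m) (u : H m) :
    parity m (displacement z u) = displacement (-z) (parity m u) := by
  refine Lp.ext ?_
  filter_upwards [coeFn_parity (displacement z u), ae_neg (coeFn_displacement z u),
    coeFn_displacement (-z) (parity m u), ae_sub (-z).1 (coeFn_parity u)] with y h1 h2 h3 h4
  rw [h1, h2, h3, h4]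
  congr 1
  · simp [phaseFun]
  · congr 1
    simp [sub_eq_add_neg, add_comm]

theorem displacedParity_apply {m : ℕ} (z : Phase m) (u : H m) :
    displacedParity z u = displacement z (parity m (displacement (-z) u)) := by
  rw [displacedParity, adjoint_displacement]
  rfl

/-- Parity reverses displacements, so the two displacements merge, with trivial phase because `symp
z z = 0`. This form ties Wigner functions to characteristic functions. -/
theorem displacedParity_eq {m : ℕ} (z : Phase m) (u : H m) :
    displacedParity z u = displacement ((2 : ℝ) • z) (parity m u) := by
  rw [displacedParity_apply, parity_displacement, neg_neg, displacement_displacement, symp_self,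
    two_smul]
  simp

theorem inner_displacedParity_left {m : ℕ} (z : Phase m) (u v : H m) :
    ⟪displacedParity z u, v⟫_ℂ = ⟪u, displacedParity z v⟫_ℂ := by
  rw [displacedParity_apply, displacedParity_apply, inner_displacement_left, inner_parity_left,
    inner_displacement_left, neg_neg]

theorem norm_displacedParity {m : ℕ} (z : Phase m) (u : H m) : ‖displacedParity z u‖ = ‖u‖ := by
  rw [displacedParity_eq, norm_displacement, norm_parity]

/-- Covariance under phase space translations, from the Weyl relations; it turns displaced operators
into translated Wigner functions. -/
theorem displacement_displacedParity {m : ℕ} (z w : Phase m) (u : H m) :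
    displacedParity z (displacement w u) = displacement w (displacedParity (z - w) u) := by
  rw [displacedParity_eq, parity_displacement, displacement_displacement, displacedParity_eq,
    displacement_displacement]
  have e1 : symp ((2 : ℝ) • z) (-w) = symp w ((2 : ℝ) • (z - w)) := by
    simp only [symp, Prod.smul_fst, Prod.smul_snd, Prod.fst_neg, Prod.snd_neg, Prod.fst_sub,
      Prod.snd_sub, smul_dotProduct, dotProduct_smul, dotProduct_neg, dotProduct_sub, smul_eq_mul]
    rw [dotProduct_comm w.1 z.2, dotProduct_comm w.2 z.1, dotProduct_comm w.2 w.1]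
    ring
  have e2 : (2 : ℝ) • z + -w = w + (2 : ℝ) • (z - w) := by module
  rw [e1, e2]

theorem coeFn_displacedParity {m : ℕ} (z : Phase m) (u : H m) :
    displacedParity z u =ᵐ[volume] fun y =>
      Complex.exp (Complex.I * ((z.2 ⬝ᵥ ((2 : ℝ) • (y - z.1)) : ℝ) : ℂ)) *
        u ((2 : ℝ) • z.1 - y) := by
  rw [displacedParity_eq]
  filter_upwards [coeFn_displacement ((2 : ℝ) • z) (parity m u),
    ae_sub ((2 : ℝ) • z).1 (coeFn_parity u)] with y h1 h2
  rw [h1, h2]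
  congr 1
  · rw [phaseFun]
    congr 3
    simp only [Prod.smul_fst, Prod.smul_snd, smul_dotProduct, dotProduct_smul, dotProduct_sub,
      smul_eq_mul]
    ring
  · simp

/-! ### Strong continuity -/

theorem continuous_compIso_sub {m : ℕ} (u : H m) :
    Continuous fun x : Conf m =>
      compIso (fun y => y - x) (measurePreserving_sub_right volume x) u := by
  let g : Conf m → C(Conf m, Conf m) := fun x => ⟨fun y => y - x, by fun_prop⟩
  have hg : Continuous g := by
    let G : C(Conf m × Conf m, Conf m) := ⟨fun a => a.2 - a.1, by fun_prop⟩
    exact G.curry.continuous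
  exact Continuous.compMeasurePreservingLp (f := fun _ : Conf m => u) (g := g)
    continuous_const hg (fun x => measurePreserving_sub_right volume x) (by simp)

/-- Dominated convergence: the phases converge pointwise and their differences are at most 2. -/
theorem continuous_phaseMul {m : ℕ} (u : H m) : Continuous fun z : Phase m => phaseMul z u := by
  rw [continuous_iff_seqContinuous]
  intro zs z hz
  rw [Lp.tendsto_Lp_iff_tendsto_eLpNorm']
  have hb : ∀ n, eLpNorm (⇑(phaseMul (zs n) u) - ⇑(phaseMul z u)) 2 volume =
      eLpNorm (fun y => (phaseFun (zs n) y - phaseFun z y) * u y) 2 volume := by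
    intro n
    refine eLpNorm_congr_ae ?_
    filter_upwards [coeFn_phaseMul (zs n) u, coeFn_phaseMul z u] with y h1 h2
    rw [Pi.sub_apply, h1, h2, sub_mul]
  simp only [Function.comp_def, hb]
  have hsq : ∀ n, eLpNorm (fun y => (phaseFun (zs n) y - phaseFun z y) * u y) 2 volume =
      (∫⁻ y, ‖(phaseFun (zs n) y - phaseFun z y) * u y‖ₑ ^ (2 : ℝ)) ^ (1 / (2 : ℝ)) := by
    intro n
    rw [eLpNorm_eq_lintegral_rpow_enorm_toReal (by norm_num) (by norm_num)]
    norm_num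
  simp only [hsq]
  have hc : ∀ w : Phase m, Continuous fun y => phaseFun w y := continuous_phaseFun
  have hlim : Tendsto (fun n => ∫⁻ y, ‖(phaseFun (zs n) y - phaseFun z y) * u y‖ₑ ^ (2 : ℝ))
      atTop (𝓝 (∫⁻ _y : Conf m, (0 : ℝ≥0∞))) := by
    refine tendsto_lintegral_of_dominated_convergence' (fun y => (2 * ‖u y‖ₑ) ^ (2 : ℝ)) ?_ ?_ ?_ ?_
    · intro n
      exact ((((hc _).sub (hc _)).aestronglyMeasurable.mul
        (Lp.aestronglyMeasurable u)).enorm).pow_const _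
    · intro n
      refine Eventually.of_forall fun y => ?_
      simp only [enorm_mul]
      gcongr
      refine (enorm_sub_le).trans ?_
      rw [← ofReal_norm, ← ofReal_norm, norm_phaseFun, norm_phaseFun]
      norm_num
    · have h := (Lp.memLp u).eLpNorm_lt_top
      rw [eLpNorm_lt_top_iff_lintegral_rpow_enorm_lt_top (by norm_num) (by norm_num)] at h
      simp_rw [ENNReal.mul_rpow_of_nonneg _ _ (zero_le_two (α := ℝ))]
      rw [lintegral_const_mul' _ _ (by finiteness)]
      exact ENNReal.mul_ne_top (by finiteness) (by simpa using h.ne)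
    · refine Eventually.of_forall fun y => ?_
      have hcz : Continuous fun w : Phase m =>
          ‖(phaseFun w y - phaseFun z y) * u y‖ₑ ^ (2 : ℝ) := by
        have : Continuous fun w : Phase m => phaseFun w y := by
          unfold phaseFun
          fun_prop
        exact (ENNReal.continuous_rpow_const).comp
          (continuous_enorm.comp ((this.sub continuous_const).mul continuous_const))
      have h := (hcz.tendsto z).comp hz
      simpa [Function.comp_def] using h
  have := (ENNReal.continuous_rpow_const (y := 1 / (2 : ℝ))).tendsto _ |>.comp hlim
  simpa [Function.comp_def] using this

/-- Joint strong continuity of a strongly continuous family of isometries. -/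
theorem continuous_isometry_apply {X E F : Type*} [TopologicalSpace X] [NormedAddCommGroup E]
    [NormedSpace ℂ E] [NormedAddCommGroup F] [NormedSpace ℂ F] {A : X → E →L[ℂ] F}
    (hA : ∀ x u, ‖A x u‖ ≤ ‖u‖) (hc : ∀ u, Continuous fun x => A x u) {g : X → E}
    (hg : Continuous g) : Continuous fun x => A x (g x) := by
  rw [continuous_iff_continuousAt]
  intro x₀
  have h1 : Tendsto (fun x => A x (g x - g x₀)) (𝓝 x₀) (𝓝 0) := by
    refine squeeze_zero_norm (fun x => hA x _) ?_
    have h : Tendsto (fun x => g x - g x₀) (𝓝 x₀) (𝓝 0) := by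
      simpa using (hg.tendsto x₀).sub_const (g x₀)
    simpa using h.norm
  have h2 := h1.add ((hc (g x₀)).tendsto x₀)
  simpa [ContinuousAt] using h2

theorem continuous_displacement {m : ℕ} (u : H m) :
    Continuous fun z : Phase m => displacement z u := by
  have h := continuous_isometry_apply (A := fun z : Phase m => phaseMul z)
    (fun z u => (norm_phaseMul z u).le) continuous_phaseMul
    ((continuous_compIso_sub u).comp continuous_fst)
  exact h

theorem continuous_displacement_apply {m : ℕ} {X : Type*} [TopologicalSpace X] {z : X → Phase m}
    {g : X → H m} (hz : Continuous z) (hg : Continuous g) :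
    Continuous fun x => displacement (z x) (g x) :=
  continuous_isometry_apply (A := fun x => displacement (z x))
    (fun _ u => (norm_displacement _ u).le) (fun u => (continuous_displacement u).comp hz) hg

theorem continuous_displacedParity {m : ℕ} (u : H m) :
    Continuous fun z : Phase m => displacedParity z u := by
  simp_rw [displacedParity_eq]
  exact (continuous_displacement _).comp (by fun_prop)

end Bosonic

namespace Bosonic

/-! ### Separability, traces -/

instance fact_two_ne_top : Fact ((2 : ℝ≥0∞) ≠ ∞) := ⟨by norm_num⟩

/-- Distinct orthonormal vectors have distance √2, so balls of radius 1/2 about them are disjoint,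
and a separable space has room for countably many only. Countability is what allows termwise
integration over families. -/
instance countable_basisIdx (m : ℕ) : Countable (basisIdx m) := by
  have hsep : TopologicalSpace.SeparableSpace (H m) := inferInstance
  refine Pairwise.countable_of_isOpen_disjoint (α := H m)
    (s := fun i : basisIdx m => Metric.ball (onb m i) (1 / 2)) ?_
    (fun _ => Metric.isOpen_ball)
    (fun i => ⟨onb m i, Metric.mem_ball_self (by norm_num)⟩)
  intro i j hij
  refine Metric.ball_disjoint_ball ?_
  have h1 : ‖onb m i - onb m j‖ * ‖onb m i - onb m j‖ = 2 := by
    have := norm_sub_sq (𝕜 := ℂ) (onb m i) (onb m j)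
    rw [(onb m).orthonormal.2 hij, (onb m).orthonormal.1 i, (onb m).orthonormal.1 j] at this
    rw [← pow_two, this]
    norm_num
  rw [dist_eq_norm]
  nlinarith [norm_nonneg (onb m i - onb m j)]

theorem tsum_norm_inner_mul_inner_le {m : ℕ} (u v : H m) :
    (Summable fun i => ‖⟪onb m i, v⟫_ℂ * ⟪u, onb m i⟫_ℂ‖) ∧
      ∑' i, ‖⟪onb m i, v⟫_ℂ * ⟪u, onb m i⟫_ℂ‖ ≤ ‖u‖ * ‖v‖ := by
  have hu := (onb m).orthonormal.inner_products_summable u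
  have hv := (onb m).orthonormal.inner_products_summable v
  have h := Real.summable_and_inner_le_Lp_mul_Lq_tsum_of_nonneg (p := 2) (q := 2)
    (f := fun i => ‖⟪onb m i, v⟫_ℂ‖) (g := fun i => ‖⟪onb m i, u⟫_ℂ‖)
    Real.HolderConjugate.two_two (fun _ => norm_nonneg _) (fun _ => norm_nonneg _)
    (by simpa using hv) (by simpa using hu)
  have e : ∀ i, ‖⟪onb m i, v⟫_ℂ * ⟪u, onb m i⟫_ℂ‖ =
      ‖⟪onb m i, v⟫_ℂ‖ * ‖⟪onb m i, u⟫_ℂ‖ := fun i => by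
    rw [norm_mul, norm_inner_symm u]
  simp_rw [e]
  refine ⟨h.1, h.2.trans ?_⟩
  have hu' := (onb m).orthonormal.tsum_inner_products_le u
  have hv' := (onb m).orthonormal.tsum_inner_products_le v
  rw [mul_comm ‖u‖]
  have key : ∀ w : H m, ∑' i, ‖⟪onb m i, w⟫_ℂ‖ ^ 2 ≤ ‖w‖ ^ 2 →
      (∑' i, ‖⟪onb m i, w⟫_ℂ‖ ^ (2 : ℝ)) ^ (1 / (2 : ℝ)) ≤ ‖w‖ := by
    intro w hw
    rw [← Real.sqrt_eq_rpow]
    refine Real.sqrt_le_iff.2 ⟨norm_nonneg _, ?_⟩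
    simpa using hw
  exact mul_le_mul (key v hv') (key u hu')
    (Real.rpow_nonneg (tsum_nonneg fun i => Real.rpow_nonneg (norm_nonneg _) _) _) (norm_nonneg _)

/-- Parseval's identity under the integral sign. By Cauchy–Schwarz all finite sums of absolute
values are at most ‖u a‖ ‖v a‖, which justifies the exchange. -/
theorem hasSum_integral_inner_mul_inner {α : Type*} [MeasurableSpace α] {μ : Measure α} {m : ℕ}
    {u v : α → H m} (hu : AEStronglyMeasurable u μ) (hv : AEStronglyMeasurable v μ)
    (hi : Integrable (fun a => ‖u a‖ * ‖v a‖) μ) :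
    HasSum (fun i => ∫ a, ⟪onb m i, v a⟫_ℂ * ⟪u a, onb m i⟫_ℂ ∂μ) (∫ a, ⟪u a, v a⟫_ℂ ∂μ) := by
  have hmeas : ∀ i, AEStronglyMeasurable (fun a => ⟪onb m i, v a⟫_ℂ * ⟪u a, onb m i⟫_ℂ) μ :=
    fun i => (aestronglyMeasurable_const.inner hv).mul (hu.inner aestronglyMeasurable_const)
  have hbd : ∀ i a, ‖⟪onb m i, v a⟫_ℂ * ⟪u a, onb m i⟫_ℂ‖ ≤ ‖u a‖ * ‖v a‖ := fun i a =>
    ((tsum_norm_inner_mul_inner_le (u a) (v a)).1.le_tsum i fun _ _ => norm_nonneg _).trans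
      (tsum_norm_inner_mul_inner_le (u a) (v a)).2
  have hint : ∀ i, Integrable (fun a => ⟪onb m i, v a⟫_ℂ * ⟪u a, onb m i⟫_ℂ) μ := fun i =>
    hi.mono' (hmeas i) (Eventually.of_forall (hbd i))
  have h := hasSum_integral_of_summable_integral_norm hint ?_
  · have e : ∀ a, ∑' i, ⟪onb m i, v a⟫_ℂ * ⟪u a, onb m i⟫_ℂ = ⟪u a, v a⟫_ℂ := fun a => by
      rw [← (onb m).tsum_inner_mul_inner]
      exact tsum_congr fun i => mul_comm _ _
    simpa only [e] using h
  · refine summable_of_sum_le (c := ∫ a, ‖u a‖ * ‖v a‖ ∂μ)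
      (fun i => integral_nonneg fun a => norm_nonneg _) fun s => ?_
    rw [← integral_finsetSum _ fun i _ => (hint i).norm]
    refine integral_mono (integrable_finsetSum _ fun i _ => (hint i).norm) hi fun a => ?_
    exact ((tsum_norm_inner_mul_inner_le (u a) (v a)).1.sum_le_tsum s
      fun _ _ => norm_nonneg _).trans (tsum_norm_inner_mul_inner_le (u a) (v a)).2

theorem ContinuousLinearMap_inner_right {m : ℕ} (X : H m →L[ℂ] H m) (f g : H m) :
    ⟪f, X g⟫_ℂ = ⟪ContinuousLinearMap.adjoint X f, g⟫_ℂ :=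
  (ContinuousLinearMap.adjoint_inner_left X g f).symm

/-- The trace of `X T` for `T = ∫ |v⟩⟨u|`. -/
theorem hasSum_trace_comp_left {α : Type*} [MeasurableSpace α] {μ : Measure α} {m : ℕ}
    {u v : α → H m} (hu : AEStronglyMeasurable u μ) (hv : AEStronglyMeasurable v μ)
    (hi : Integrable (fun a => ‖u a‖ * ‖v a‖) μ) {T : H m →L[ℂ] H m}
    (hT : ∀ f g, ⟪f, T g⟫_ℂ = ∫ a, ⟪f, v a⟫_ℂ * ⟪u a, g⟫_ℂ ∂μ) (X : H m →L[ℂ] H m) :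
    HasSum (fun i => ⟪onb m i, (X ∘L T) (onb m i)⟫_ℂ) (∫ a, ⟪u a, X (v a)⟫_ℂ ∂μ) := by
  have h := hasSum_integral_inner_mul_inner hu (X.continuous.comp_aestronglyMeasurable hv)
    ((hi.const_mul ‖X‖).mono' (hu.norm.mul (X.continuous.comp_aestronglyMeasurable hv).norm)
      (Eventually.of_forall fun a => by
        rw [norm_mul, norm_norm, norm_norm]
        calc _ ≤ ‖u a‖ * (‖X‖ * ‖v a‖) := by gcongr; exact X.le_opNorm _
          _ = _ := by ring))
  refine h.congr_fun fun i => ?_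
  rw [ContinuousLinearMap.comp_apply, ContinuousLinearMap_inner_right, hT]
  simp only [ContinuousLinearMap_inner_right X]

/-- The trace of `T X` for `T = ∫ |v⟩⟨u|`. -/
theorem hasSum_trace_comp_right {α : Type*} [MeasurableSpace α] {μ : Measure α} {m : ℕ}
    {u v : α → H m} (hu : AEStronglyMeasurable u μ) (hv : AEStronglyMeasurable v μ)
    (hi : Integrable (fun a => ‖u a‖ * ‖v a‖) μ) {T : H m →L[ℂ] H m}
    (hT : ∀ f g, ⟪f, T g⟫_ℂ = ∫ a, ⟪f, v a⟫_ℂ * ⟪u a, g⟫_ℂ ∂μ) (X : H m →L[ℂ] H m) :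
    HasSum (fun i => ⟪onb m i, (T ∘L X) (onb m i)⟫_ℂ) (∫ a, ⟪u a, X (v a)⟫_ℂ ∂μ) := by
  set Y := ContinuousLinearMap.adjoint X
  have h := hasSum_integral_inner_mul_inner (Y.continuous.comp_aestronglyMeasurable hu) hv
    ((hi.const_mul ‖Y‖).mono' ((Y.continuous.comp_aestronglyMeasurable hu).norm.mul hv.norm)
      (Eventually.of_forall fun a => by
        rw [norm_mul, norm_norm, norm_norm]
        calc _ ≤ (‖Y‖ * ‖u a‖) * ‖v a‖ := by gcongr; exact Y.le_opNorm _
          _ = _ := by ring))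
  simp only [Y, ← ContinuousLinearMap_inner_right] at h
  refine h.congr_fun fun i => ?_
  rw [ContinuousLinearMap.comp_apply, hT]

/-! ### Countable families of vectors with signs -/

/-- Countable families of vectors `v k` with signs `ε k` and `∑ ‖v k‖² < ∞`; they describe
the operators `∑ ε k |v k⟩⟨v k|`. -/
structure IsSignedFamily {ι : Type*} {m : ℕ} (ε : ι → ℝ) (v : ι → H m) : Prop where
  sign : ∀ k, |ε k| ≤ 1
  summable : Summable fun k => ‖v k‖ ^ 2

/-- `T = ∑ ε k |v k⟩⟨v k|`, in the weak sense. -/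
def Represents {ι : Type*} {m : ℕ} (ε : ι → ℝ) (v : ι → H m) (T : H m →L[ℂ] H m) : Prop :=
  ∀ f g, HasSum (fun k => (ε k : ℂ) * (⟪f, v k⟫_ℂ * ⟪v k, g⟫_ℂ)) ⟪f, T g⟫_ℂ

theorem IsSignedFamily.norm_le {ι : Type*} {m : ℕ} {ε : ι → ℝ} {v : ι → H m}
    (h : IsSignedFamily ε v) (k : ι) {X : H m → H m} {C : ℝ} (hX : ∀ f, ‖X f‖ ≤ C * ‖f‖) :
    ‖(ε k : ℂ) * ⟪v k, X (v k)⟫_ℂ‖ ≤ C * ‖v k‖ ^ 2 := by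
  rw [norm_mul, Complex.norm_real, Real.norm_eq_abs]
  calc |ε k| * ‖⟪v k, X (v k)⟫_ℂ‖ ≤ 1 * (‖v k‖ * (C * ‖v k‖)) := by
        gcongr
        · exact h.sign k
        · exact (norm_inner_le_norm _ _).trans (by gcongr; exact hX _)
    _ = _ := by ring

theorem IsSignedFamily.summable_inner {ι : Type*} {m : ℕ} {ε : ι → ℝ} {v : ι → H m}
    (h : IsSignedFamily ε v) (X : H m →L[ℂ] H m) :
    Summable fun k => (ε k : ℂ) * ⟪v k, X (v k)⟫_ℂ :=
  Summable.of_norm_bounded (h.summable.mul_left ‖X‖) fun k => h.norm_le k X.le_opNorm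

theorem IsSignedFamily.hasSum_trace {ι : Type*} [Countable ι] {m : ℕ} {ε : ι → ℝ} {v : ι → H m}
    (h : IsSignedFamily ε v) {T : H m →L[ℂ] H m} (hT : Represents ε v T) (X : H m →L[ℂ] H m) :
    HasSum (fun i => ⟪onb m i, (X ∘L T) (onb m i)⟫_ℂ) (∑' k, (ε k : ℂ) * ⟪v k, X (v k)⟫_ℂ) ∧
      HasSum (fun i => ⟪onb m i, (T ∘L X) (onb m i)⟫_ℂ)
        (∑' k, (ε k : ℂ) * ⟪v k, X (v k)⟫_ℂ) := by
  -- The sum over k is read as an integral against counting measure, with the sign moved into one of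
  -- the two vectors, so that the trace formulas for integrals of rank one operators apply.
  let _ : MeasurableSpace ι := ⊤
  have hm : ∀ g : ι → H m, AEStronglyMeasurable g Measure.count := fun g =>
    (StronglyMeasurable.of_discrete).aestronglyMeasurable
  have hbd : ∀ k, ‖v k‖ * ‖(ε k : ℂ) • v k‖ ≤ ‖v k‖ ^ 2 := fun k => by
    rw [norm_smul, Complex.norm_real, Real.norm_eq_abs]
    nlinarith [h.sign k, mul_nonneg (norm_nonneg (v k)) (norm_nonneg (v k))]
  have hi : Integrable (fun k => ‖v k‖ * ‖(ε k : ℂ) • v k‖) Measure.count := by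
    rw [integrable_count_iff]
    refine Summable.of_nonneg_of_le (fun _ => norm_nonneg _) (fun k => ?_) h.summable
    rw [Real.norm_of_nonneg (by positivity)]
    exact hbd k
  have hcount : ∀ F : ι → ℂ, (∃ C, ∀ k, ‖F k‖ ≤ C * ‖v k‖ ^ 2) →
      ∫ k, F k ∂Measure.count = ∑' k, F k := by
    rintro F ⟨C, hC⟩
    rw [integral_countable]
    · simp [Measure.real]
    · rw [integrable_count_iff]
      exact Summable.of_nonneg_of_le (fun _ => norm_nonneg _) hC (h.summable.mul_left C)
  have hT' : ∀ f g, ⟪f, T g⟫_ℂ = ∫ k, ⟪f, (ε k : ℂ) • v k⟫_ℂ * ⟪v k, g⟫_ℂ ∂Measure.count := by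
    intro f g
    rw [hcount, ← (hT f g).tsum_eq]
    · exact tsum_congr fun k => by rw [inner_smul_right, mul_assoc]
    · refine ⟨‖f‖ * ‖g‖, fun k => ?_⟩
      rw [norm_mul]
      calc _ ≤ (‖f‖ * ‖(ε k : ℂ) • v k‖) * (‖v k‖ * ‖g‖) := by
            gcongr <;> exact norm_inner_le_norm _ _
        _ = (‖f‖ * ‖g‖) * (‖v k‖ * ‖(ε k : ℂ) • v k‖) := by ring
        _ ≤ _ := by gcongr; exact hbd k
  have hX : ∫ k, ⟪v k, X ((ε k : ℂ) • v k)⟫_ℂ ∂Measure.count =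
      ∑' k, (ε k : ℂ) * ⟪v k, X (v k)⟫_ℂ := by
    simp only [map_smul, inner_smul_right]
    exact hcount _ ⟨‖X‖, fun k => h.norm_le k X.le_opNorm⟩
  rw [← hX]
  exact ⟨hasSum_trace_comp_left (hm _) (hm _) hi hT' X,
    hasSum_trace_comp_right (hm _) (hm _) hi hT' X⟩

theorem IsSignedFamily.opTrace_left {ι : Type*} [Countable ι] {m : ℕ} {ε : ι → ℝ} {v : ι → H m}
    (h : IsSignedFamily ε v) {T : H m →L[ℂ] H m} (hT : Represents ε v T) (X : H m →L[ℂ] H m) :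
    opTrace (X ∘L T) = ∑' k, (ε k : ℂ) * ⟪v k, X (v k)⟫_ℂ :=
  (h.hasSum_trace hT X).1.tsum_eq

theorem IsSignedFamily.opTrace_right {ι : Type*} [Countable ι] {m : ℕ} {ε : ι → ℝ} {v : ι → H m}
    (h : IsSignedFamily ε v) {T : H m →L[ℂ] H m} (hT : Represents ε v T) (X : H m →L[ℂ] H m) :
    opTrace (T ∘L X) = ∑' k, (ε k : ℂ) * ⟪v k, X (v k)⟫_ℂ :=
  (h.hasSum_trace hT X).2.tsum_eq

/-- `πᵐ` times the Wigner function of `∑ ε k |v k⟩⟨v k|`. -/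
def famWigner {ι : Type*} {m : ℕ} (ε : ι → ℝ) (v : ι → H m) (z : Phase m) : ℝ :=
  ∑' k, ε k * (⟪v k, displacedParity z (v k)⟫_ℂ).re

theorem inner_displacedParity_self {m : ℕ} (z : Phase m) (v : H m) :
    (((⟪v, displacedParity z v⟫_ℂ).re : ℝ) : ℂ) = ⟪v, displacedParity z v⟫_ℂ := by
  refine Complex.conj_eq_iff_re.1 ?_
  rw [inner_conj_symm, inner_displacedParity_left]

theorem ofReal_famWigner {ι : Type*} {m : ℕ} (ε : ι → ℝ) (v : ι → H m) (z : Phase m) :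
    (famWigner ε v z : ℂ) = ∑' k, (ε k : ℂ) * ⟪v k, displacedParity z (v k)⟫_ℂ := by
  rw [famWigner, Complex.ofReal_tsum]
  refine tsum_congr fun k => ?_
  rw [Complex.ofReal_mul, inner_displacedParity_self]

theorem IsSignedFamily.wigner_eq {ι : Type*} [Countable ι] {m : ℕ} {ε : ι → ℝ} {v : ι → H m}
    (h : IsSignedFamily ε v) {T : H m →L[ℂ] H m} (hT : Represents ε v T) (z : Phase m) :
    wigner T z = (Real.pi ^ m)⁻¹ * famWigner ε v z := by
  rw [wigner, h.opTrace_right hT, ← ofReal_famWigner, Complex.ofReal_re]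

theorem exists_isPositive_mul_self {E : Type*} [NormedAddCommGroup E] [InnerProductSpace ℂ E]
    [CompleteSpace E] {A : E →L[ℂ] E} (hA : A.IsPositive) :
    ∃ R : E →L[ℂ] E, R.IsPositive ∧ R * R = A := by
  have hA0 : 0 ≤ A := (ContinuousLinearMap.nonneg_iff_isPositive A).2 hA
  exact ⟨CFC.sqrt A, (ContinuousLinearMap.nonneg_iff_isPositive _).1 (CFC.sqrt_nonneg A),
    CFC.sqrt_mul_sqrt_self A hA0⟩

theorem continuous_rankOne {E : Type*} [NormedAddCommGroup E] [InnerProductSpace ℂ E] :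
    Continuous fun q : E × E => InnerProductSpace.rankOne ℂ q.1 q.2 := by
  have h : Continuous fun q : E × E => (innerSL ℂ q.2 : E →L[ℂ] ℂ).smulRight q.1 :=
    ((ContinuousLinearMap.smulRightL ℂ E E).continuous.comp
      ((innerSL ℂ).continuous.comp continuous_snd)).clm_apply continuous_fst
  exact h

/-- A positive operator of finite trace is `∑ |v k⟩⟨v k|` with `∑ ‖v k‖² = tr A`. -/
theorem exists_represents_of_isPositive {m : ℕ} {A : H m →L[ℂ] H m} (hA : A.IsPositive)
    (hs : Summable fun i => ⟪onb m i, A (onb m i)⟫_ℂ) :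
    ∃ v : basisIdx m → H m, IsSignedFamily (fun _ => 1) v ∧ Represents (fun _ => 1) v A ∧
      ∀ i, ((‖v i‖ ^ 2 : ℝ) : ℂ) = ⟪onb m i, A (onb m i)⟫_ℂ := by
  -- With R the positive square root, Parseval gives A = ∑ |R e_i⟩⟨R e_i|, and ‖R e_i‖² is a
  -- diagonal entry of A.
  obtain ⟨R, hRp, hRR⟩ := exists_isPositive_mul_self hA
  have hRs : ∀ f g, ⟪R f, g⟫_ℂ = ⟪f, R g⟫_ℂ := hRp.isSymmetric
  have hAR : ∀ f g, ⟪f, A g⟫_ℂ = ⟪R f, R g⟫_ℂ := fun f g => by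
    rw [hRs, ← hRR]
    rfl
  have hn : ∀ i, ((‖R (onb m i)‖ ^ 2 : ℝ) : ℂ) = ⟪onb m i, A (onb m i)⟫_ℂ := fun i => by
    rw [hAR, inner_self_eq_norm_sq_to_K]
    push_cast
    rfl
  refine ⟨fun i => R (onb m i), ⟨fun _ => by simp, ?_⟩, fun f g => ?_, hn⟩
  · have h := hs.congr fun i => (hn i).symm
    exact_mod_cast h
  · have h := (onb m).hasSum_inner_mul_inner (R f) (R g)
    rw [← hAR] at h
    refine h.congr_fun fun i => ?_
    rw [hRs, ← hRs]
    simp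

theorem Represents.sub {ι κ : Type*} {m : ℕ} {ε : ι → ℝ} {v : ι → H m} {ε' : κ → ℝ}
    {v' : κ → H m} {A B : H m →L[ℂ] H m} (hA : Represents ε v A) (hB : Represents ε' v' B) :
    Represents (Sum.elim ε fun k => -ε' k) (Sum.elim v v') (A - B) := by
  intro f g
  rw [sub_apply, inner_sub_right, sub_eq_add_neg]
  refine HasSum.sum ?_ ?_
  · exact hA f g
  · refine (hB f g).neg.congr_fun fun k => ?_
    simp

theorem IsSignedFamily.sumElim {ι κ : Type*} {m : ℕ} {ε : ι → ℝ} {v : ι → H m} {ε' : κ → ℝ}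
    {v' : κ → H m} (h : IsSignedFamily ε v) (h' : IsSignedFamily ε' v') :
    IsSignedFamily (Sum.elim ε fun k => -ε' k) (Sum.elim v v') := by
  refine ⟨?_, ?_⟩
  · rintro (k | k)
    · exact h.sign k
    · simpa using h'.sign k
  · exact (HasSum.sum (f := fun k => ‖Sum.elim v v' k‖ ^ 2) h.summable.hasSum
      h'.summable.hasSum).summable

/-- A self-adjoint trace class operator is given by a signed family. -/
theorem IsSelfAdjointTraceClass.exists_represents {m : ℕ} {T : H m →L[ℂ] H m}
    (hT : IsSelfAdjointTraceClass T) :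
    ∃ (ε : basisIdx m ⊕ basisIdx m → ℝ) (v : basisIdx m ⊕ basisIdx m → H m),
      IsSignedFamily ε v ∧ Represents ε v T := by
  obtain ⟨A, B, hA, hB, rfl⟩ := hT
  obtain ⟨v, hv, hvA, -⟩ := exists_represents_of_isPositive hA.1 hA.2
  obtain ⟨w, hw, hwB, -⟩ := exists_represents_of_isPositive hB.1 hB.2
  exact ⟨_, _, hv.sumElim hw, hvA.sub hwB⟩

theorem IsDensityOperator.exists_represents {m : ℕ} {ρ : H m →L[ℂ] H m}
    (hρ : IsDensityOperator ρ) : ∃ v : basisIdx m → H m, IsSignedFamily (fun _ => 1) v ∧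
      Represents (fun _ => 1) v ρ ∧ ∑' k, ‖v k‖ ^ 2 = 1 := by
  obtain ⟨v, hv, hvρ, hn⟩ := exists_represents_of_isPositive hρ.1 hρ.2.summable
  refine ⟨v, hv, hvρ, ?_⟩
  have h := hρ.2.tsum_eq
  simp_rw [← hn] at h
  rw [← Complex.ofReal_tsum] at h
  exact_mod_cast h

/-! ### Integrals of rank one operators -/

section MixOp

variable {α : Type*} [MeasurableSpace α] {E : Type*} [NormedAddCommGroup E]
  [InnerProductSpace ℂ E] [CompleteSpace E]

/-- The operator `∫ |v a⟩⟨u a| dμ`. -/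
def mixOp (μ : Measure α) (u v : α → E) : E →L[ℂ] E :=
  ∫ a, InnerProductSpace.rankOne ℂ (v a) (u a) ∂μ

theorem inner_mixOp {μ : Measure α} {u v : α → E} (hu : AEStronglyMeasurable u μ)
    (hv : AEStronglyMeasurable v μ) (hi : Integrable (fun a => ‖u a‖ * ‖v a‖) μ) (f g : E) :
    ⟪f, mixOp μ u v g⟫_ℂ = ∫ a, ⟪f, v a⟫_ℂ * ⟪u a, g⟫_ℂ ∂μ := by
  have hm : AEStronglyMeasurable (fun a => InnerProductSpace.rankOne ℂ (v a) (u a)) μ :=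
    Continuous.comp_aestronglyMeasurable₂ (g := fun x y : E => InnerProductSpace.rankOne ℂ x y)
      continuous_rankOne hv hu
  have hI : Integrable (fun a => InnerProductSpace.rankOne ℂ (v a) (u a)) μ := by
    refine hi.mono' hm (Eventually.of_forall fun a => ?_)
    rw [InnerProductSpace.norm_rankOne, mul_comm]
  have h1 : mixOp μ u v g = ∫ a, ⟪u a, g⟫_ℂ • v a ∂μ :=
    ContinuousLinearMap.integral_apply hI g
  have h2 : Integrable (fun a => ⟪u a, g⟫_ℂ • v a) μ := by
    refine (hi.const_mul ‖g‖).mono' ((hu.inner aestronglyMeasurable_const).smul hv)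
      (Eventually.of_forall fun a => ?_)
    rw [norm_smul]
    calc _ ≤ (‖u a‖ * ‖g‖) * ‖v a‖ := by gcongr; exact norm_inner_le_norm _ _
      _ = _ := by ring
  rw [h1, ← integral_inner h2]
  refine integral_congr_ae (Eventually.of_forall fun a => ?_)
  simp only [inner_smul_right]
  ring

theorem isPositive_mixOp {μ : Measure α} {v : α → E} (hv : AEStronglyMeasurable v μ)
    (hi : Integrable (fun a => ‖v a‖ * ‖v a‖) μ) : (mixOp μ v v).IsPositive := by
  have hsq : ∀ (f : E) a, ⟪f, v a⟫_ℂ * ⟪v a, f⟫_ℂ = ((‖⟪f, v a⟫_ℂ‖ ^ 2 : ℝ) : ℂ) := by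
    intro f a
    rw [← inner_conj_symm (v a) f, Complex.mul_conj, Complex.normSq_eq_norm_sq]
  refine (ContinuousLinearMap.isPositive_iff_complex _).2 fun f => ?_
  have h : ⟪mixOp μ v v f, f⟫_ℂ = ((∫ a, ‖⟪f, v a⟫_ℂ‖ ^ 2 ∂μ : ℝ) : ℂ) := by
    rw [← inner_conj_symm, inner_mixOp hv hv hi]
    simp_rw [hsq]
    rw [integral_complex_ofReal, Complex.conj_ofReal]
  rw [h]
  simp only [RCLike.re_eq_complex_re, Complex.ofReal_re, true_and]
  exact integral_nonneg fun a => by positivity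

end MixOp

theorem isPosTraceClass_mixOp {α : Type*} [MeasurableSpace α] {μ : Measure α} {m : ℕ}
    {v : α → H m} (hv : AEStronglyMeasurable v μ)
    (hi : Integrable (fun a => ‖v a‖ * ‖v a‖) μ) : IsPosTraceClass (mixOp μ v v) :=
  ⟨isPositive_mixOp hv hi, (hasSum_trace_comp_left hv hv hi (inner_mixOp hv hv hi)
    (ContinuousLinearMap.id ℂ _)).summable⟩

end Bosonic

namespace Bosonic

/-! ### Cross-correlations of square integrable functions -/

section Correlation

variable {E : Type*} [NormedAddCommGroup E]

/-- The `L²` norm of a function. -/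
def l2Norm {l : ℕ} (f : Conf l → E) : ℝ := Real.sqrt (∫ b, ‖f b‖ ^ 2)

theorem l2Norm_nonneg {l : ℕ} (f : Conf l → E) : 0 ≤ l2Norm f := Real.sqrt_nonneg _

theorem integral_norm_mul_norm_le {F : Type*} [NormedAddCommGroup F] {l : ℕ} {f : Conf l → E}
    {g : Conf l → F} (hf : MemLp f 2 volume) (hg : MemLp g 2 volume) :
    Integrable (fun b => ‖f b‖ * ‖g b‖) ∧ ∫ b, ‖f b‖ * ‖g b‖ ≤ l2Norm f * l2Norm g := by
  refine ⟨hf.norm.integrable_mul hg.norm, ?_⟩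
  have h := integral_mul_le_Lp_mul_Lq_of_nonneg (μ := (volume : Measure (Conf l)))
    (f := fun b => ‖f b‖) (g := fun b => ‖g b‖) Real.HolderConjugate.two_two
    (Eventually.of_forall fun _ => norm_nonneg _) (Eventually.of_forall fun _ => norm_nonneg _)
    (by simpa using hf.norm) (by simpa using hg.norm)
  simpa [l2Norm, Real.sqrt_eq_rpow] using h

theorem l2Norm_comp {l : ℕ} {f : Conf l → E} {e : Conf l → Conf l}
    (he : MeasurePreserving e volume volume) (hm : MeasurableEmbedding e) :
    l2Norm (fun b => f (e b)) = l2Norm f := by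
  rw [l2Norm, l2Norm, he.integral_comp hm (fun b => ‖f b‖ ^ 2)]

theorem l2Norm_coe {l : ℕ} (f : Lp E 2 (volume : Measure (Conf l))) : l2Norm f = ‖f‖ := by
  rw [Lp.norm_def, (Lp.memLp f).eLpNorm_eq_integral_rpow_norm (by norm_num) (by norm_num),
    ENNReal.toReal_ofReal (by positivity), l2Norm, Real.sqrt_eq_rpow]
  norm_num

theorem l2Norm_congr {l : ℕ} {f g : Conf l → E} (h : f =ᵐ[volume] g) : l2Norm f = l2Norm g := by
  rw [l2Norm, l2Norm]
  congr 1
  exact integral_congr_ae (h.mono fun _ h => by simp only [h])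

theorem tendsto_l2Norm_translate {l : ℕ} {f : Conf l → E} (hf : MemLp f 2 volume) :
    Tendsto (fun s : Conf l => l2Norm fun b => f (b + s) - f b) (𝓝 0) (𝓝 0) := by
  let F : Lp E 2 (volume : Measure (Conf l)) := hf.toLp f
  let g : Conf l → C(Conf l, Conf l) := fun x => ⟨fun y => y + x, by fun_prop⟩
  have hg : Continuous g := by
    let G : C(Conf l × Conf l, Conf l) := ⟨fun a => a.2 + a.1, by fun_prop⟩
    exact G.curry.continuous
  have hc := Continuous.compMeasurePreservingLp (f := fun _ : Conf l => F) (g := g)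
    continuous_const hg (fun x => measurePreserving_add_right volume x) (by simp)
  have h0 := ((hc.sub (continuous_const (y := F))).norm).tendsto 0
  have e : ∀ s : Conf l, ‖Lp.compMeasurePreserving (g s)
      (measurePreserving_add_right volume s) F - F‖ = l2Norm fun b => f (b + s) - f b := by
    intro s
    rw [← l2Norm_coe]
    refine l2Norm_congr ?_
    filter_upwards [Lp.coeFn_sub (Lp.compMeasurePreserving (g s)
      (measurePreserving_add_right volume s) F) F, Lp.coeFn_compMeasurePreserving F
      (measurePreserving_add_right volume s), hf.coeFn_toLp,
      (measurePreserving_add_right volume s).quasiMeasurePreserving.ae hf.coeFn_toLp]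
      with b h1 h2 h3 h4
    rw [h1, Pi.sub_apply, h3]
    congr 1
    exact h2.trans h4
  have h1 : Tendsto (fun s : Conf l => l2Norm fun b => f (b + s) - f b) (𝓝 0)
      (𝓝 (l2Norm fun b => f (b + 0) - f b)) := (h0.congr e).trans_eq (congrArg 𝓝 (e 0))
  simpa [l2Norm] using h1

variable [InnerProductSpace ℂ E]

/-- The correlation `(b, s) ↦ ⟨u (b + s), v (b - s)⟩`. -/
def corr {l : ℕ} (u v : Conf l → E) (b s : Conf l) : ℂ := ⟪u (b + s), v (b - s)⟫_ℂ

/-- Its Fourier transform `∫ exp (2 i p s) ⟨u (b + s), v (b - s)⟩ ds`. -/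
def corrFT {l : ℕ} (u v : Conf l → E) (z : Phase l) : ℂ :=
  ∫ s, Complex.exp (Complex.I * ((z.2 ⬝ᵥ ((2 : ℝ) • s) : ℝ) : ℂ)) * corr u v z.1 s

variable {l : ℕ} {u v : Conf l → E}

theorem integrable_corr_right (hu : MemLp u 2 volume) (hv : MemLp v 2 volume) (b : Conf l) :
    Integrable (corr u v b) ∧ ∫ s, ‖corr u v b s‖ ≤ l2Norm u * l2Norm v := by
  have hu' := hu.comp_measurePreserving (measurePreserving_add_left volume b)
  have hv' := hv.comp_measurePreserving (Measure.measurePreserving_sub_left volume b)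
  have h := integral_norm_mul_norm_le hu' hv'
  have hle : ∀ s, ‖corr u v b s‖ ≤ ‖(u ∘ fun x => b + x) s‖ * ‖(v ∘ fun x => b - x) s‖ :=
    fun s => norm_inner_le_norm _ _
  have hi : Integrable (corr u v b) := h.1.mono' (hu'.1.inner hv'.1) (Eventually.of_forall hle)
  refine ⟨hi, (integral_mono hi.norm h.1 hle).trans (h.2.trans_eq ?_)⟩
  congr 1
  · exact l2Norm_comp (measurePreserving_add_left volume b) (measurableEmbedding_addLeft b)
  · exact l2Norm_comp (Measure.measurePreserving_sub_left volume b)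
      (MeasurableEquiv.subLeft b).measurableEmbedding

theorem integrable_corr_left (hu : MemLp u 2 volume) (hv : MemLp v 2 volume) (s : Conf l) :
    Integrable (fun b => corr u v b s) ∧ ∫ b, ‖corr u v b s‖ ≤ l2Norm u * l2Norm v := by
  have hu' := hu.comp_measurePreserving (measurePreserving_add_right volume s)
  have hv' := hv.comp_measurePreserving (measurePreserving_sub_right volume s)
  have h := integral_norm_mul_norm_le hu' hv'
  have hle : ∀ b, ‖corr u v b s‖ ≤ ‖(u ∘ fun x => x + s) b‖ * ‖(v ∘ fun x => x - s) b‖ :=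
    fun b => norm_inner_le_norm _ _
  have hi : Integrable (fun b => corr u v b s) :=
    h.1.mono' (hu'.1.inner hv'.1) (Eventually.of_forall hle)
  refine ⟨hi, (integral_mono hi.norm h.1 hle).trans (h.2.trans_eq ?_)⟩
  congr 1
  · exact l2Norm_comp (measurePreserving_add_right volume s) (measurableEmbedding_addRight s)
  · exact l2Norm_comp (measurePreserving_sub_right volume s)
      (MeasurableEquiv.subRight s).measurableEmbedding

theorem norm_corrFT_le (hu : MemLp u 2 volume) (hv : MemLp v 2 volume) (z : Phase l) :
    ‖corrFT u v z‖ ≤ l2Norm u * l2Norm v := by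
  refine (norm_integral_le_integral_norm _).trans ((integral_mono_of_nonneg
    (Eventually.of_forall fun _ => norm_nonneg _) (integrable_corr_right hu hv z.1).1.norm
    (Eventually.of_forall fun s => ?_)).trans (integrable_corr_right hu hv z.1).2)
  simp only [norm_mul]
  rw [mul_comm Complex.I, Complex.norm_exp_ofReal_mul_I, one_mul]

theorem stronglyMeasurable_corr (hu : StronglyMeasurable u) (hv : StronglyMeasurable v) :
    StronglyMeasurable fun q : Conf l × Conf l => corr u v q.1 q.2 :=
  (hu.comp_measurable (measurable_fst.add measurable_snd)).inner
    (hv.comp_measurable (measurable_fst.sub measurable_snd))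

theorem stronglyMeasurable_corrFT (hu : StronglyMeasurable u) (hv : StronglyMeasurable v) :
    StronglyMeasurable (corrFT u v) := by
  have h : StronglyMeasurable fun q : Phase l × Conf l =>
      Complex.exp (Complex.I * ((q.1.2 ⬝ᵥ ((2 : ℝ) • q.2) : ℝ) : ℂ)) * corr u v q.1.1 q.2 := by
    refine StronglyMeasurable.mul ?_ ?_
    · have : Continuous fun q : Phase l × Conf l =>
        Complex.exp (Complex.I * ((q.1.2 ⬝ᵥ ((2 : ℝ) • q.2) : ℝ) : ℂ)) := by fun_prop
      exact this.stronglyMeasurable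
    · exact (stronglyMeasurable_corr hu hv).comp_measurable
        ((measurable_fst.comp measurable_fst).prodMk measurable_snd)
  exact h.integral_prod_right

/-- The Gaussian regularisation of the Fourier inversion formula for the correlation. -/
theorem integral_gauss_mul_corrFT (hum : StronglyMeasurable u) (hvm : StronglyMeasurable v)
    (hu : MemLp u 2 volume) (hv : MemLp v 2 volume) {h : Conf l → ℂ} (hm : Measurable h)
    (hi : Integrable h) {t : ℝ} (ht : 0 < t) :
    ∫ z : Phase l, (gauss t z.2 : ℂ) * h z.1 * corrFT u v z =
      ((Real.sqrt (Real.pi / t) ^ l : ℝ) : ℂ) *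
        ∫ s, (gauss (1 / t) s : ℂ) * ∫ b, h b * corr u v b s := by
  set K : Phase l → Conf l → ℂ := fun z s => (gauss t z.2 : ℂ) * h z.1 *
    (Complex.exp (Complex.I * ((z.2 ⬝ᵥ ((2 : ℝ) • s) : ℝ) : ℂ)) * corr u v z.1 s) with hK
  have hnexp : ∀ r : ℝ, ‖Complex.exp (Complex.I * (r : ℂ))‖ = 1 := fun r => by
    rw [mul_comm, Complex.norm_exp_ofReal_mul_I]
  have hKn : ∀ z s, ‖K z s‖ = gauss t z.2 * ‖h z.1‖ * ‖corr u v z.1 s‖ := by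
    intro z s
    rw [hK]
    simp only [norm_mul, hnexp, one_mul, Complex.norm_real, Real.norm_of_nonneg (gauss_pos _ _).le]
  have hgh : Integrable (fun z : Phase l => ‖h z.1‖ * gauss t z.2) :=
    hi.norm.mul_prod (integrable_gauss ht)
  have hKm : StronglyMeasurable (Function.uncurry K) := by
    refine StronglyMeasurable.mul (StronglyMeasurable.mul ?_ ?_) (StronglyMeasurable.mul ?_ ?_)
    · have : Continuous fun q : Phase l × Conf l => (gauss t q.1.2 : ℂ) := by
        unfold gauss; fun_prop
      exact this.stronglyMeasurable
    · exact (hm.comp (by fun_prop : Measurable fun q : Phase l × Conf l => q.1.1)).stronglyMeasurable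
    · have : Continuous fun q : Phase l × Conf l =>
        Complex.exp (Complex.I * ((q.1.2 ⬝ᵥ ((2 : ℝ) • q.2) : ℝ) : ℂ)) := by fun_prop
      exact this.stronglyMeasurable
    · exact (stronglyMeasurable_corr hum hvm).comp_measurable
        ((measurable_fst.comp measurable_fst).prodMk measurable_snd)
  have hKi : Integrable (Function.uncurry K) (volume.prod volume) := by
    rw [integrable_prod_iff hKm.aestronglyMeasurable]
    refine ⟨Eventually.of_forall fun z => ?_, ?_⟩
    · refine ((integrable_corr_right hu hv z.1).1.norm.const_mul (gauss t z.2 * ‖h z.1‖)).mono'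
        (hKm.comp_measurable measurable_prodMk_left).aestronglyMeasurable
        (Eventually.of_forall fun s => (hKn z s).le)
    · refine (hgh.mul_const (l2Norm u * l2Norm v)).mono'
        hKm.norm.integral_prod_right.aestronglyMeasurable (Eventually.of_forall fun z => ?_)
      rw [Real.norm_of_nonneg (integral_nonneg fun _ => norm_nonneg _)]
      simp only [Function.uncurry_apply_pair, hKn]
      rw [integral_const_mul, mul_comm (‖h z.1‖)]
      exact mul_le_mul_of_nonneg_left (integrable_corr_right hu hv z.1).2
        (mul_nonneg (gauss_pos _ _).le (norm_nonneg _))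
  have e1 : ∀ z : Phase l, (gauss t z.2 : ℂ) * h z.1 * corrFT u v z = ∫ s, K z s := fun z => by
    rw [corrFT, ← integral_const_mul]
  simp_rw [e1]
  rw [integral_integral_swap hKi, ← integral_const_mul]
  have hsw := hKi.swap
  rw [integrable_prod_iff hsw.1] at hsw
  refine integral_congr_ae ?_
  filter_upwards [hsw.1] with s hs
  have hs' : Integrable (fun z : Phase l => K z s) := hs
  have e2 : ∫ z : Phase l, K z s = ∫ b, ∫ p, K (b, p) s := integral_prod _ hs'
  rw [e2, ← integral_const_mul, ← integral_const_mul]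
  refine integral_congr_ae (Eventually.of_forall fun b => ?_)
  have e3 : ∀ p : Conf l, K (b, p) s = (h b * corr u v b s) *
      ((gauss t p : ℂ) * Complex.exp (Complex.I * ((p ⬝ᵥ ((2 : ℝ) • s) : ℝ) : ℂ))) := by
    intro p
    rw [hK]
    ring
  -- The factor 2 in the phase turns the parameter 1/(4t) of the Fourier transform into 1/t.
  have e4 : gauss (1 / (4 * t)) ((2 : ℝ) • s) = gauss (1 / t) s := by
    simp only [gauss, smul_dotProduct, dotProduct_smul, smul_eq_mul]
    congr 2
    field_simp
    ring
  simp only [e3]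
  rw [integral_const_mul, integral_gauss_mul_cexp ht, e4]
  push_cast
  ring

theorem norm_integral_mul_corr_le (hu : MemLp u 2 volume) (hv : MemLp v 2 volume)
    {h : Conf l → ℂ} {C : ℝ} (hC : ∀ b, ‖h b‖ ≤ C) (s : Conf l) :
    ‖∫ b, h b * corr u v b s‖ ≤ C * (l2Norm u * l2Norm v) := by
  have hC0 : 0 ≤ C := (norm_nonneg _).trans (hC 0)
  refine (norm_integral_le_integral_norm _).trans ((integral_mono_of_nonneg
    (Eventually.of_forall fun _ => norm_nonneg _)
    ((integrable_corr_left hu hv s).1.norm.const_mul C)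
    (Eventually.of_forall fun b => ?_)).trans ?_)
  · simp only [norm_mul]
    exact mul_le_mul_of_nonneg_right (hC b) (norm_nonneg _)
  · rw [integral_const_mul]
    exact mul_le_mul_of_nonneg_left (integrable_corr_left hu hv s).2 hC0

/-- Replacing s by 0 changes the two factors one after the other, and each change is small because
translations are strongly continuous on `L²`. -/
theorem continuousAt_integral_mul_corr (hu : MemLp u 2 volume) (hv : MemLp v 2 volume)
    {h : Conf l → ℂ} (hm : Measurable h) {C : ℝ} (hC : ∀ b, ‖h b‖ ≤ C) :
    ContinuousAt (fun s => ∫ b, h b * corr u v b s) 0 := by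
  have hC0 : 0 ≤ C := (norm_nonneg _).trans (hC 0)
  have hint : ∀ s, Integrable fun b => h b * corr u v b s := fun s =>
    (integrable_corr_left hu hv s).1.bdd_mul hm.aestronglyMeasurable (Eventually.of_forall hC)
  have hub : ∀ s, MemLp (fun b => u (b + s) - u b) 2 volume := fun s =>
    (hu.comp_measurePreserving (measurePreserving_add_right volume s)).sub hu
  have hvb : ∀ s, MemLp (fun b => v (b + s) - v b) 2 volume := fun s =>
    (hv.comp_measurePreserving (measurePreserving_add_right volume s)).sub hv
  rw [ContinuousAt, tendsto_iff_norm_sub_tendsto_zero]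
  have hlim : Tendsto (fun s : Conf l => C * ((l2Norm fun b => u (b + s) - u b) * l2Norm v +
      l2Norm u * l2Norm fun b => v (b + -s) - v b)) (𝓝 0) (𝓝 0) := by
    have h1 := tendsto_l2Norm_translate hu
    have h2 : Tendsto (fun s : Conf l => l2Norm fun b => v (b + -s) - v b) (𝓝 0) (𝓝 0) := by
      have hn : Tendsto (fun s : Conf l => -s) (𝓝 0) (𝓝 0) := by
        simpa using (continuous_neg (G := Conf l)).tendsto 0
      exact (tendsto_l2Norm_translate hv).comp hn
    simpa using ((h1.mul_const (l2Norm v)).add (h2.const_mul (l2Norm u))).const_mul C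
  refine squeeze_zero (fun _ => norm_nonneg _) (fun s => ?_) hlim
  rw [← integral_sub (hint s) (hint 0)]
  have hb1 := integral_norm_mul_norm_le (hub s)
    (hv.comp_measurePreserving (measurePreserving_sub_right volume s))
  have hb2 := integral_norm_mul_norm_le hu (hvb (-s))
  have hsum : Integrable fun b => C * (‖u (b + s) - u b‖ * ‖v (b - s)‖ +
      ‖u b‖ * ‖v (b + -s) - v b‖) := (hb1.1.add hb2.1).const_mul C
  refine (norm_integral_le_integral_norm _).trans ((integral_mono_of_nonneg
    (Eventually.of_forall fun _ => norm_nonneg _) hsum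
    (Eventually.of_forall fun b => ?_)).trans ?_)
  · simp only [corr, add_zero, sub_zero]
    rw [← mul_sub, norm_mul]
    have e : ⟪u (b + s), v (b - s)⟫_ℂ - ⟪u b, v b⟫_ℂ =
        ⟪u (b + s) - u b, v (b - s)⟫_ℂ + ⟪u b, v (b + -s) - v b⟫_ℂ := by
      rw [inner_sub_left, inner_sub_right, ← sub_eq_add_neg b s]
      ring
    rw [e]
    refine mul_le_mul (hC b) ((norm_add_le _ _).trans ?_) (norm_nonneg _) hC0
    exact add_le_add (norm_inner_le_norm _ _) (norm_inner_le_norm _ _)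
  · rw [integral_const_mul]
    refine mul_le_mul_of_nonneg_left ?_ hC0
    refine (integral_add hb1.1 hb2.1).trans_le ?_
    refine add_le_add (hb1.2.trans_eq ?_) hb2.2
    congr 1
    exact l2Norm_comp (measurePreserving_sub_right volume s)
      (MeasurableEquiv.subRight s).measurableEmbedding

/-- The factors √(π/t) and √(πt) multiply to π, so the bound is uniform in t. It is the majorant for
sums over families and the uniform bound in the use of Fatou's lemma. -/
theorem norm_integral_gauss_mul_corrFT_le (hum : StronglyMeasurable u) (hvm : StronglyMeasurable v)
    (hu : MemLp u 2 volume) (hv : MemLp v 2 volume) {h : Conf l → ℂ} (hm : Measurable h)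
    (hi : Integrable h) {C : ℝ} (hC : ∀ b, ‖h b‖ ≤ C) {t : ℝ} (ht : 0 < t) :
    ‖∫ z : Phase l, (gauss t z.2 : ℂ) * h z.1 * corrFT u v z‖ ≤
      Real.pi ^ l * (C * (l2Norm u * l2Norm v)) := by
  have hC0 : 0 ≤ C := (norm_nonneg _).trans (hC 0)
  rw [integral_gauss_mul_corrFT hum hvm hu hv hm hi ht, norm_mul, Complex.norm_real,
    Real.norm_of_nonneg (by positivity)]
  have h1 : ‖∫ s : Conf l, (gauss (1 / t) s : ℂ) * ∫ b, h b * corr u v b s‖ ≤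
      Real.sqrt (Real.pi / (1 / t)) ^ l * (C * (l2Norm u * l2Norm v)) := by
    rw [← integral_gauss (by positivity), ← integral_mul_const]
    refine norm_integral_le_of_norm_le ((integrable_gauss (by positivity)).mul_const _)
      (Eventually.of_forall fun s => ?_)
    rw [norm_mul, Complex.norm_real, Real.norm_of_nonneg (gauss_pos _ _).le]
    exact mul_le_mul_of_nonneg_left (norm_integral_mul_corr_le hu hv hC s) (gauss_pos _ _).le
  calc _ ≤ Real.sqrt (Real.pi / t) ^ l *
        (Real.sqrt (Real.pi / (1 / t)) ^ l * (C * (l2Norm u * l2Norm v))) := by gcongr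
    _ = _ := by
      rw [← mul_assoc, ← mul_pow, ← Real.sqrt_mul (by positivity)]
      congr 2
      have : Real.pi / t * (Real.pi / (1 / t)) = Real.pi ^ 2 := by
        field_simp
      rw [this, Real.sqrt_sq Real.pi_pos.le]

theorem tendsto_integral_gauss_mul_corrFT (hum : StronglyMeasurable u) (hvm : StronglyMeasurable v)
    (hu : MemLp u 2 volume) (hv : MemLp v 2 volume) {h : Conf l → ℂ} (hm : Measurable h)
    (hi : Integrable h) {C : ℝ} (hC : ∀ b, ‖h b‖ ≤ C) :
    Tendsto (fun t : ℝ => ∫ z : Phase l, (gauss t z.2 : ℂ) * h z.1 * corrFT u v z) (𝓝[>] 0)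
      (𝓝 ((Real.pi ^ l : ℝ) * ∫ b, h b * ⟪u b, v b⟫_ℂ)) := by
  have hΨm : AEStronglyMeasurable (fun s => ∫ b, h b * corr u v b s) volume := by
    have : StronglyMeasurable fun q : Conf l × Conf l => h q.2 * corr u v q.2 q.1 :=
      (hm.comp measurable_snd).stronglyMeasurable.mul
        ((stronglyMeasurable_corr hum hvm).comp_measurable measurable_swap)
    exact this.integral_prod_right.aestronglyMeasurable
  have key := tendsto_integral_gauss_smul (norm_integral_mul_corr_le hu hv hC) hΨm
    (continuousAt_integral_mul_corr hu hv hm hC)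
  have e0 : ∫ b, h b * corr u v b 0 = ∫ b, h b * ⟪u b, v b⟫_ℂ := by
    simp only [corr, add_zero, sub_zero]
  rw [e0] at key
  refine key.congr' ?_
  filter_upwards [self_mem_nhdsWithin] with t ht
  exact (integral_gauss_mul_corrFT hum hvm hu hv hm hi ht).symm

end Correlation

end Bosonic

namespace Bosonic

/-! ### Marginals of sums of correlations -/

/-- Integrating out the momentum with a Gaussian cut-off restores the correlation at s = 0, and
bounds uniform in t allow the limit termwise. The sum of transforms is not assumed integrable.
Values in a general inner product space are allowed because a vector of m + l modes is later read as
an `H m`-valued function of l coordinates. -/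
theorem tendsto_integral_gauss_mul_tsum {E : Type*} [NormedAddCommGroup E] [InnerProductSpace ℂ E]
    {ι : Type*} [Countable ι] {l : ℕ} {ε : ι → ℝ} (hε : ∀ k, |ε k| ≤ 1) {u v : ι → Conf l → E}
    (hum : ∀ k, StronglyMeasurable (u k)) (hvm : ∀ k, StronglyMeasurable (v k))
    (hu : ∀ k, MemLp (u k) 2 volume) (hv : ∀ k, MemLp (v k) 2 volume)
    (hs : Summable fun k => l2Norm (u k) * l2Norm (v k)) {h : Conf l → ℂ} (hm : Measurable h)
    (hi : Integrable h) {C : ℝ} (hC : ∀ b, ‖h b‖ ≤ C) :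
    Tendsto (fun t : ℝ => ∫ z : Phase l, (gauss t z.2 : ℂ) * h z.1 *
        ∑' k, (ε k : ℂ) * corrFT (u k) (v k) z) (𝓝[>] 0)
      (𝓝 ((Real.pi ^ l : ℝ) * ∑' k, (ε k : ℂ) * ∫ b, h b * ⟪u k b, v k b⟫_ℂ)) ∧
    ∀ t : ℝ, 0 < t → ‖∫ z : Phase l, (gauss t z.2 : ℂ) * h z.1 *
        ∑' k, (ε k : ℂ) * corrFT (u k) (v k) z‖ ≤
      Real.pi ^ l * C * ∑' k, l2Norm (u k) * l2Norm (v k) := by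
  have hεc : ∀ k, ‖(ε k : ℂ)‖ ≤ 1 := fun k => by
    rw [Complex.norm_real]
    exact hε k
  set J : ι → ℝ → ℂ := fun k t =>
    (ε k : ℂ) * ∫ z : Phase l, (gauss t z.2 : ℂ) * h z.1 * corrFT (u k) (v k) z with hJ
  have hJb : ∀ k t, 0 < t → ‖J k t‖ ≤ Real.pi ^ l * C * (l2Norm (u k) * l2Norm (v k)) := by
    intro k t ht
    rw [hJ]
    simp only [norm_mul (ε k : ℂ)]
    have h1 := norm_integral_gauss_mul_corrFT_le (hum k) (hvm k) (hu k) (hv k) hm hi hC ht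
    calc _ ≤ 1 * _ := mul_le_mul (hεc k) h1 (norm_nonneg _) zero_le_one
      _ = _ := by ring
  have hJs : Summable fun k => Real.pi ^ l * C * (l2Norm (u k) * l2Norm (v k)) := hs.mul_left _
  have hsum : ∀ t, 0 < t → ∫ z : Phase l, (gauss t z.2 : ℂ) * h z.1 *
      ∑' k, (ε k : ℂ) * corrFT (u k) (v k) z = ∑' k, J k t := by
    intro t ht
    have hgh : Integrable (fun z : Phase l => h z.1 * (gauss t z.2 : ℂ)) :=
      hi.mul_prod (integrable_gauss ht).ofReal
    have hgh' : Integrable (fun z : Phase l => (gauss t z.2 : ℂ) * h z.1) := by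
      simpa only [mul_comm] using hgh
    have hF : ∀ k, Integrable fun z : Phase l =>
        (ε k : ℂ) * ((gauss t z.2 : ℂ) * h z.1 * corrFT (u k) (v k) z) := fun k =>
      (hgh'.mul_bdd (stronglyMeasurable_corrFT (hum k) (hvm k)).aestronglyMeasurable
        (Eventually.of_forall (norm_corrFT_le (hu k) (hv k)))).const_mul _
    have h1 := hasSum_integral_of_summable_integral_norm hF ?_
    · have h2 := h1.tsum_eq
      simp only [integral_const_mul] at h2
      rw [hJ, h2]
      refine integral_congr_ae (Eventually.of_forall fun z => ?_)
      simp only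
      rw [← tsum_mul_left]
      exact tsum_congr fun k => by ring
    · refine Summable.of_nonneg_of_le (fun k => integral_nonneg fun _ => norm_nonneg _)
        (fun k => ?_) (hs.mul_left (∫ z : Phase l, ‖(gauss t z.2 : ℂ) * h z.1‖))
      rw [← integral_mul_const]
      refine integral_mono (hF k).norm (hgh'.norm.mul_const _) fun z => ?_
      simp only
      rw [norm_mul, norm_mul _ (corrFT _ _ _)]
      calc _ ≤ 1 * (‖(gauss t z.2 : ℂ) * h z.1‖ * (l2Norm (u k) * l2Norm (v k))) := by
            gcongr
            · exact hεc k
            · exact norm_corrFT_le (hu k) (hv k) z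
        _ = _ := by ring
  constructor
  · have h1 : Tendsto (fun t => ∑' k, J k t) (𝓝[>] 0)
        (𝓝 (∑' k, (ε k : ℂ) * ((Real.pi ^ l : ℝ) * ∫ b, h b * ⟪u k b, v k b⟫_ℂ))) := by
      refine tendsto_tsum_of_dominated_convergence hJs (fun k => ?_) ?_
      · exact (tendsto_integral_gauss_mul_corrFT (hum k) (hvm k) (hu k) (hv k) hm hi hC).const_mul _
      · filter_upwards [self_mem_nhdsWithin] with t ht k
        exact hJb k t ht
    rw [← tsum_mul_left]
    simp_rw [mul_left_comm (_ : ℂ) ((Real.pi ^ l : ℝ) : ℂ)] at h1 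
    refine h1.congr' ?_
    filter_upwards [self_mem_nhdsWithin] with t ht
    exact (hsum t ht).symm
  · intro t ht
    rw [hsum t ht, ← tsum_mul_left]
    exact tsum_of_norm_bounded hJs.hasSum fun k => hJb k t ht

/-! ### The Wigner function as a Fourier transform -/

/-- A displaced parity is a reflection of the position about `z.1` combined with a phase; writing
the position as `z.1 + s` gives Wigner's formula. -/
theorem inner_displacedParity_eq_corrFT {m : ℕ} (u v : H m) (z : Phase m) :
    ⟪u, displacedParity z v⟫_ℂ = corrFT u v z := by
  rw [L2.inner_def, corrFT, ← integral_add_left_eq_self _ z.1]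
  refine integral_congr_ae ?_
  filter_upwards [(measurePreserving_add_left volume z.1).quasiMeasurePreserving.ae
    (coeFn_displacedParity z v)] with s hs
  rw [hs, corr]
  simp only [RCLike.inner_apply]
  rw [add_sub_cancel_left, two_smul ℝ z.1, add_sub_add_left_eq_sub]
  ring

/-- Opposite shifts of the two arguments amount to a shift of s, hence to a phase. Marginals
weighted with a character in p are thereby plain marginals of shifted families. -/
theorem corrFT_translate {E : Type*} [NormedAddCommGroup E] [InnerProductSpace ℂ E] {l : ℕ}
    (u v : Conf l → E) (a : Conf l) (z : Phase l) :
    corrFT (fun b => u (b + a)) (fun b => v (b - a)) z =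
      Complex.exp (-(Complex.I * ((z.2 ⬝ᵥ ((2 : ℝ) • a) : ℝ) : ℂ))) * corrFT u v z := by
  rw [corrFT, corrFT, ← integral_const_mul]
  rw [← integral_add_right_eq_self (fun s => Complex.exp (-(Complex.I *
    ((z.2 ⬝ᵥ ((2 : ℝ) • a) : ℝ) : ℂ))) * _) a]
  refine integral_congr_ae (Eventually.of_forall fun s => ?_)
  simp only [corr]
  rw [← mul_assoc, ← Complex.exp_add, add_assoc, sub_sub]
  congr 2
  simp only [smul_add, dotProduct_add]
  push_cast
  ring

theorem memLp_translate {E : Type*} [NormedAddCommGroup E] {l : ℕ} {v : Conf l → E}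
    (hv : MemLp v 2 volume) (a : Conf l) :
    (MemLp (fun b => v (b + a)) 2 volume ∧ l2Norm (fun b => v (b + a)) = l2Norm v) ∧
      (MemLp (fun b => v (b - a)) 2 volume ∧ l2Norm (fun b => v (b - a)) = l2Norm v) :=
  ⟨⟨hv.comp_measurePreserving (measurePreserving_add_right volume a),
    l2Norm_comp (measurePreserving_add_right volume a) (measurableEmbedding_addRight a)⟩,
    ⟨hv.comp_measurePreserving (measurePreserving_sub_right volume a),
    l2Norm_comp (measurePreserving_sub_right volume a)
      (MeasurableEquiv.subRight a).measurableEmbedding⟩⟩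

theorem IsSignedFamily.continuous_famWigner {ι : Type*} {m : ℕ} {ε : ι → ℝ} {v : ι → H m}
    (hv : IsSignedFamily ε v) :
    Continuous (famWigner ε v) := by
  refine continuous_tsum (u := fun k => ‖v k‖ ^ 2) (fun k => ?_) hv.summable fun k z => ?_
  · exact continuous_const.mul (Complex.continuous_re.comp
      (continuous_const.inner (continuous_displacedParity (v k))))
  · have h := hv.norm_le k (X := displacedParity z) (C := 1) fun f => by
      rw [norm_displacedParity, one_mul]
    rw [one_mul] at h
    refine le_trans ?_ h
    rw [norm_mul, norm_mul, Complex.norm_real]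
    exact mul_le_mul_of_nonneg_left (Complex.abs_re_le_norm _) (norm_nonneg _)

/-! ### Marginals and characteristic function of a signed family -/

section Family

variable {ι : Type*} [Countable ι] {m : ℕ} {ε : ι → ℝ} {v : ι → H m}

theorem IsSignedFamily.tendsto_integral_gauss (hv : IsSignedFamily ε v) (a : Conf m)
    {h : Conf m → ℂ} (hm : Measurable h) (hi : Integrable h) {C : ℝ} (hC : ∀ b, ‖h b‖ ≤ C) :
    Tendsto (fun t : ℝ => ∫ z : Phase m, (gauss t z.2 : ℂ) * h z.1 *
        (Complex.exp (-(Complex.I * ((z.2 ⬝ᵥ ((2 : ℝ) • a) : ℝ) : ℂ))) * famWigner ε v z))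
      (𝓝[>] 0)
      (𝓝 ((Real.pi ^ m : ℝ) * ∑' k, (ε k : ℂ) * ∫ b, h b * ⟪v k (b + a), v k (b - a)⟫_ℂ)) ∧
    ∀ t : ℝ, 0 < t → ‖∫ z : Phase m, (gauss t z.2 : ℂ) * h z.1 *
        (Complex.exp (-(Complex.I * ((z.2 ⬝ᵥ ((2 : ℝ) • a) : ℝ) : ℂ))) * famWigner ε v z)‖ ≤
      Real.pi ^ m * C * ∑' k, ‖v k‖ ^ 2 := by
  have hl : ∀ k, l2Norm (fun b => v k (b + a)) * l2Norm (fun b => v k (b - a)) = ‖v k‖ ^ 2 := by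
    intro k
    rw [(memLp_translate (Lp.memLp (v k)) a).1.2, (memLp_translate (Lp.memLp (v k)) a).2.2,
      l2Norm_coe, pow_two]
  have e : ∀ z : Phase m, ∑' k, (ε k : ℂ) * corrFT (fun b => v k (b + a)) (fun b => v k (b - a)) z =
      Complex.exp (-(Complex.I * ((z.2 ⬝ᵥ ((2 : ℝ) • a) : ℝ) : ℂ))) * famWigner ε v z := by
    intro z
    rw [ofReal_famWigner, ← tsum_mul_left]
    refine tsum_congr fun k => ?_
    rw [corrFT_translate, inner_displacedParity_eq_corrFT]
    ring
  have h := tendsto_integral_gauss_mul_tsum (E := ℂ) hv.sign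
    (u := fun k b => v k (b + a)) (v := fun k b => v k (b - a))
    (fun k => (Lp.stronglyMeasurable (v k)).comp_measurable (measurable_id.add_const a))
    (fun k => (Lp.stronglyMeasurable (v k)).comp_measurable (measurable_id.sub_const a))
    (fun k => (memLp_translate (Lp.memLp (v k)) a).1.1)
    (fun k => (memLp_translate (Lp.memLp (v k)) a).2.1)
    (by simpa only [hl] using hv.summable) hm hi hC
  simpa only [e, hl] using h

/-- A non-negative Wigner function is integrable. -/
theorem IsSignedFamily.integrable_famWigner (hv : IsSignedFamily ε v)
    (h0 : ∀ z, 0 ≤ famWigner ε v z) : Integrable (famWigner ε v) := by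
  refine ⟨hv.continuous_famWigner.aestronglyMeasurable, ?_⟩
  set B : ℕ → Set (Conf m) := fun j => Metric.closedBall 0 j with hB
  -- Cut-offs, sharp in position and Gaussian in momentum. Their integrals are bounded uniformly in
  -- j by the regularised inversion formula, and Fatou's lemma passes the bound to the limit.
  set F : ℕ → Phase m → ℝ := fun j z =>
    gauss (1 / (j + 1)) z.2 * (B j).indicator 1 z.1 * famWigner ε v z with hF
  have hBm : ∀ j, MeasurableSet (B j) := fun j => Metric.isClosed_closedBall.measurableSet
  have hind : ∀ j, Integrable ((B j).indicator (1 : Conf m → ℂ)) := fun j =>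
    (integrable_indicator_iff (hBm j)).2 (integrableOn_const
      (isCompact_closedBall (0 : Conf m) j).measure_lt_top.ne)
  have hind' : ∀ j, Integrable ((B j).indicator (1 : Conf m → ℝ)) := fun j =>
    (integrable_indicator_iff (hBm j)).2 (integrableOn_const
      (isCompact_closedBall (0 : Conf m) j).measure_lt_top.ne)
  have hbd : ∀ z, |famWigner ε v z| ≤ ∑' k, ‖v k‖ ^ 2 := by
    intro z
    rw [← Real.norm_eq_abs]
    refine tsum_of_norm_bounded hv.summable.hasSum fun k => ?_
    have h := hv.norm_le k (X := displacedParity z) (C := 1) fun f => by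
      rw [norm_displacedParity, one_mul]
    rw [one_mul] at h
    refine le_trans ?_ h
    rw [norm_mul, norm_mul, Complex.norm_real]
    exact mul_le_mul_of_nonneg_left (Complex.abs_re_le_norm _) (norm_nonneg _)
  have hFi : ∀ j, Integrable (F j) := by
    intro j
    have h1 : Integrable fun z : Phase m => (B j).indicator (1 : Conf m → ℝ) z.1 *
        gauss (1 / ((j : ℝ) + 1)) z.2 := (hind' j).mul_prod (integrable_gauss (by positivity))
    refine (h1.mul_bdd hv.continuous_famWigner.aestronglyMeasurable
      (Eventually.of_forall hbd)).congr (Eventually.of_forall fun z => ?_)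
    simp only [hF]
    ring
  have hF0 : ∀ j z, 0 ≤ F j z := fun j z => mul_nonneg (mul_nonneg (gauss_pos _ _).le
    (Set.indicator_nonneg (fun _ _ => zero_le_one) _)) (h0 z)
  have hFb : ∀ j, ∫ z, F j z ≤ Real.pi ^ m * 1 * ∑' k, ‖v k‖ ^ 2 := by
    intro j
    have h := (hv.tendsto_integral_gauss (0 : Conf m) (h := (B j).indicator 1)
      (measurable_one.indicator (hBm j)) (hind j) (C := 1) (fun b => by
        by_cases hb : b ∈ B j <;> simp [hb])).2 (1 / ((j : ℝ) + 1)) (by positivity)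
    refine le_trans (le_abs_self _) (le_trans (le_of_eq ?_) h)
    rw [← Real.norm_eq_abs, ← Complex.norm_real, ← integral_complex_ofReal]
    congr 1
    refine integral_congr_ae (Eventually.of_forall fun z => ?_)
    simp only [hF]
    by_cases hb : z.1 ∈ B j <;> simp [hb]
  have hlim : ∀ z, Tendsto (fun j => F j z) atTop (𝓝 (famWigner ε v z)) := by
    intro z
    have h1 : Tendsto (fun j : ℕ => gauss (1 / ((j : ℝ) + 1)) z.2) atTop (𝓝 1) :=
      (tendsto_gauss_zero z.2).comp tendsto_one_div_add_atTop_nhds_zero_nat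
    have h2 : ∀ᶠ j : ℕ in atTop, (B j).indicator (1 : Conf m → ℝ) z.1 = 1 := by
      obtain ⟨N, hN⟩ := exists_nat_ge ‖z.1‖
      filter_upwards [eventually_ge_atTop N] with j hj
      have : z.1 ∈ B j := by
        simp only [hB, mem_closedBall_zero_iff]
        exact hN.trans (by exact_mod_cast hj)
      simp [this]
    have h3 : Tendsto (fun j : ℕ => gauss (1 / ((j : ℝ) + 1)) z.2 *
        (B j).indicator (1 : Conf m → ℝ) z.1) atTop (𝓝 1) := by
      refine h1.congr' ?_
      filter_upwards [h2] with j hj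
      rw [hj, mul_one]
    simpa only [one_mul] using h3.mul_const (famWigner ε v z)
  rw [hasFiniteIntegral_iff_enorm]
  have hfm : ∀ j, Measurable fun z => ‖F j z‖ₑ := by
    intro j
    have : Measurable (F j) := by
      refine Measurable.mul (Measurable.mul ?_ ?_) hv.continuous_famWigner.measurable
      · exact (continuous_gauss _).measurable.comp measurable_snd
      · exact (measurable_one.indicator (hBm j)).comp measurable_fst
    exact this.enorm
  have hfat := lintegral_liminf_le (μ := (volume : Measure (Phase m))) (u := atTop) hfm
  refine lt_of_le_of_lt (le_trans (le_of_eq ?_) hfat)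
    (lt_of_le_of_lt (b := ENNReal.ofReal (Real.pi ^ m * 1 * ∑' k, ‖v k‖ ^ 2)) ?_
      ENNReal.ofReal_lt_top)
  · refine lintegral_congr fun z => ?_
    exact ((continuous_enorm.tendsto _).comp (hlim z)).liminf_eq.symm
  · refine liminf_le_of_le ?_ fun b hb => ?_
    · isBoundedDefault
    · obtain ⟨j, hj⟩ := hb.exists
      refine hj.trans ?_
      rw [lintegral_enorm_of_nonneg (hF0 j), ← ofReal_integral_eq_lintegral_ofReal (hFi j)
        (Eventually.of_forall (hF0 j))]
      exact ENNReal.ofReal_le_ofReal (hFb j)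

/-- Marginals of an integrable Wigner function. -/
theorem IsSignedFamily.integral_famWigner_mul (hv : IsSignedFamily ε v)
    (hw : Integrable (famWigner ε v)) (a : Conf m) {h : Conf m → ℂ} (hm : Measurable h) {C : ℝ}
    (hC : ∀ b, ‖h b‖ ≤ C) :
    ∫ z : Phase m, (famWigner ε v z : ℂ) * (h z.1 *
        Complex.exp (-(Complex.I * ((z.2 ⬝ᵥ ((2 : ℝ) • a) : ℝ) : ℂ)))) =
      (Real.pi ^ m : ℝ) * ∑' k, (ε k : ℂ) * ∫ b, h b * ⟪v k (b + a), v k (b - a)⟫_ℂ := by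
  have hC0 : 0 ≤ C := (norm_nonneg _).trans (hC 0)
  set e : Phase m → ℂ := fun z => Complex.exp (-(Complex.I * ((z.2 ⬝ᵥ ((2 : ℝ) • a) : ℝ) : ℂ)))
    with he
  have hec : Continuous e := by rw [he]; fun_prop
  have hen : ∀ z, ‖e z‖ = 1 := fun z => by
    rw [he]
    simp only
    rw [← mul_neg, ← Complex.ofReal_neg, mul_comm, Complex.norm_exp_ofReal_mul_I]
  have hwc : Integrable fun z => (famWigner ε v z : ℂ) := hw.ofReal
  have hwh : ∀ {g : Conf m → ℂ}, Measurable g →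
      AEStronglyMeasurable (fun z : Phase m => (famWigner ε v z : ℂ) * (g z.1 * e z)) volume :=
    fun hg => hwc.1.mul ((hg.comp measurable_fst).aestronglyMeasurable.mul
      hec.aestronglyMeasurable)
  -- integrable `h`
  have key : ∀ {g : Conf m → ℂ}, Measurable g → Integrable g → (∀ b, ‖g b‖ ≤ C) →
      ∫ z : Phase m, (famWigner ε v z : ℂ) * (g z.1 * e z) =
      (Real.pi ^ m : ℝ) * ∑' k, (ε k : ℂ) * ∫ b, g b * ⟪v k (b + a), v k (b - a)⟫_ℂ := by
    intro g hg hgi hgC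
    have h1 := (hv.tendsto_integral_gauss a hg hgi hgC).1
    -- The same regularised integrals have two limits: one by Fourier inversion, the other by
    -- dominated convergence, the Wigner function being integrable now.
    refine tendsto_nhds_unique ?_ h1
    refine tendsto_integral_filter_of_dominated_convergence
      (fun z => C * ‖(famWigner ε v z : ℂ)‖) ?_ ?_ (hwc.norm.const_mul C) ?_
    · refine Eventually.of_forall fun t => ?_
      have hc : Continuous fun z : Phase m => (gauss t z.2 : ℂ) := by unfold gauss; fun_prop
      exact (hc.aestronglyMeasurable.mul (hg.comp measurable_fst).aestronglyMeasurable).mul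
        (hec.aestronglyMeasurable.mul hwc.1)
    · filter_upwards [self_mem_nhdsWithin] with t ht
      refine Eventually.of_forall fun z => ?_
      rw [norm_mul, norm_mul, norm_mul, hen, one_mul, Complex.norm_real,
        Real.norm_of_nonneg (gauss_pos _ _).le]
      gcongr
      calc _ ≤ 1 * C := mul_le_mul (gauss_le_one (le_of_lt ht) _) (hgC _) (norm_nonneg _)
            zero_le_one
        _ = C := one_mul C
    · refine Eventually.of_forall fun z => ?_
      have h2 : Tendsto (fun t : ℝ => (gauss t z.2 : ℂ)) (𝓝[>] 0) (𝓝 ((1 : ℝ) : ℂ)) :=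
        (Complex.continuous_ofReal.tendsto _).comp
          ((tendsto_gauss_zero z.2).mono_left nhdsWithin_le_nhds)
      have h3 := (h2.mul_const (g z.1)).mul_const (e z * famWigner ε v z)
      convert h3 using 2
      push_cast
      ring
  -- cut off
  set B : ℕ → Set (Conf m) := fun j => Metric.closedBall 0 j with hB
  have hBm : ∀ j, MeasurableSet (B j) := fun j => Metric.isClosed_closedBall.measurableSet
  have hgC : ∀ j b, ‖(B j).indicator h b‖ ≤ C := fun j b =>
    (norm_indicator_le_norm_self _ _).trans (hC b)
  have hgi : ∀ j, Integrable ((B j).indicator h) := fun j =>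
    (integrable_indicator_iff (hBm j)).2 (Measure.integrableOn_of_bounded
      (isCompact_closedBall (0 : Conf m) j).measure_lt_top.ne hm.aestronglyMeasurable
        (Eventually.of_forall hC))
  have hlim : ∀ b, Tendsto (fun j => (B j).indicator h b) atTop (𝓝 (h b)) := by
    intro b
    refine tendsto_const_nhds.congr' ?_
    obtain ⟨N, hN⟩ := exists_nat_ge ‖b‖
    filter_upwards [eventually_ge_atTop N] with j hj
    have : b ∈ B j := by
      simp only [hB, mem_closedBall_zero_iff]
      exact hN.trans (by exact_mod_cast hj)
    simp [this]
  have hL : Tendsto (fun j => ∫ z : Phase m, (famWigner ε v z : ℂ) *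
      ((B j).indicator h z.1 * e z)) atTop
      (𝓝 (∫ z : Phase m, (famWigner ε v z : ℂ) * (h z.1 * e z))) := by
    refine tendsto_integral_of_dominated_convergence (fun z => ‖(famWigner ε v z : ℂ)‖ * C)
      (fun j => hwh (hm.indicator (hBm j))) (hwc.norm.mul_const C)
      (fun j => Eventually.of_forall fun z => ?_) (Eventually.of_forall fun z => ?_)
    · rw [norm_mul, norm_mul, hen, mul_one]
      gcongr
      exact hgC j _
    · exact ((hlim z.1).mul_const _).const_mul _
  have hcorr : ∀ k, Integrable (fun b => ⟪v k (b + a), v k (b - a)⟫_ℂ) ∧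
      ∫ b, ‖⟪v k (b + a), v k (b - a)⟫_ℂ‖ ≤ ‖v k‖ ^ 2 := fun k => by
    have h := integrable_corr_left (Lp.memLp (v k)) (Lp.memLp (v k)) a
    rwa [l2Norm_coe, ← pow_two] at h
  have hR : Tendsto (fun j => ((Real.pi ^ m : ℝ) : ℂ) * ∑' k, (ε k : ℂ) *
      ∫ b, (B j).indicator h b * ⟪v k (b + a), v k (b - a)⟫_ℂ) atTop
      (𝓝 ((Real.pi ^ m : ℝ) * ∑' k, (ε k : ℂ) * ∫ b, h b * ⟪v k (b + a), v k (b - a)⟫_ℂ)) := by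
    refine Tendsto.const_mul _ (tendsto_tsum_of_dominated_convergence
      (hv.summable.mul_left C) (fun k => Tendsto.const_mul _ ?_)
      (Eventually.of_forall fun j k => ?_))
    · refine tendsto_integral_of_dominated_convergence
        (fun b => C * ‖⟪v k (b + a), v k (b - a)⟫_ℂ‖)
        (fun j => (hm.indicator (hBm j)).aestronglyMeasurable.mul (hcorr k).1.1)
        ((hcorr k).1.norm.const_mul C)
        (fun j => Eventually.of_forall fun b => ?_) (Eventually.of_forall fun b => ?_)
      · rw [norm_mul]
        gcongr
        exact hgC j b
      · exact (hlim b).mul_const _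
    · have h2 := norm_integral_mul_corr_le (Lp.memLp (v k)) (Lp.memLp (v k)) (hgC j) a
      rw [l2Norm_coe, ← pow_two] at h2
      rw [norm_mul, Complex.norm_real]
      calc _ ≤ 1 * (C * ‖v k‖ ^ 2) := mul_le_mul (hv.sign k) h2 (norm_nonneg _) zero_le_one
        _ = _ := one_mul _
  refine tendsto_nhds_unique hL (hR.congr fun j => ?_)
  exact (key (hm.indicator (hBm j)) (hgi j) (hgC j)).symm

theorem integral_norm_sq {m : ℕ} (v : H m) : ∫ b, ⟪v b, v b⟫_ℂ = ((‖v‖ ^ 2 : ℝ) : ℂ) := by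
  rw [← L2.inner_def, inner_self_eq_norm_sq_to_K]
  push_cast
  rfl

theorem IsSignedFamily.integral_famWigner (hv : IsSignedFamily ε v)
    (hw : Integrable (famWigner ε v)) :
    ∫ z, famWigner ε v z = Real.pi ^ m * ∑' k, ε k * ‖v k‖ ^ 2 := by
  have h := hv.integral_famWigner_mul hw (0 : Conf m) (h := fun _ => 1) measurable_const (C := 1)
    (fun b => by simp)
  simp only [smul_zero, dotProduct_zero, Complex.ofReal_zero, mul_zero, neg_zero, Complex.exp_zero,
    mul_one, one_mul, add_zero, sub_zero, integral_norm_sq] at h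
  rw [integral_complex_ofReal] at h
  apply Complex.ofReal_injective
  rw [h, Complex.ofReal_mul, Complex.ofReal_tsum]
  simp only [Complex.ofReal_mul]

/-- The characteristic function is the symplectic Fourier transform of the Wigner function. -/
theorem IsSignedFamily.tsum_inner_displacement (hv : IsSignedFamily ε v)
    (hw : Integrable (famWigner ε v)) (ζ : Phase m) :
    (Real.pi ^ m : ℝ) * ∑' k, (ε k : ℂ) * ⟪v k, displacement ζ (v k)⟫_ℂ =
      ∫ z, (famWigner ε v z : ℂ) * Complex.exp (Complex.I * ((symp z ζ : ℝ) : ℂ)) := by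
  -- The shift takes half of the position displacement and h takes the momentum displacement; the
  -- two phases combine to exp(i symp z ζ).
  have h := hv.integral_famWigner_mul hw ((1 / 2 : ℝ) • ζ.1)
    (h := fun x => Complex.exp (Complex.I * ((ζ.2 ⬝ᵥ x : ℝ) : ℂ)))
    (by fun_prop) (C := 1)
    (fun b => by rw [mul_comm, Complex.norm_exp_ofReal_mul_I])
  have e1 : ∀ z : Phase m, Complex.exp (Complex.I * ((ζ.2 ⬝ᵥ z.1 : ℝ) : ℂ)) *
      Complex.exp (-(Complex.I * ((z.2 ⬝ᵥ ((2 : ℝ) • (1 / 2 : ℝ) • ζ.1) : ℝ) : ℂ))) =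
      Complex.exp (Complex.I * ((symp z ζ : ℝ) : ℂ)) := by
    intro z
    rw [← Complex.exp_add, symp, smul_smul]
    norm_num
    rw [dotProduct_comm ζ.2]
    ring_nf
  simp only [e1] at h
  rw [h]
  congr 1
  refine tsum_congr fun k => ?_
  congr 1
  rw [L2.inner_def, ← integral_add_right_eq_self _ ((1 / 2 : ℝ) • ζ.1)]
  refine integral_congr_ae ?_
  filter_upwards [(measurePreserving_add_right volume ((1 / 2 : ℝ) • ζ.1)).quasiMeasurePreserving.ae
    (coeFn_displacement ζ (v k))] with b hb
  rw [hb, phaseFun]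
  have e2 : b + (1 / 2 : ℝ) • ζ.1 - ζ.1 = b - (1 / 2 : ℝ) • ζ.1 := by module
  have e3 : ζ.2 ⬝ᵥ (b + (1 / 2 : ℝ) • ζ.1) - ζ.2 ⬝ᵥ ζ.1 / 2 = ζ.2 ⬝ᵥ b := by
    simp only [dotProduct_add, dotProduct_smul, smul_eq_mul]
    ring
  rw [e2, e3]
  simp only [RCLike.inner_apply]
  ring

end Family

end Bosonic

namespace Bosonic

/-! ### Families with non-negative Wigner function -/

/-- Signed families `∑ ε k |v k⟩⟨v k|` with non-negative Wigner function. -/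
structure IsPosFamily {ι : Type*} {m : ℕ} (ε : ι → ℝ) (v : ι → H m) : Prop extends
    IsSignedFamily ε v where
  nonneg : ∀ z, 0 ≤ famWigner ε v z

theorem IsSignedFamily.map {ι : Type*} {m k : ℕ} {ε : ι → ℝ} {v : ι → H m}
    (hv : IsSignedFamily ε v) {F : H m → H k} (hF : ∀ f, ‖F f‖ = ‖f‖) :
    IsSignedFamily ε fun i => F (v i) :=
  ⟨hv.sign, by simpa only [hF] using hv.summable⟩

theorem continuous_symp {m : ℕ} {α : Type*} [TopologicalSpace α] {f g : α → Phase m}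
    (hf : Continuous f) (hg : Continuous g) : Continuous fun a => symp (f a) (g a) := by
  unfold symp
  fun_prop

/-! ### Positivity read off from the characteristic function -/

section CharacteristicFunction

variable {ι : Type*} [Countable ι] {m : ℕ} {ε : ι → ℝ} {v : ι → H m}

/-- If the characteristic function is the Fourier transform of a finite measure, then
`∑ ε k ⟨v k, Π v k⟩` is non-negative. -/
theorem IsSignedFamily.tsum_inner_parity_nonneg (hv : IsSignedFamily ε v) {ν : Measure (Phase m)}
    [IsFiniteMeasure ν] (hν : ∀ ζ, ∑' k, (ε k : ℂ) * ⟪v k, displacement ζ (v k)⟫_ℂ =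
      ∫ z, Complex.exp (Complex.I * ((symp z ζ : ℝ) : ℂ)) ∂ν) :
    0 ≤ (∑' k, (ε k : ℂ) * ⟪v k, parity m (v k)⟫_ℂ).re := by
  -- Applying parity to the second vector turns the Wigner function into the characteristic function
  -- at 2z. Formally the integral of the latter over phase space gives the Wigner function at the
  -- origin; Gaussians of parameter t in momentum and s in position make it converge.
  have hχ : ∀ z : Phase m, ∑' k, (ε k : ℂ) * corrFT (v k) (parity m (v k)) z =
      ∫ y, Complex.exp (Complex.I * ((symp y ((2 : ℝ) • z) : ℝ) : ℂ)) ∂ν := by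
    intro z
    rw [← hν]
    refine tsum_congr fun k => ?_
    rw [← inner_displacedParity_eq_corrFT, displacedParity_eq, parity_parity]
  have hl : ∀ k, l2Norm (v k) * l2Norm (parity m (v k)) = ‖v k‖ ^ 2 := fun k => by
    rw [l2Norm_coe, l2Norm_coe, norm_parity, pow_two]
  have hgs : ∀ s : ℝ, 0 < s → 0 ≤ (∑' k, (ε k : ℂ) *
      ∫ b, (gauss s b : ℂ) * ⟪v k b, parity m (v k) b⟫_ℂ).re := by
    intro s hs
    have h := (tendsto_integral_gauss_mul_tsum (E := ℂ) hv.sign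
      (u := fun k => v k) (v := fun k => parity m (v k))
      (fun k => Lp.stronglyMeasurable _) (fun k => Lp.stronglyMeasurable _)
      (fun k => Lp.memLp _) (fun k => Lp.memLp _) (by simpa only [hl] using hv.summable)
      (h := fun b => (gauss s b : ℂ)) (C := 1)
      (Complex.continuous_ofReal.comp (continuous_gauss s)).measurable
      (integrable_gauss hs).ofReal (fun b => by
        rw [Complex.norm_real, Real.norm_of_nonneg (gauss_pos _ _).le]
        exact gauss_le_one hs.le b)).1
    simp only [hχ] at h
    have h2 := (Complex.continuous_re.tendsto _).comp h
    have h3 : 0 ≤ ((Real.pi ^ m : ℝ) * ∑' k, (ε k : ℂ) *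
      ∫ b, (gauss s b : ℂ) * ⟪v k b, parity m (v k) b⟫_ℂ : ℂ).re := by
      refine ge_of_tendsto h2 ?_
      filter_upwards [self_mem_nhdsWithin] with t ht
      have ht' : 0 < t := ht
      set K : Phase m → Phase m → ℂ := fun z y => (gauss t z.2 : ℂ) * (gauss s z.1 : ℂ) *
        Complex.exp (Complex.I * ((symp y ((2 : ℝ) • z) : ℝ) : ℂ)) with hK
      have hKi : Integrable (Function.uncurry K) (volume.prod ν) := by
        have h1 : Integrable (fun z : Phase m => gauss s z.1 * gauss t z.2) :=
          (integrable_gauss hs).mul_prod (integrable_gauss ht')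
        have h2 : Integrable (fun q : Phase m × Phase m => (gauss s q.1.1 * gauss t q.1.2) * 1)
          (volume.prod ν) := h1.mul_prod (integrable_const (1 : ℝ))
        refine h2.mono' ?_ (Eventually.of_forall fun q => ?_)
        · have hc1 : Continuous fun q : Phase m × Phase m => symp q.2 ((2 : ℝ) • q.1) :=
            continuous_symp (by fun_prop) (by fun_prop)
          have hc : Continuous (Function.uncurry K) := by
            simp only [hK]
            unfold Function.uncurry gauss
            fun_prop
          exact hc.aestronglyMeasurable
        · simp only [Function.uncurry, hK]
          rw [norm_mul, norm_mul, Complex.norm_real, Complex.norm_real, mul_comm Complex.I,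
            Complex.norm_exp_ofReal_mul_I, Real.norm_of_nonneg (gauss_pos _ _).le,
            Real.norm_of_nonneg (gauss_pos _ _).le, mul_comm (gauss t _)]
      have e1 : ∀ z : Phase m, (gauss t z.2 : ℂ) * (gauss s z.1 : ℂ) *
          ∫ y, Complex.exp (Complex.I * ((symp y ((2 : ℝ) • z) : ℝ) : ℂ)) ∂ν = ∫ y, K z y ∂ν :=
        fun z => (integral_const_mul _ _).symm
      simp only [Function.comp_apply, e1]
      rw [integral_integral_swap hKi]
      -- The Gaussian Fourier transform over phase space is a positive Gaussian in y, so the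
      -- regularised integral is that of a positive function against ν.
      have e2 : ∀ y : Phase m, ∫ z, K z y = ((Real.sqrt (Real.pi / s) ^ m *
          gauss (1 / (4 * s)) ((-2 : ℝ) • y.2) * (Real.sqrt (Real.pi / t) ^ m *
          gauss (1 / (4 * t)) ((2 : ℝ) • y.1)) : ℝ) : ℂ) := by
        intro y
        rw [Complex.ofReal_mul, ← integral_gauss_mul_cexp hs, ← integral_gauss_mul_cexp ht',
          ← integral_prod_mul]
        refine integral_congr_ae (Eventually.of_forall fun z => ?_)
        simp only [hK]
        rw [mul_mul_mul_comm, ← Complex.exp_add, mul_comm (gauss t z.2 : ℂ)]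
        congr 2
        rw [← mul_add, ← Complex.ofReal_add]
        congr 2
        simp only [symp, Prod.smul_fst, Prod.smul_snd, dotProduct_smul, smul_eq_mul]
        rw [dotProduct_comm y.1, dotProduct_comm y.2]
        ring
      simp only [e2]
      rw [integral_complex_ofReal, Complex.ofReal_re]
      refine integral_nonneg fun y => ?_
      have := gauss_pos (1 / (4 * s)) ((-2 : ℝ) • y.2)
      have := gauss_pos (1 / (4 * t)) ((2 : ℝ) • y.1)
      positivity
    rw [Complex.re_ofReal_mul] at h3
    exact nonneg_of_mul_nonneg_right h3 (by positivity)
  have hlim : Tendsto (fun s : ℝ => ∑' k, (ε k : ℂ) *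
      ∫ b, (gauss s b : ℂ) * ⟪v k b, parity m (v k) b⟫_ℂ) (𝓝[>] 0)
      (𝓝 (∑' k, (ε k : ℂ) * ⟪v k, parity m (v k)⟫_ℂ)) := by
    have hint : ∀ k, Integrable (fun b => ⟪v k b, parity m (v k) b⟫_ℂ) := fun k =>
      L2.integrable_inner (𝕜 := ℂ) (v k) (parity m (v k))
    have hgn : ∀ (s : ℝ) (b : Conf m), 0 < s → ∀ c : ℂ, ‖(gauss s b : ℂ) * c‖ ≤ ‖c‖ := by
      intro s b hs c
      rw [norm_mul, Complex.norm_real, Real.norm_of_nonneg (gauss_pos _ _).le]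
      exact mul_le_of_le_one_left (norm_nonneg _) (gauss_le_one hs.le b)
    refine tendsto_tsum_of_dominated_convergence hv.summable (fun k => Tendsto.const_mul _ ?_) ?_
    · rw [L2.inner_def]
      refine tendsto_integral_filter_of_dominated_convergence
        (fun b => ‖⟪v k b, parity m (v k) b⟫_ℂ‖) ?_ ?_ (hint k).norm ?_
      · exact Eventually.of_forall fun s =>
          (Complex.continuous_ofReal.comp (continuous_gauss s)).aestronglyMeasurable.mul (hint k).1
      · filter_upwards [self_mem_nhdsWithin] with s hs
        exact Eventually.of_forall fun b => hgn s b hs _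
      · refine Eventually.of_forall fun b => ?_
        have h2 : Tendsto (fun s : ℝ => (gauss s b : ℂ)) (𝓝[>] 0) (𝓝 ((1 : ℝ) : ℂ)) :=
          (Complex.continuous_ofReal.tendsto _).comp
            ((tendsto_gauss_zero b).mono_left nhdsWithin_le_nhds)
        simpa using h2.mul_const _
    · filter_upwards [self_mem_nhdsWithin] with s hs k
      have h1 : ‖∫ b, (gauss s b : ℂ) * ⟪v k b, parity m (v k) b⟫_ℂ‖ ≤ ‖v k‖ ^ 2 := by
        have hle := integral_norm_mul_norm_le (Lp.memLp (v k)) (Lp.memLp (parity m (v k)))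
        rw [hl] at hle
        refine (norm_integral_le_of_norm_le hle.1 (Eventually.of_forall fun b => ?_)).trans hle.2
        exact (hgn s b hs _).trans (norm_inner_le_norm _ _)
      rw [norm_mul, Complex.norm_real]
      calc _ ≤ 1 * ‖v k‖ ^ 2 := mul_le_mul (hv.sign k) h1 (norm_nonneg _) zero_le_one
        _ = _ := one_mul _
  refine ge_of_tendsto ((Complex.continuous_re.tendsto _).comp hlim) ?_
  filter_upwards [self_mem_nhdsWithin] with s hs
  exact hgs s hs

/-- By the Weyl relations, displacing the vector multiplies its characteristic function by a
character, which amounts to translating the Wigner function. -/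
theorem inner_displacement_conj (z ζ : Phase m) (u : H m) :
    ⟪displacement (-z) u, displacement ζ (displacement (-z) u)⟫_ℂ =
      Complex.exp (Complex.I * ((-(symp z ζ) : ℝ) : ℂ)) * ⟪u, displacement ζ u⟫_ℂ := by
  rw [inner_displacement_left, neg_neg, displacement_displacement,
    displacement_displacement, smul_smul, inner_smul_right, ← Complex.exp_add]
  congr 2
  · rw [← mul_add, ← Complex.ofReal_add]
    congr 2
    simp only [symp, Prod.fst_add, Prod.snd_add, Prod.fst_neg, Prod.snd_neg,
      dotProduct_neg, add_dotProduct]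
    rw [dotProduct_comm ζ.1 z.2, dotProduct_comm ζ.2 z.1, dotProduct_comm z.1 z.2]
    ring
  · congr 2
    abel

/-- Displacing by -z moves the point z to the origin and translates ν accordingly, so positivity at
the origin is enough. Positivity is carried through Gaussian unitaries by this criterion. -/
theorem IsSignedFamily.isPosFamily_of_charFun (hv : IsSignedFamily ε v) {ν : Measure (Phase m)}
    [IsFiniteMeasure ν] (hν : ∀ ζ, ∑' k, (ε k : ℂ) * ⟪v k, displacement ζ (v k)⟫_ℂ =
      ∫ z, Complex.exp (Complex.I * ((symp z ζ : ℝ) : ℂ)) ∂ν) : IsPosFamily ε v := by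
  refine ⟨hv, fun z => ?_⟩
  have hmeas : Measurable fun y : Phase m => y - z := by fun_prop
  have := Measure.isFiniteMeasure_map ν fun y => y - z
  have h := (hv.map (F := displacement (-z)) (norm_displacement (-z))).tsum_inner_parity_nonneg
    (ν := ν.map fun y => y - z) fun ζ => ?_
  · rw [← Complex.ofReal_re (famWigner ε v z), ofReal_famWigner]
    refine h.trans_eq (congrArg Complex.re (tsum_congr fun k => ?_))
    rw [displacedParity_apply, inner_displacement_left, neg_neg]
  · simp only [inner_displacement_conj]
    simp only [mul_left_comm _ (Complex.exp _)]
    rw [tsum_mul_left, hν, ← integral_const_mul, integral_map hmeas.aemeasurable]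
    · refine integral_congr_ae (Eventually.of_forall fun y => ?_)
      simp only
      rw [← Complex.exp_add, ← mul_add, ← Complex.ofReal_add]
      congr 3
      simp only [symp, Prod.fst_sub, Prod.snd_sub, sub_dotProduct]
      ring
    · have : Continuous fun y : Phase m => symp y ζ := continuous_symp continuous_id continuous_const
      exact (by fun_prop : Continuous fun y : Phase m =>
        Complex.exp (Complex.I * ((symp y ζ : ℝ) : ℂ))).aestronglyMeasurable

/-- Pairing z with (-z.2, z.1) gives |z.1|² + |z.2|², so a map preserving the form is injective,
hence onto in finite dimension. Every argument of a characteristic function can then be written as S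
z. -/
theorem symplectic_surjective {S : Phase m →ₗ[ℝ] Phase m}
    (hS : ∀ z w, symp (S z) (S w) = symp z w) : Function.Surjective S := by
  refine LinearMap.injective_iff_surjective.1 ((injective_iff_map_eq_zero S).2 fun z hz => ?_)
  have h := hS z (-z.2, z.1)
  rw [hz] at h
  simp only [symp, Prod.fst_zero, Prod.snd_zero, zero_dotProduct, sub_zero, dotProduct_neg,
    sub_neg_eq_add] at h
  have h1 := dotProduct_self_nonneg' z.1
  have h2 := dotProduct_self_nonneg' z.2
  exact Prod.ext (dotProduct_self_eq_zero.1 (by linarith)) (dotProduct_self_eq_zero.1 (by linarith))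

/-- Gaussian unitaries preserve the non-negativity of Wigner functions. -/
theorem IsPosFamily.gaussianUnitary (hv : IsPosFamily ε v) {U : H m ≃ₗᵢ[ℂ] H m}
    (hU : IsGaussianUnitary U) : IsPosFamily ε fun k => U (v k) := by
  obtain ⟨S, d, hS, hUD⟩ := hU
  have hw := hv.toIsSignedFamily.integrable_famWigner hv.nonneg
  have hw0 : ∀ z, 0 ≤ (Real.pi ^ m)⁻¹ * famWigner ε v z := fun z =>
    mul_nonneg (by positivity) (hv.nonneg z)
  have hwi : Integrable fun z => (Real.pi ^ m)⁻¹ * famWigner ε v z := hw.const_mul _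
  have hSc : Continuous S := S.continuous_of_finiteDimensional
  -- The normalised Wigner function as a measure; its image under y ↦ S y - d has the characteristic
  -- function of the transformed family.
  set ν : Measure (Phase m) := volume.withDensity fun z =>
    ENNReal.ofReal ((Real.pi ^ m)⁻¹ * famWigner ε v z) with hν
  have hνf : IsFiniteMeasure ν := isFiniteMeasure_withDensity_ofReal hwi.2
  have hmeas : Measurable fun y : Phase m => S y - d := by fun_prop
  have := Measure.isFiniteMeasure_map ν fun y => S y - d
  refine (hv.toIsSignedFamily.map U.norm_map).isPosFamily_of_charFun
    (ν := ν.map fun y => S y - d) fun ζ => ?_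
  obtain ⟨z, rfl⟩ := symplectic_surjective hS ζ
  have e1 : ∀ k, (ε k : ℂ) * ⟪U (v k), displacement (S z) (U (v k))⟫_ℂ =
      Complex.exp (Complex.I * ((-(symp d (S z)) : ℝ) : ℂ)) *
        ((ε k : ℂ) * ⟪v k, displacement z (v k)⟫_ℂ) := by
    intro k
    have h : displacement (S z) (U (v k)) =
        Complex.exp (Complex.I * ((-(symp d (S z)) : ℝ) : ℂ)) • U (displacement z (v k)) := by
      rw [hUD, smul_smul, ← Complex.exp_add]
      push_cast
      rw [mul_neg, neg_add_cancel, Complex.exp_zero, one_smul]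
    rw [h, inner_smul_right, U.inner_map_map]
    ring
  simp only [e1]
  rw [tsum_mul_left, integral_map hmeas.aemeasurable]
  · have h := hv.toIsSignedFamily.tsum_inner_displacement hw z
    have h2 : ∑' k, (ε k : ℂ) * ⟪v k, displacement z (v k)⟫_ℂ =
        ((Real.pi ^ m : ℝ) : ℂ)⁻¹ * ∫ y, (famWigner ε v y : ℂ) *
          Complex.exp (Complex.I * ((symp y z : ℝ) : ℂ)) := by
      rw [← h, ← mul_assoc, inv_mul_cancel₀, one_mul]
      exact_mod_cast (by positivity : Real.pi ^ m ≠ 0)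
    rw [h2, hν, integral_withDensity_eq_integral_toReal_smul₀ hwi.1.aemeasurable.ennreal_ofReal
      (Eventually.of_forall fun _ => ENNReal.ofReal_lt_top), ← integral_const_mul,
      ← integral_const_mul]
    refine integral_congr_ae (Eventually.of_forall fun y => ?_)
    simp only
    rw [ENNReal.toReal_ofReal (hw0 y), Complex.real_smul]
    have e2 : Complex.exp (Complex.I * ((symp (S y - d) (S z) : ℝ) : ℂ)) =
        Complex.exp (Complex.I * ((-(symp d (S z)) : ℝ) : ℂ)) *
          Complex.exp (Complex.I * ((symp y z : ℝ) : ℂ)) := by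
      rw [← Complex.exp_add, ← mul_add, ← Complex.ofReal_add, ← hS y z]
      congr 3
      simp only [symp, Prod.fst_sub, Prod.snd_sub, sub_dotProduct]
      ring
    rw [e2]
    push_cast
    ring
  · have : Continuous fun y : Phase m => symp y (S z) := continuous_symp continuous_id continuous_const
    exact (by fun_prop : Continuous fun y : Phase m =>
      Complex.exp (Complex.I * ((symp y (S z) : ℝ) : ℂ))).aestronglyMeasurable

end CharacteristicFunction

end Bosonic

namespace Bosonic

/-! ### Tensor products and the vacuum -/

theorem norm_tensorVec {m k : ℕ} (f : H m) (g : H k) : ‖tensorVec f g‖ = ‖f‖ * ‖g‖ := by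
  have h := inner_tensorVec f f g g
  rw [inner_self_eq_norm_sq_to_K, inner_self_eq_norm_sq_to_K, inner_self_eq_norm_sq_to_K] at h
  have h' : ‖tensorVec f g‖ ^ 2 = (‖f‖ * ‖g‖) ^ 2 := by
    rw [mul_pow]
    exact_mod_cast h
  exact (sq_eq_sq₀ (norm_nonneg _) (by positivity)).1 h'

theorem dotProduct_split {m k : ℕ} (x y : Conf (m + k)) :
    x ⬝ᵥ y = (splitMap m k x).1 ⬝ᵥ (splitMap m k y).1 +
      (splitMap m k x).2 ⬝ᵥ (splitMap m k y).2 := by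
  simp only [dotProduct, splitMap, Fin.sum_univ_add]

/-- Splitting the modes. -/
def splitPhase (m k : ℕ) : Phase (m + k) ≃ᵐ Phase m × Phase k :=
  ((appendMeq m k).symm.prodCongr (appendMeq m k).symm).trans <|
    MeasurableEquiv.prodAssoc.trans <|
      ((MeasurableEquiv.refl _).prodCongr (MeasurableEquiv.prodAssoc.symm.trans <|
        (MeasurableEquiv.prodComm.prodCongr (MeasurableEquiv.refl _)).trans
          MeasurableEquiv.prodAssoc)).trans MeasurableEquiv.prodAssoc.symm

theorem measurePreserving_splitPhase (m k : ℕ) :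
    MeasurePreserving (splitPhase m k) volume (volume.prod volume) := by
  have hs := measurePreserving_split m k
  have h1 : MeasurePreserving ((appendMeq m k).symm.prodCongr (appendMeq m k).symm)
      volume ((volume.prod volume).prod (volume.prod volume)) := hs.prod hs
  refine h1.trans ?_
  refine (measurePreserving_prodAssoc volume volume (volume.prod volume)).trans ?_
  refine MeasurePreserving.trans
    (μb := volume.prod (volume.prod (volume.prod volume))) ?_
    (measurePreserving_prodAssoc volume volume (volume.prod volume)).symm
  refine (MeasurePreserving.id volume).prod ?_
  refine (measurePreserving_prodAssoc volume volume volume).symm.trans ?_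
  refine MeasurePreserving.trans (μb := (volume.prod volume).prod volume) ?_
    (measurePreserving_prodAssoc volume volume volume)
  exact Measure.measurePreserving_swap.prod (MeasurePreserving.id volume)

/-- Reflection and phase both split over the modes; the product formula for Wigner functions rests
on this. -/
theorem displacedParity_tensorVec {m k : ℕ} (z : Phase (m + k)) (f : H m) (g : H k) :
    displacedParity z (tensorVec f g) =
      tensorVec (displacedParity (splitPhase m k z).1 f) (displacedParity (splitPhase m k z).2 g) := by
  refine Lp.ext ?_
  filter_upwards [coeFn_displacedParity z (tensorVec f g),
    (Measure.measurePreserving_sub_left volume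
      ((2 : ℝ) • z.1)).quasiMeasurePreserving.ae (coeFn_tensorVec f g),
    coeFn_tensorVec (displacedParity (splitPhase m k z).1 f) (displacedParity (splitPhase m k z).2 g),
    ae_split_fst k (coeFn_displacedParity (splitPhase m k z).1 f),
    ae_split_snd m (coeFn_displacedParity (splitPhase m k z).2 g)] with y h1 h2 h3 h4 h5
  rw [h1, h2, h3, h4, h5, dotProduct_split, mul_mul_mul_comm, ← Complex.exp_add]
  congr 1
  rw [← mul_add, ← Complex.ofReal_add]
  rfl

/-- The correlation of Gaussians. -/
theorem corrFT_gauss {l : ℕ} {κ : ℝ} (hκ : 0 < κ) (z : Phase l) :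
    corrFT (fun y : Conf l => (gauss κ y : ℂ)) (fun y => (gauss κ y : ℂ)) z =
      ((gauss (2 * κ) z.1 * (Real.sqrt (Real.pi / (2 * κ)) ^ l * gauss (1 / (2 * κ)) z.2) : ℝ) : ℂ) := by
  have h := integral_gauss_mul_cexp (l := l) (t := 2 * κ) (by positivity) ((2 : ℝ) • z.2)
  have e1 : gauss (1 / (4 * (2 * κ))) ((2 : ℝ) • z.2) = gauss (1 / (2 * κ)) z.2 := by
    simp only [gauss, smul_dotProduct, dotProduct_smul, smul_eq_mul]
    congr 2
    field_simp
    ring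
  rw [e1] at h
  rw [Complex.ofReal_mul, ← h, corrFT, ← integral_const_mul]
  refine integral_congr_ae (Eventually.of_forall fun s => ?_)
  simp only [corr, RCLike.inner_apply, Complex.conj_ofReal]
  -- The parallelogram identity separates the centre from the difference.
  have e2 : gauss κ (z.1 - s) * gauss κ (z.1 + s) = gauss (2 * κ) z.1 * gauss (2 * κ) s := by
    simp only [gauss]
    rw [← Real.exp_add, ← Real.exp_add]
    congr 1
    simp only [dotProduct_add, add_dotProduct, sub_dotProduct, dotProduct_sub]
    ring
  rw [← Complex.ofReal_mul, e2, Complex.ofReal_mul, dotProduct_smul, dotProduct_smul,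
    dotProduct_comm z.2]
  ring

theorem vacuumFun_eq {k : ℕ} (x : Conf k) :
    vacuumFun k x = ((Real.pi ^ (-(1 / 4) : ℝ)) ^ k : ℝ) * (gauss (1 / 2) x : ℂ) := by
  rw [vacuumFun, ← Complex.ofReal_mul, Finset.prod_mul_distrib, gauss_eq_prod]
  simp

theorem coeFn_vacuum (k : ℕ) : vacuum k =ᵐ[volume] vacuumFun k := (memLp_vacuumFun k).coeFn_toLp

theorem corrFT_congr {E : Type*} [NormedAddCommGroup E] [InnerProductSpace ℂ E] {l : ℕ}
    {u u' v v' : Conf l → E} (hu : u =ᵐ[volume] u') (hv : v =ᵐ[volume] v') (z : Phase l) :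
    corrFT u v z = corrFT u' v' z := by
  refine integral_congr_ae ?_
  filter_upwards [(measurePreserving_add_left volume z.1).quasiMeasurePreserving.ae hu,
    (Measure.measurePreserving_sub_left volume z.1).quasiMeasurePreserving.ae hv] with s h1 h2
  simp only [corr]
  rw [h1, h2]

theorem pi_rpow_sq_mul (k : ℕ) :
    (Real.pi ^ (-(1 / 4) : ℝ)) ^ k * (Real.pi ^ (-(1 / 4) : ℝ)) ^ k * Real.sqrt Real.pi ^ k = 1 := by
  rw [← mul_pow, ← mul_pow, Real.sqrt_eq_rpow, ← Real.rpow_add Real.pi_pos,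
    ← Real.rpow_add Real.pi_pos]
  norm_num

theorem inner_displacedParity_vacuum {k : ℕ} (z : Phase k) :
    ⟪vacuum k, displacedParity z (vacuum k)⟫_ℂ = ((gauss 1 z.1 * gauss 1 z.2 : ℝ) : ℂ) := by
  rw [inner_displacedParity_eq_corrFT, corrFT_congr (coeFn_vacuum k) (coeFn_vacuum k)]
  have e : ∀ s, corr (vacuumFun k) (vacuumFun k) z.1 s =
      (((Real.pi ^ (-(1 / 4) : ℝ)) ^ k * (Real.pi ^ (-(1 / 4) : ℝ)) ^ k : ℝ) : ℂ) *
        corr (fun y : Conf k => (gauss (1 / 2) y : ℂ)) (fun y => (gauss (1 / 2) y : ℂ)) z.1 s := by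
    intro s
    simp only [corr, vacuumFun_eq, RCLike.inner_apply, map_mul, Complex.conj_ofReal]
    push_cast
    ring
  have h := corrFT_gauss (l := k) (κ := 1 / 2) (by norm_num) z
  rw [corrFT] at h ⊢
  simp only [e, mul_left_comm _ (((_ : ℝ) : ℂ))]
  rw [integral_const_mul, h, ← Complex.ofReal_mul]
  congr 1
  rw [mul_left_comm, ← mul_assoc _ _ (gauss _ z.2)]
  norm_num
  have h1 := pi_rpow_sq_mul k
  norm_num at h1
  left
  rw [h1, one_mul]

theorem norm_vacuum (k : ℕ) : ‖vacuum k‖ = 1 := by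
  have h : ⟪vacuum k, vacuum k⟫_ℂ = 1 := by
    rw [L2.inner_def]
    have e : ∫ y, ⟪vacuum k y, vacuum k y⟫_ℂ = ∫ y : Conf k,
        ((((Real.pi ^ (-(1 / 4) : ℝ)) ^ k * (Real.pi ^ (-(1 / 4) : ℝ)) ^ k) * gauss 1 y : ℝ) : ℂ) := by
      refine integral_congr_ae ?_
      filter_upwards [coeFn_vacuum k] with y hy
      rw [hy, vacuumFun_eq]
      simp only [RCLike.inner_apply, map_mul, Complex.conj_ofReal]
      have e2 : gauss (1 / 2) y * gauss (1 / 2) y = gauss 1 y := by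
        simp only [gauss]
        rw [← Real.exp_add]
        congr 1
        ring
      rw [← e2]
      push_cast
      ring
    rw [e, integral_complex_ofReal, integral_const_mul, integral_gauss one_pos, div_one,
      pi_rpow_sq_mul, Complex.ofReal_one]
  have h' : ‖vacuum k‖ ^ 2 = 1 := by
    rw [← inner_self_eq_norm_sq (𝕜 := ℂ), h]
    exact Complex.one_re
  exact (pow_eq_one_iff_of_nonneg (norm_nonneg _) two_ne_zero).1 h'

theorem norm_tensorVec_vacuum {m : ℕ} (k : ℕ) (f : H m) : ‖tensorVec f (vacuum k)‖ = ‖f‖ := by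
  rw [norm_tensorVec, norm_vacuum, mul_one]

/-- The Wigner function is multiplied by that of the vacuum, a positive Gaussian. -/
theorem IsPosFamily.tensorVec_vacuum {ι : Type*} {m : ℕ} {ε : ι → ℝ} {v : ι → H m}
    (hv : IsPosFamily ε v) (k : ℕ) : IsPosFamily ε fun i => tensorVec (v i) (vacuum k) := by
  refine ⟨hv.toIsSignedFamily.map (norm_tensorVec_vacuum k), fun z => ?_⟩
  have e : famWigner ε (fun i => tensorVec (v i) (vacuum k)) z =
      famWigner ε v (splitPhase m k z).1 *
        (gauss 1 (splitPhase m k z).2.1 * gauss 1 (splitPhase m k z).2.2) := by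
    rw [famWigner, famWigner, ← tsum_mul_right]
    refine tsum_congr fun i => ?_
    rw [displacedParity_tensorVec, inner_tensorVec, inner_displacedParity_vacuum, mul_comm,
      Complex.re_mul_ofReal]
    ring
  rw [e]
  exact mul_nonneg (hv.nonneg _) (mul_nonneg (gauss_pos _ _).le (gauss_pos _ _).le)

/-! ### Tensor products of operators -/

theorem eq_zero_of_forall_inner_tensorVec {m k : ℕ} {x : H (m + k)}
    (h : ∀ f g, ⟪tensorVec f g, x⟫_ℂ = 0) : x = 0 := by
  have h1 : ∀ t, ⟪tensorIso m k t, x⟫_ℂ = 0 := by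
    intro t
    induction t with
    | zero => simp
    | tmul f g => exact h f g
    | add s t hs ht => rw [map_add, inner_add_left, hs, ht, add_zero]
  have h2 : ∀ y, ⟪y, x⟫_ℂ = 0 := fun y =>
    (denseRange_tensorIso m k).induction_on y
      (isClosed_eq (continuous_id.inner continuous_const) continuous_const) h1
  exact inner_self_eq_zero.1 (h2 x)

theorem ext_tensorVec {m k : ℕ} {A B : H (m + k) →L[ℂ] H (m + k)}
    (h : ∀ f g f' g', ⟪tensorVec f g, A (tensorVec f' g')⟫_ℂ =
      ⟪tensorVec f g, B (tensorVec f' g')⟫_ℂ) : A = B := by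
  have h1 : ∀ f' g', A (tensorVec f' g') = B (tensorVec f' g') := fun f' g' =>
    sub_eq_zero.1 (eq_zero_of_forall_inner_tensorVec fun f g => by
      rw [inner_sub_right, h, sub_self])
  have h2 : ∀ t, A (tensorIso m k t) = B (tensorIso m k t) := by
    intro t
    induction t with
    | zero => simp
    | tmul f g => exact h1 f g
    | add s t hs ht => rw [map_add, map_add, map_add, hs, ht]
  refine ContinuousLinearMap.ext fun y => ?_
  exact (denseRange_tensorIso m k).induction_on y
    (isClosed_eq A.continuous B.continuous) h2

/-- The rank one operators are summable in norm, so a Bochner integral over counting measure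
provides the operator. -/
theorem IsSignedFamily.exists_operator {ι : Type*} [Countable ι] {m : ℕ} {ε : ι → ℝ} {v : ι → H m}
    (h : IsSignedFamily ε v) : ∃ T : H m →L[ℂ] H m, Represents ε v T := by
  let _ : MeasurableSpace ι := ⊤
  have hm : ∀ g : ι → H m, AEStronglyMeasurable g Measure.count := fun g =>
    (StronglyMeasurable.of_discrete).aestronglyMeasurable
  have hbd : ∀ k, ‖v k‖ * ‖(ε k : ℂ) • v k‖ ≤ ‖v k‖ ^ 2 := fun k => by
    rw [norm_smul, Complex.norm_real, Real.norm_eq_abs]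
    nlinarith [h.sign k, mul_nonneg (norm_nonneg (v k)) (norm_nonneg (v k))]
  have hi : Integrable (fun k => ‖v k‖ * ‖(ε k : ℂ) • v k‖) Measure.count := by
    rw [integrable_count_iff]
    refine Summable.of_nonneg_of_le (fun _ => norm_nonneg _) (fun k => ?_) h.summable
    rw [Real.norm_of_nonneg (by positivity)]
    exact hbd k
  refine ⟨mixOp Measure.count v fun k => (ε k : ℂ) • v k, fun f g => ?_⟩
  have hF : Summable fun k => ‖⟪f, (ε k : ℂ) • v k⟫_ℂ * ⟪v k, g⟫_ℂ‖ := by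
    refine Summable.of_nonneg_of_le (fun _ => norm_nonneg _) (fun k => ?_)
      (h.summable.mul_left (‖f‖ * ‖g‖))
    rw [norm_mul]
    calc _ ≤ (‖f‖ * ‖(ε k : ℂ) • v k‖) * (‖v k‖ * ‖g‖) := by
          gcongr <;> exact norm_inner_le_norm _ _
      _ = (‖f‖ * ‖g‖) * (‖v k‖ * ‖(ε k : ℂ) • v k‖) := by ring
      _ ≤ _ := by gcongr; exact hbd k
  rw [inner_mixOp (hm _) (hm _) hi, integral_countable (integrable_count_iff.2 hF)]
  have e : ∀ k, (ε k : ℂ) * (⟪f, v k⟫_ℂ * ⟪v k, g⟫_ℂ) =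
      Measure.count.real {k} • (⟪f, (ε k : ℂ) • v k⟫_ℂ * ⟪v k, g⟫_ℂ) := fun k => by
    rw [inner_smul_right]
    simp [Measure.real, mul_assoc]
  simp_rw [← e]
  refine Summable.hasSum (hF.of_norm.congr fun k => ?_)
  rw [inner_smul_right, mul_assoc]

theorem IsSignedFamily.tensor {ι κ : Type*} {m k : ℕ} {ε : ι → ℝ} {v : ι → H m} {ε' : κ → ℝ}
    {v' : κ → H k} (h : IsSignedFamily ε v) (h' : IsSignedFamily ε' v') :
    IsSignedFamily (fun q : ι × κ => ε q.1 * ε' q.2) fun q => tensorVec (v q.1) (v' q.2) := by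
  refine ⟨fun q => ?_, ?_⟩
  · rw [abs_mul]
    exact mul_le_one₀ (h.sign _) (abs_nonneg _) (h'.sign _)
  · simp only [norm_tensorVec, mul_pow]
    exact h.summable.mul_of_nonneg h'.summable (fun _ => by positivity) fun _ => by positivity

theorem hasSum_mul_complex {ι κ : Type*} {a : ι → ℂ} {b : κ → ℂ} {s t : ℂ} (ha : HasSum a s)
    (hb : HasSum b t) : HasSum (fun q : ι × κ => a q.1 * b q.2) (s * t) := by
  have h : Summable fun q : ι × κ => a q.1 * b q.2 :=
    summable_mul_of_summable_norm (f := a) (g := b) ha.summable.norm hb.summable.norm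
  exact ha.mul hb h

/-- On product vectors the double series factorises into the two given ones, which says nothing yet
about general vectors. Hence the operator of the double series is constructed first and then
identified with `tensorOp` on product vectors, which determine a bounded operator. -/
theorem Represents.tensor {ι κ : Type*} [Countable ι] [Countable κ] {m k : ℕ} {ε : ι → ℝ}
    {v : ι → H m} {ε' : κ → ℝ} {v' : κ → H k} {T : H m →L[ℂ] H m} {T' : H k →L[ℂ] H k}
    (h : IsSignedFamily ε v) (h' : IsSignedFamily ε' v')
    (hT : Represents ε v T) (hT' : Represents ε' v' T') :
    Represents (fun q : ι × κ => ε q.1 * ε' q.2) (fun q => tensorVec (v q.1) (v' q.2))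
      (tensorOp T T') := by
  obtain ⟨W, hW⟩ := (h.tensor h').exists_operator
  have hTW : tensorOp T T' = W := by
    refine ext_tensorVec fun f g f' g' => ?_
    rw [tensorOp_tensorVec, inner_tensorVec]
    have a1 : HasSum (fun i => (ε i : ℂ) * (⟪f, v i⟫_ℂ * ⟪v i, f'⟫_ℂ)) ⟪f, T f'⟫_ℂ := hT f f'
    have a2 : HasSum (fun i => (ε' i : ℂ) * (⟪g, v' i⟫_ℂ * ⟪v' i, g'⟫_ℂ)) ⟪g, T' g'⟫_ℂ := hT' g g'
    have h1 := hasSum_mul_complex a1 a2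
    have h2 : HasSum (fun q : ι × κ => ((ε q.1 * ε' q.2 : ℝ) : ℂ) *
        (⟪tensorVec f g, tensorVec (v q.1) (v' q.2)⟫_ℂ *
          ⟪tensorVec (v q.1) (v' q.2), tensorVec f' g'⟫_ℂ)) _ :=
      hW (tensorVec f g) (tensorVec f' g')
    refine h1.unique ?_
    simp only [inner_tensorVec, Complex.ofReal_mul] at h2
    have e : (fun q : ι × κ => (ε q.1 : ℂ) * ε' q.2 *
        (⟪f, v q.1⟫_ℂ * ⟪g, v' q.2⟫_ℂ * (⟪v q.1, f'⟫_ℂ * ⟪v' q.2, g'⟫_ℂ))) = fun q : ι × κ =>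
        (ε q.1 * (⟪f, v q.1⟫_ℂ * ⟪v q.1, f'⟫_ℂ)) * (ε' q.2 * (⟪g, v' q.2⟫_ℂ * ⟪v' q.2, g'⟫_ℂ)) := by
      funext q
      ring
    rw [e] at h2
    exact h2
  rw [hTW]
  exact hW

theorem famWigner_tensor {ι κ : Type*} {m k : ℕ} {ε : ι → ℝ} {v : ι → H m} {ε' : κ → ℝ}
    {v' : κ → H k} (h : IsSignedFamily ε v) (h' : IsSignedFamily ε' v') (z : Phase (m + k)) :
    famWigner (fun q : ι × κ => ε q.1 * ε' q.2) (fun q => tensorVec (v q.1) (v' q.2)) z =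
      famWigner ε v (splitPhase m k z).1 * famWigner ε' v' (splitPhase m k z).2 := by
  have hs := (h.summable_inner (displacedParity (splitPhase m k z).1)).norm
  have hs' := (h'.summable_inner (displacedParity (splitPhase m k z).2)).norm
  apply Complex.ofReal_injective
  rw [Complex.ofReal_mul, ofReal_famWigner, ofReal_famWigner, ofReal_famWigner,
    tsum_mul_tsum_of_summable_norm hs hs']
  refine tsum_congr fun q => ?_
  rw [displacedParity_tensorVec, inner_tensorVec]
  push_cast
  ring

/-- States given by an explicit countable family of vectors. -/
def HasEnsemble {m : ℕ} (ρ : H m →L[ℂ] H m) : Prop :=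
  ∃ (ι : Type) (_ : Countable ι) (v : ι → H m), IsSignedFamily (fun _ => 1) v ∧
    Represents (fun _ => 1) v ρ ∧ ∑' k, ‖v k‖ ^ 2 = 1

theorem IsDensityOperator.hasEnsemble {m : ℕ} {ρ : H m →L[ℂ] H m} (h : IsDensityOperator ρ) :
    HasEnsemble ρ := by
  obtain ⟨v, hv⟩ := h.exists_represents
  exact ⟨basisIdx m, inferInstance, v, hv⟩

theorem HasEnsemble.tensor {m k : ℕ} {ρ : H m →L[ℂ] H m} {σ : H k →L[ℂ] H k}
    (hρ : HasEnsemble ρ) (hσ : HasEnsemble σ) : HasEnsemble (tensorOp ρ σ) ∧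
      ∀ z, wigner (tensorOp ρ σ) z =
        wigner ρ (splitPhase m k z).1 * wigner σ (splitPhase m k z).2 := by
  obtain ⟨ι, hι, v, hv, hvρ, hv1⟩ := hρ
  obtain ⟨κ, hκ, w, hw, hwσ, hw1⟩ := hσ
  have hvw := hv.tensor hw
  have hT := Represents.tensor hv hw hvρ hwσ
  constructor
  · simp only [mul_one] at hvw hT
    refine ⟨ι × κ, inferInstance, _, hvw, hT, ?_⟩
    simp only [norm_tensorVec, mul_pow]
    rw [← tsum_mul_tsum_of_summable_norm hv.summable.norm hw.summable.norm, hv1, hw1, mul_one]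
  · intro z
    rw [hvw.wigner_eq hT, hv.wigner_eq hvρ, hw.wigner_eq hwσ, famWigner_tensor hv hw, pow_add,
      mul_inv]
    ring

instance isEmpty_fin_mul_zero (m : ℕ) : IsEmpty (Fin (m * 0)) := Fin.isEmpty'

theorem volume_conf_zero (m : ℕ) : (volume : Measure (Conf (m * 0))) = Measure.dirac 0 := by
  rw [volume_pi]
  exact Measure.pi_of_empty _ _

instance uniquePhaseMulZero (m : ℕ) : Unique (Phase (m * 0)) :=
  ⟨⟨0⟩, fun _ => Prod.ext (Subsingleton.elim _ _) (Subsingleton.elim _ _)⟩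

theorem integral_conf_zero {m : ℕ} (F : Conf (m * 0) → ℂ) : ∫ a, F a = F 0 := by
  rw [volume_conf_zero, integral_dirac]

theorem of_ae_conf_zero {m : ℕ} {P : Conf (m * 0) → Prop} (h : ∀ᵐ a, P a) : P 0 := by
  rw [volume_conf_zero, ae_dirac_eq] at h
  exact h

/-- For zero modes the configuration space is a point, `L²` is one-dimensional and the vacuum is the
constant 1, so the identity is the vacuum projection. This is the start of the induction over tensor
powers. -/
theorem hasEnsemble_id (m : ℕ) :
    HasEnsemble (ContinuousLinearMap.id ℂ (H (m * 0))) ∧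
      ∀ z, wigner (ContinuousLinearMap.id ℂ (H (m * 0))) z = 1 := by
  have hf : IsSignedFamily (fun _ : Unit => (1 : ℝ)) fun _ : Unit => vacuum (m * 0) :=
    ⟨fun _ => by simp, (hasSum_fintype _).summable⟩
  have hv0 : vacuum (m * 0) 0 = 1 := by
    rw [of_ae_conf_zero (coeFn_vacuum (m * 0))]
    simp [vacuumFun]
  have hr : Represents (fun _ : Unit => (1 : ℝ)) (fun _ : Unit => vacuum (m * 0))
      (ContinuousLinearMap.id ℂ (H (m * 0))) := by
    intro f g
    have h := hasSum_fintype fun _ : Unit =>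
      ((1 : ℝ) : ℂ) * (⟪f, vacuum (m * 0)⟫_ℂ * ⟪vacuum (m * 0), g⟫_ℂ)
    have e : ∑ _ : Unit, ((1 : ℝ) : ℂ) * (⟪f, vacuum (m * 0)⟫_ℂ * ⟪vacuum (m * 0), g⟫_ℂ) =
        ⟪f, ContinuousLinearMap.id ℂ (H (m * 0)) g⟫_ℂ := by
      rw [ContinuousLinearMap.id_apply, L2.inner_def, L2.inner_def, L2.inner_def,
        integral_conf_zero, integral_conf_zero, integral_conf_zero, hv0]
      simp [RCLike.inner_apply, mul_comm]
    rw [e] at h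
    exact h
  refine ⟨⟨Unit, inferInstance, _, hf, hr, ?_⟩, fun z => ?_⟩
  · rw [tsum_fintype]
    simp [norm_vacuum]
  · rw [hf.wigner_eq hr, famWigner, tsum_fintype]
    simp only [Finset.univ_unique, Finset.sum_singleton, inner_displacedParity_vacuum]
    simp [gauss, dotProduct]

/-- The Wigner function of a tensor power is a product. -/
theorem exists_tensorPow_equiv (m n : ℕ) : ∃ e : Phase (m * n) ≃ᵐ (Fin n → Phase m),
    MeasurePreserving e ∧ ∀ ρ : H m →L[ℂ] H m, HasEnsemble ρ → HasEnsemble (tensorPow ρ n) ∧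
      ∀ z, wigner (tensorPow ρ n) z = ∏ i, wigner ρ (e z i) := by
  induction n with
  | zero =>
    let e : Phase (m * 0) ≃ᵐ (Fin 0 → Phase m) := MeasurableEquiv.ofUniqueOfUnique _ _
    refine ⟨e, ⟨e.measurable, ?_⟩, fun ρ _ => ⟨(hasEnsemble_id m).1, fun z => ?_⟩⟩
    · have h1 : (volume : Measure (Phase (m * 0))) = Measure.dirac 0 := by
        change (volume : Measure (Conf (m * 0))).prod volume = _
        rw [volume_conf_zero, Measure.dirac_prod_dirac]
        rfl
      rw [h1, Measure.map_dirac' e.measurable, volume_pi]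
      exact (Measure.pi_of_empty _ _).symm
    · rw [Finset.univ_eq_empty, Finset.prod_empty]
      exact (hasEnsemble_id m).2 z
  | succ n ih =>
    obtain ⟨e, he, h⟩ := ih
    -- `tensorPow` adjoins the new factor on the right, so it becomes the last coordinate. The
    -- rearrangement does not depend on ρ: one change of variables serves both states.
    let s := MeasurableEquiv.piFinSuccAbove (fun _ : Fin (n + 1) => Phase m) (Fin.last n)
    let E : Phase (m * n + m) ≃ᵐ (Fin (n + 1) → Phase m) :=
      (splitPhase (m * n) m).trans ((e.prodCongr (MeasurableEquiv.refl _)).trans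
        (MeasurableEquiv.prodComm.trans s.symm))
    refine ⟨E, ?_, fun ρ hρ => ?_⟩
    · refine (measurePreserving_splitPhase (m * n) m).trans ?_
      refine MeasurePreserving.trans (μb := volume.prod volume)
        (he.prod (MeasurePreserving.id volume)) ?_
      refine MeasurePreserving.trans (μb := volume.prod volume) Measure.measurePreserving_swap ?_
      exact (volume_preserving_piFinSuccAbove (fun _ : Fin (n + 1) => Phase m) (Fin.last n)).symm
    · have hn := h ρ hρ
      have ht := hn.1.tensor hρ
      refine ⟨ht.1, fun z => ?_⟩
      rw [Fin.prod_univ_castSucc]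
      refine (ht.2 z).trans ?_
      rw [hn.2]
      have hE : E z = (Fin.last n).insertNth (splitPhase (m * n) m z).2
        (e (splitPhase (m * n) m z).1) := rfl
      rw [hE]
      simp

end Bosonic

namespace Bosonic

/-! ### Sums of integrable functions -/

section Tsum

variable {α ι E : Type*} [MeasurableSpace α] {μ : Measure α} [Countable ι] [NormedAddCommGroup E]
  {F : ι → α → E}

theorem lintegral_tsum_enorm_ne_top (hF : ∀ i, Integrable (F i) μ)
    (hs : Summable fun i => ∫ a, ‖F i a‖ ∂μ) : ∫⁻ a, ∑' i, ‖F i a‖ₑ ∂μ ≠ ∞ := by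
  rw [lintegral_tsum fun i => (hF i).1.enorm]
  have h : ∀ i, ∫⁻ a, ‖F i a‖ₑ ∂μ = ENNReal.ofReal (∫ a, ‖F i a‖ ∂μ) := fun i =>
    (ofReal_integral_norm_eq_lintegral_enorm (hF i)).symm
  simp only [h]
  rw [← ENNReal.ofReal_tsum_of_nonneg (fun i => integral_nonneg fun _ => norm_nonneg _) hs]
  exact ENNReal.ofReal_ne_top

theorem ae_summable_norm (hF : ∀ i, Integrable (F i) μ)
    (hs : Summable fun i => ∫ a, ‖F i a‖ ∂μ) : ∀ᵐ a ∂μ, Summable fun i => ‖F i a‖ := by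
  filter_upwards [ae_lt_top' (AEMeasurable.tsum fun i => (hF i).1.enorm)
    (lintegral_tsum_enorm_ne_top hF hs)] with a ha
  exact NNReal.summable_coe.2 (ENNReal.tsum_coe_ne_top_iff_summable.1 ha.ne)

theorem integrable_tsum [CompleteSpace E] (hF : ∀ i, Integrable (F i) μ)
    (hs : Summable fun i => ∫ a, ‖F i a‖ ∂μ) : Integrable (fun a => ∑' i, F i a) μ := by
  refine ⟨aestronglyMeasurable_of_tendsto_ae (u := (atTop : Filter (Finset ι)))
    (f := fun s a => ∑ i ∈ s, F i a)
    (fun s => Finset.aestronglyMeasurable_fun_sum s fun i _ => (hF i).1) ?_, ?_⟩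
  · filter_upwards [ae_summable_norm hF hs] with a ha
    exact ha.of_norm.hasSum
  · refine lt_of_le_of_lt (lintegral_mono_ae ?_) (lintegral_tsum_enorm_ne_top hF hs).lt_top
    filter_upwards [ae_summable_norm hF hs] with a ha
    exact enorm_tsum_le_tsum_enorm

end Tsum

/-! ### Measurability of vector valued functions -/

/-- Pettis' theorem in a separable Hilbert space: partial sums of the basis expansion are measurable
and converge pointwise. -/
theorem stronglyMeasurable_of_inner {α : Type*} [MeasurableSpace α] {m : ℕ} {F : α → H m}
    (h : ∀ g, Measurable fun a => ⟪g, F a⟫_ℂ) : StronglyMeasurable F := by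
  refine stronglyMeasurable_of_tendsto (u := (atTop : Filter (Finset (basisIdx m))))
    (f := fun s a => ∑ i ∈ s, (onb m).repr (F a) i • onb m i) (fun s => ?_)
    (tendsto_pi_nhds.2 fun a => (onb m).hasSum_repr (F a))
  refine Finset.stronglyMeasurable_fun_sum s fun i _ => ?_
  simp only [HilbertBasis.repr_apply_apply]
  exact (h (onb m i)).stronglyMeasurable.smul_const (onb m i)

theorem aestronglyMeasurable_of_inner {α : Type*} [MeasurableSpace α] {μ : Measure α} {m : ℕ}
    {F : α → H m} (h : ∀ g, AEStronglyMeasurable (fun a => ⟪g, F a⟫_ℂ) μ) :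
    AEStronglyMeasurable F μ := by
  refine aestronglyMeasurable_of_tendsto_ae (u := (atTop : Filter (Finset (basisIdx m))))
    (f := fun s a => ∑ i ∈ s, (onb m).repr (F a) i • onb m i) (fun s => ?_)
    (Eventually.of_forall fun a => (onb m).hasSum_repr (F a))
  refine Finset.aestronglyMeasurable_fun_sum s fun i _ => ?_
  simp only [HilbertBasis.repr_apply_apply]
  exact (h (onb m i)).smul_const (onb m i)

/-- Continuity in the vector and measurability in the parameter give joint measurability on the
separable space `H m`. Measurable dependence on the record of outcomes is obtained in this way. -/
theorem stronglyMeasurable_comp_of_continuous {α : Type*} [MeasurableSpace α] {m : ℕ} {F : Type*}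
    [NormedAddCommGroup F] {u : H m → α → F} (hc : ∀ a, Continuous fun f => u f a)
    (hu : ∀ f, StronglyMeasurable (u f)) {σ : α → H m} (hσ : StronglyMeasurable σ) :
    StronglyMeasurable fun a => u (σ a) a := by
  borelize (H m)
  exact (stronglyMeasurable_uncurry_of_continuous_of_stronglyMeasurable hc hu).comp_measurable
    (hσ.measurable.prodMk measurable_id)

theorem stronglyMeasurable_clm_apply {α : Type*} [MeasurableSpace α] {m n : ℕ}
    {N : α → H m →L[ℂ] H n} (hN : ∀ g, StronglyMeasurable fun a => N a g) {σ : α → H m}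
    (hσ : StronglyMeasurable σ) : StronglyMeasurable fun a => N a (σ a) :=
  stronglyMeasurable_comp_of_continuous (u := fun f a => N a f) (fun a => (N a).continuous) hN hσ

/-- Polarisation: effects of protocols are given through their quadratic forms only. -/
theorem stronglyMeasurable_of_quadraticForm {α : Type*} [MeasurableSpace α] {m : ℕ}
    {M : α → H m →L[ℂ] H m} (hM : ∀ f, Measurable fun a => ⟪f, M a f⟫_ℂ) (g : H m) :
    StronglyMeasurable fun a => M a g := by
  refine stronglyMeasurable_of_inner fun f => ?_
  have h : ∀ f, Measurable fun a => ⟪M a f, f⟫_ℂ := fun f => by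
    simp only [← inner_conj_symm _ f]
    exact Complex.continuous_conj.measurable.comp (hM f)
  have e : (fun a => ⟪f, M a g⟫_ℂ) = fun a => (starRingEnd ℂ) ((⟪M a (g + f), g + f⟫_ℂ -
      ⟪M a (g - f), g - f⟫_ℂ - Complex.I * ⟪M a (g + Complex.I • f), g + Complex.I • f⟫_ℂ +
        Complex.I * ⟪M a (g - Complex.I • f), g - Complex.I • f⟫_ℂ) / 4) := by
    funext a
    rw [← inner_conj_symm]
    congr 1
    simp only [map_add, map_sub, map_smul, inner_add_left, inner_add_right, inner_sub_left,
      inner_sub_right, inner_smul_left, inner_smul_right, Complex.conj_I]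
    linear_combination (1 / 2 * ⟪M a g, f⟫_ℂ - 1 / 2 * ⟪M a f, g⟫_ℂ) * Complex.I_mul_I
  rw [e]
  refine Complex.continuous_conj.measurable.comp (Measurable.div_const ?_ 4)
  exact (((h _).sub (h _)).sub ((h _).const_mul _)).add ((h _).const_mul _)

/-! ### Slices -/

/-- `(b, a) ↦ Fin.append a b`. -/
def coAppend (m l : ℕ) : Conf l × Conf m ≃ᵐ Conf (m + l) :=
  MeasurableEquiv.prodComm.trans (appendMeq m l)

theorem measurePreserving_coAppend (m l : ℕ) :
    MeasurePreserving (coAppend m l) (volume.prod volume) volume :=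
  Measure.measurePreserving_swap.trans (measurePreserving_append m l)

@[simp]
theorem coAppend_castAdd {m l : ℕ} (q : Conf l × Conf m) (i : Fin m) :
    coAppend m l q (Fin.castAdd l i) = q.2 i := Fin.append_left _ _ i

@[simp]
theorem coAppend_natAdd {m l : ℕ} (q : Conf l × Conf m) (j : Fin l) :
    coAppend m l q (Fin.natAdd m j) = q.1 j := Fin.append_right _ _ j

theorem coAppend_add {m l : ℕ} (a a' : Conf m) (b b' : Conf l) :
    coAppend m l (b + b', a + a') = coAppend m l (b, a) + coAppend m l (b', a') := by
  ext i
  refine Fin.addCases (fun i => ?_) (fun j => ?_) i <;>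
    simp

theorem coAppend_sub {m l : ℕ} (a a' : Conf m) (b b' : Conf l) :
    coAppend m l (b - b', a - a') = coAppend m l (b, a) - coAppend m l (b', a') := by
  ext i
  refine Fin.addCases (fun i => ?_) (fun j => ?_) i <;>
    simp

theorem dotProduct_coAppend {m l : ℕ} (a a' : Conf m) (b b' : Conf l) :
    coAppend m l (b, a) ⬝ᵥ coAppend m l (b', a') = a ⬝ᵥ a' + b ⬝ᵥ b' := by
  simp [dotProduct, Fin.sum_univ_add]

theorem ae_memLp_coAppend {m l : ℕ} (f : H (m + l)) :
    ∀ᵐ b : Conf l, MemLp (fun a : Conf m => f (coAppend m l (b, a))) 2 volume := by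
  have hG := (Lp.memLp f).comp_measurePreserving (measurePreserving_coAppend m l)
  have h2 := (memLp_two_iff_integrable_sq_norm hG.1).1 hG
  filter_upwards [hG.1.prodMk_left, h2.prod_right_ae] with b h3 h4
  exact (memLp_two_iff_integrable_sq_norm h3).2 h4

theorem ae_coeFn_slice {m l : ℕ} (f : H (m + l)) :
    ∀ᵐ b : Conf l, slice rfl f b =ᵐ[volume] fun a : Conf m => f (coAppend m l (b, a)) := by
  filter_upwards [ae_memLp_coAppend f] with b hb
  have e : slice rfl f b = hb.toLp _ := dif_pos hb
  rw [e]
  exact hb.coeFn_toLp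

theorem integrable_inner_coAppend {m l : ℕ} (f g : H (m + l)) :
    Integrable (fun q : Conf l × Conf m => ⟪f (coAppend m l q), g (coAppend m l q)⟫_ℂ)
      (volume.prod volume) :=
  ((measurePreserving_coAppend m l).integrable_comp
    (L2.integrable_inner f g).aestronglyMeasurable).2 (L2.integrable_inner f g)

theorem ae_inner_slice {m l : ℕ} (f g : H (m + l)) : ∀ᵐ b : Conf l,
    ∫ a : Conf m, ⟪f (coAppend m l (b, a)), g (coAppend m l (b, a))⟫_ℂ =
      ⟪slice rfl f b, slice rfl g b⟫_ℂ := by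
  filter_upwards [ae_coeFn_slice f, ae_coeFn_slice g] with b h1 h2
  rw [L2.inner_def]
  refine integral_congr_ae ?_
  filter_upwards [h1, h2] with a h3 h4
  rw [h3, h4]

/-- Fubini: slicing is an isometry into the square integrable functions of the outcome with values
in the remaining modes. -/
theorem inner_slice {m l n : ℕ} (h : m + l = n) (f g : H n) :
    Integrable (fun b => ⟪slice h f b, slice h g b⟫_ℂ) ∧
      ∫ b, ⟪slice h f b, slice h g b⟫_ℂ = ⟪f, g⟫_ℂ := by
  subst h
  have hi := integrable_inner_coAppend f g
  constructor
  · exact hi.integral_prod_left.congr (ae_inner_slice f g)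
  · rw [← integral_congr_ae (ae_inner_slice f g), L2.inner_def,
      ← (measurePreserving_coAppend m l).integral_comp (coAppend m l).measurableEmbedding]
    exact (integral_prod _ hi).symm

theorem slice_add {m l n : ℕ} (h : m + l = n) (f g : H n) :
    ∀ᵐ b, slice h (f + g) b = slice h f b + slice h g b := by
  subst h
  have h1 := Measure.ae_ae_of_ae_prod
    ((measurePreserving_coAppend m l).quasiMeasurePreserving.ae (Lp.coeFn_add f g))
  filter_upwards [ae_coeFn_slice f, ae_coeFn_slice g, ae_coeFn_slice (f + g), h1]
    with b h2 h3 h4 h5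
  refine Lp.ext ?_
  filter_upwards [h2, h3, h4, h5, Lp.coeFn_add (slice rfl f b) (slice rfl g b)]
    with a h6 h7 h8 h9 h10
  rw [h8, h9, h10, Pi.add_apply, Pi.add_apply, h6, h7]

theorem aestronglyMeasurable_slice {m l n : ℕ} (h : m + l = n) (f : H n) :
    AEStronglyMeasurable (fun b => slice h f b) volume := by
  subst h
  refine aestronglyMeasurable_of_inner fun g => ?_
  have hm : AEStronglyMeasurable (fun q : Conf l × Conf m => ⟪g q.2, f (coAppend m l q)⟫_ℂ)
      (volume.prod volume) :=
    (Lp.aestronglyMeasurable g).comp_snd.inner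
      ((Lp.aestronglyMeasurable f).comp_measurePreserving (measurePreserving_coAppend m l))
  refine hm.integral_prod_right'.congr ?_
  filter_upwards [ae_coeFn_slice f] with b h1
  rw [L2.inner_def]
  refine integral_congr_ae ?_
  filter_upwards [h1] with a h3
  rw [h3]

theorem memLp_slice {m l n : ℕ} (h : m + l = n) (f : H n) :
    MemLp (fun b => slice h f b) 2 volume ∧ l2Norm (fun b => slice h f b) = ‖f‖ ∧
      ∫ b, ‖slice h f b‖ ^ 2 = ‖f‖ ^ 2 := by
  have h1 := inner_slice h f f
  have e : ∀ b, ⟪slice h f b, slice h f b⟫_ℂ = ((‖slice h f b‖ ^ 2 : ℝ) : ℂ) := fun b => by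
    rw [inner_self_eq_norm_sq_to_K]
    exact (Complex.ofReal_pow _ _).symm
  simp only [e] at h1
  have h2 : ∫ b, ‖slice h f b‖ ^ 2 = ‖f‖ ^ 2 := by
    have h3 := h1.2
    have h4 : ⟪f, f⟫_ℂ = ((‖f‖ ^ 2 : ℝ) : ℂ) := by
      rw [inner_self_eq_norm_sq_to_K]
      exact (Complex.ofReal_pow _ _).symm
    rw [integral_complex_ofReal, h4] at h3
    exact Complex.ofReal_injective h3
  refine ⟨?_, ?_, h2⟩
  · rw [memLp_two_iff_integrable_sq_norm (aestronglyMeasurable_slice h f)]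
    exact h1.1.re
  · rw [l2Norm, h2, Real.sqrt_sq (norm_nonneg _)]

/-- Joining phase space points. -/
def joinPhase {m l : ℕ} (z : Phase m) (w : Phase l) : Phase (m + l) :=
  (coAppend m l (w.1, z.1), coAppend m l (w.2, z.2))

/-- Fubini over the unmeasured coordinates turns their share of the correlation integral into a
matrix element of the displaced parity between slices. At fixed z the Wigner function thus becomes a
correlation transform of vector valued functions of the measured positions. -/
theorem inner_displacedParity_joinPhase {m l : ℕ} (z : Phase m) (w : Phase l) (f g : H (m + l)) :
    ⟪f, displacedParity (joinPhase z w) g⟫_ℂ =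
      corrFT (fun b => slice rfl f b) (fun b => displacedParity z (slice rfl g b)) w := by
  have hi := (integrable_corr_right (Lp.memLp f) (Lp.memLp g) (joinPhase z w).1).1
  have hi' : Integrable (fun s => Complex.exp (Complex.I *
      (((joinPhase z w).2 ⬝ᵥ ((2 : ℝ) • s) : ℝ) : ℂ)) * corr f g (joinPhase z w).1 s) := by
    refine hi.bdd_mul (c := 1) (Continuous.aestronglyMeasurable (by fun_prop)) ?_
    exact Eventually.of_forall fun s => by rw [mul_comm, Complex.norm_exp_ofReal_mul_I]
  rw [inner_displacedParity_eq_corrFT, corrFT,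
    ← (measurePreserving_coAppend m l).integral_comp (coAppend m l).measurableEmbedding,
    integral_prod (fun x => Complex.exp (Complex.I *
      (((joinPhase z w).2 ⬝ᵥ ((2 : ℝ) • coAppend m l x) : ℝ) : ℂ)) *
        corr f g (joinPhase z w).1 (coAppend m l x))
      (((measurePreserving_coAppend m l).integrable_comp hi'.aestronglyMeasurable).2 hi')]
  refine integral_congr_ae ?_
  filter_upwards [(measurePreserving_add_left volume w.1).quasiMeasurePreserving.ae
      (ae_coeFn_slice f),
    (Measure.measurePreserving_sub_left volume w.1).quasiMeasurePreserving.ae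
      (ae_coeFn_slice g)] with b h1 h2
  rw [corr, inner_displacedParity_eq_corrFT, corrFT_congr h1 h2, corrFT, ← integral_const_mul]
  refine integral_congr_ae (Eventually.of_forall fun a => ?_)
  have e : (2 : ℝ) • coAppend m l (b, a) = coAppend m l ((2 : ℝ) • b, (2 : ℝ) • a) := by
    simp only [two_smul, coAppend_add]
  simp only [corr, joinPhase]
  rw [← mul_assoc, ← Complex.exp_add, e, dotProduct_coAppend, ← coAppend_add, ← coAppend_sub]
  push_cast
  ring_nf

/-- Integrating the full Wigner function over the momenta of the measured modes leaves, at each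
outcome b, the Wigner function of the sliced family. Against the indicator of a set of outcomes the
regularised integral is visibly non-negative. The exceptional null set depends on z. -/
theorem isPosFamily_slice_aux {ι : Type*} [Countable ι] {m l : ℕ} {ε : ι → ℝ} {v : ι → H (m + l)}
    (hv : IsPosFamily ε v) (z : Phase m) : ∀ᵐ b : Conf l,
      0 ≤ (∑' k, (ε k : ℂ) * ⟪slice rfl (v k) b, displacedParity z (slice rfl (v k) b)⟫_ℂ).re := by
  have hmem := fun k => (memLp_slice rfl (v k) : MemLp (fun b : Conf l => slice rfl (v k) b) 2 _ ∧ _)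
  -- Strongly measurable versions of the slices, which the correlation lemmas require.
  set u : ι → Conf l → H m := fun k => (hmem k).1.1.mk _ with hu
  have hum : ∀ k, StronglyMeasurable (u k) := fun k => (hmem k).1.1.stronglyMeasurable_mk
  have hue : ∀ k, (fun b : Conf l => slice rfl (v k) b) =ᵐ[volume] u k := fun k =>
    (hmem k).1.1.ae_eq_mk
  have huL : ∀ k, MemLp (u k) 2 volume := fun k => (hmem k).1.ae_eq (hue k)
  have hwm : ∀ k, StronglyMeasurable fun b => displacedParity z (u k b) := fun k =>
    (displacedParity z).continuous.comp_stronglyMeasurable (hum k)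
  have hwL : ∀ k, MemLp (fun b => displacedParity z (u k b)) 2 volume := fun k =>
    (huL k).of_le (hwm k).aestronglyMeasurable
      (Eventually.of_forall fun b => (norm_displacedParity z _).le)
  have hn : ∀ k, l2Norm (u k) = ‖v k‖ := fun k => by rw [← l2Norm_congr (hue k), (hmem k).2.1]
  have hn' : ∀ k, l2Norm (fun b => displacedParity z (u k b)) = ‖v k‖ := fun k => by
    rw [← hn k, l2Norm, l2Norm]
    simp only [norm_displacedParity]
  have hs : Summable fun k => l2Norm (u k) * l2Norm fun b => displacedParity z (u k b) := by
    refine hv.summable.congr fun k => ?_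
    rw [hn, hn', sq]
  have hF : ∀ w : Phase l, ∑' k, (ε k : ℂ) * corrFT (u k) (fun b => displacedParity z (u k b)) w =
      ((famWigner ε v (joinPhase z w) : ℝ) : ℂ) := fun w => by
    rw [ofReal_famWigner]
    refine tsum_congr fun k => ?_
    rw [inner_displacedParity_joinPhase]
    congr 1
    refine corrFT_congr (hue k).symm ?_ w
    filter_upwards [hue k] with b hb
    rw [hb]
  -- integrability of the sum
  have hint : ∀ k, Integrable fun b => ‖u k b‖ ^ 2 := fun k =>
    (memLp_two_iff_integrable_sq_norm (hum k).aestronglyMeasurable).1 (huL k)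
  have hsq : ∀ k, ∫ b, ‖u k b‖ ^ 2 = ‖v k‖ ^ 2 := fun k => by
    rw [← (hmem k).2.2]
    refine integral_congr_ae ?_
    filter_upwards [hue k] with b hb
    rw [hb]
  have hbd : ∀ k b, ‖(ε k : ℂ) * ⟪u k b, displacedParity z (u k b)⟫_ℂ‖ ≤ ‖u k b‖ ^ 2 := by
    intro k b
    rw [norm_mul, Complex.norm_real, Real.norm_eq_abs]
    calc _ ≤ 1 * (‖u k b‖ * ‖displacedParity z (u k b)‖) :=
          mul_le_mul (hv.sign k) (norm_inner_le_norm _ _) (norm_nonneg _) zero_le_one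
      _ = _ := by rw [norm_displacedParity]; ring
  have hint' : ∀ k, Integrable fun b => (ε k : ℂ) * ⟪u k b, displacedParity z (u k b)⟫_ℂ := fun k =>
    (hint k).mono' (((hum k).aestronglyMeasurable.inner (hwm k).aestronglyMeasurable).const_mul _)
      (Eventually.of_forall (hbd k))
  have hsum : Summable fun k => ∫ b, ‖(ε k : ℂ) * ⟪u k b, displacedParity z (u k b)⟫_ℂ‖ := by
    refine Summable.of_nonneg_of_le (fun k => integral_nonneg fun b => norm_nonneg _) (fun k => ?_)
      hv.summable
    rw [← hsq k]
    exact integral_mono (hint' k).norm (hint k) (hbd k)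
  have key : 0 ≤ᵐ[volume] fun b =>
      (∑' k, (ε k : ℂ) * ⟪u k b, displacedParity z (u k b)⟫_ℂ).re := by
    have hI : Integrable fun b => ∑' k, (ε k : ℂ) * ⟪u k b, displacedParity z (u k b)⟫_ℂ :=
      integrable_tsum hint' hsum
    refine ae_nonneg_of_forall_setIntegral_nonneg hI.re fun B hB hBf => ?_
    have hm : Measurable (B.indicator fun _ => (1 : ℂ)) := measurable_const.indicator hB
    have hi : Integrable (B.indicator fun _ => (1 : ℂ)) :=
      (integrable_indicator_iff hB).2 (integrableOn_const hBf.ne)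
    have hC : ∀ b, ‖B.indicator (fun _ => (1 : ℂ)) b‖ ≤ 1 := fun b => by
      by_cases h : b ∈ B <;> simp [h]
    have ht := (tendsto_integral_gauss_mul_tsum hv.sign hum hwm huL hwL hs hm hi hC).1
    simp only [hF] at ht
    have hlim : 0 ≤ ((Real.pi ^ l : ℝ) * ∑' k, (ε k : ℂ) * ∫ b, B.indicator (fun _ => (1 : ℂ)) b *
        ⟪u k b, displacedParity z (u k b)⟫_ℂ : ℂ).re := by
      refine ge_of_tendsto ((Complex.continuous_re.tendsto _).comp ht)
        (Eventually.of_forall fun t => ?_)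
      have e : ∀ w : Phase l, (gauss t w.2 : ℂ) * B.indicator (fun _ => (1 : ℂ)) w.1 *
          ((famWigner ε v (joinPhase z w) : ℝ) : ℂ) =
          ((gauss t w.2 * B.indicator (fun _ => (1 : ℝ)) w.1 * famWigner ε v (joinPhase z w) : ℝ) :
            ℂ) := fun w => by
        by_cases h : w.1 ∈ B <;> simp [h]
      simp only [Function.comp, e]
      rw [integral_complex_ofReal, Complex.ofReal_re]
      exact integral_nonneg fun w => mul_nonneg (mul_nonneg (gauss_pos _ _).le
        (Set.indicator_nonneg (fun _ _ => zero_le_one) _)) (hv.nonneg _)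
    rw [Complex.re_ofReal_mul] at hlim
    have hpos := nonneg_of_mul_nonneg_right hlim (by positivity)
    have e2 : ∑' k, (ε k : ℂ) * ∫ b, B.indicator (fun _ => (1 : ℂ)) b *
        ⟪u k b, displacedParity z (u k b)⟫_ℂ =
        ∫ b in B, ∑' k, (ε k : ℂ) * ⟪u k b, displacedParity z (u k b)⟫_ℂ := by
      rw [← integral_tsum_of_summable_integral_norm (fun k => (hint' k).integrableOn) ?_]
      · refine tsum_congr fun k => ?_
        rw [integral_const_mul, ← integral_indicator hB]
        congr 1
        refine integral_congr_ae (Eventually.of_forall fun b => ?_)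
        by_cases h : b ∈ B <;> simp [h]
      · exact Summable.of_nonneg_of_le (fun k => integral_nonneg fun b => norm_nonneg _)
          (fun k => setIntegral_le_integral (hint' k).norm
            (Eventually.of_forall fun b => norm_nonneg _)) hsum
    rw [e2] at hpos
    exact hpos.trans_eq (integral_re hI.integrableOn).symm
  have hall : ∀ᵐ b, ∀ k, slice rfl (v k) b = u k b := ae_all_iff.2 hue
  filter_upwards [key, hall] with b h1 h2
  simp only [h2]
  exact h1

theorem ae_summable_slice {ι : Type*} [Countable ι] {m l n : ℕ} (h : m + l = n) {v : ι → H n}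
    (hv : Summable fun k => ‖v k‖ ^ 2) : ∀ᵐ b : Conf l, Summable fun k => ‖slice h (v k) b‖ ^ 2 := by
  have h1 : ∀ k, Integrable fun b : Conf l => ‖slice h (v k) b‖ ^ 2 := fun k =>
    (memLp_two_iff_integrable_sq_norm (memLp_slice h (v k)).1.1).1 (memLp_slice h (v k)).1
  have h2 : Summable fun k => ∫ b : Conf l, ‖‖slice h (v k) b‖ ^ 2‖ := by
    simpa only [norm_pow, norm_norm, (memLp_slice h (v _)).2.2] using hv
  filter_upwards [ae_summable_norm h1 h2] with b hb
  simpa only [norm_pow, norm_norm] using hb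

/-- Almost all slices of a family of non-negative Wigner function have the same property. -/
theorem IsPosFamily.ae_slice {ι : Type*} [Countable ι] {m l n : ℕ} (h : m + l = n) {ε : ι → ℝ}
    {v : ι → H n} (hv : IsPosFamily ε v) :
    ∀ᵐ b : Conf l, IsPosFamily ε fun k => slice h (v k) b := by
  subst h
  -- A single null set works for a countable dense set of z; continuity of the Wigner function
  -- covers the other points.
  have h1 := ae_all_iff.2 fun j : ℕ =>
    isPosFamily_slice_aux hv (TopologicalSpace.denseSeq (Phase m) j)
  filter_upwards [h1, ae_summable_slice rfl hv.summable] with b h2 h3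
  have hs : IsSignedFamily ε fun k => slice rfl (v k) b := ⟨hv.sign, h3⟩
  refine ⟨hs, fun z => ?_⟩
  refine (TopologicalSpace.denseRange_denseSeq (Phase m)).induction_on z
    (isClosed_le continuous_const hs.continuous_famWigner) fun j => ?_
  rw [← Complex.ofReal_re (famWigner _ _ _), ofReal_famWigner]
  exact h2 j

end Bosonic

namespace Bosonic

/-! ### Effects which respect non-negativity of Wigner functions -/

/-- Effects `0 ≤ M ≤ 1` such that `M` and `1 - M` have a non-negative trace against every
self-adjoint trace class operator of non-negative Wigner function. -/
structure IsPosEffect {m : ℕ} (M : H m →L[ℂ] H m) : Prop where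
  isPositive : M.IsPositive
  isPositive_sub : (1 - M).IsPositive
  nonneg : ∀ {ι : Type} [Countable ι] {ε : ι → ℝ} {v : ι → H m}, IsPosFamily ε v →
    0 ≤ (∑' k, (ε k : ℂ) * ⟪v k, M (v k)⟫_ℂ).re
  nonneg_sub : ∀ {ι : Type} [Countable ι] {ε : ι → ℝ} {v : ι → H m}, IsPosFamily ε v →
    0 ≤ (∑' k, (ε k : ℂ) * ⟪v k, (1 - M) (v k)⟫_ℂ).re

theorem norm_apply_le_of_isPositive {m : ℕ} {M : H m →L[ℂ] H m} (h : M.IsPositive)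
    (h' : (1 - M).IsPositive) (f : H m) : ‖M f‖ ≤ ‖f‖ := by
  have h0 : 0 ≤ M := (ContinuousLinearMap.nonneg_iff_isPositive M).2 h
  have h1 : M ≤ 1 := (ContinuousLinearMap.le_def M 1).2 h'
  have h2 : ‖M‖ ≤ 1 := (CStarAlgebra.norm_le_one_iff_of_nonneg M h0).2 h1
  exact (M.le_of_opNorm_le h2 f).trans_eq (one_mul _)

theorem isPositive_of_inner {m : ℕ} {M : H m →L[ℂ] H m}
    (h : ∀ f, ∃ r : ℝ, 0 ≤ r ∧ ⟪f, M f⟫_ℂ = (r : ℂ)) : M.IsPositive := by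
  refine (ContinuousLinearMap.isPositive_iff_complex M).2 fun f => ?_
  obtain ⟨r, hr, hf⟩ := h f
  have : ⟪M f, f⟫_ℂ = (r : ℂ) := by rw [← inner_conj_symm, hf, Complex.conj_ofReal]
  rw [this]
  exact ⟨by simp, by simpa using hr⟩

theorem ContinuousLinearMap_isPositive_inner {m : ℕ} {M : H m →L[ℂ] H m} (h : M.IsPositive)
    (f : H m) : 0 ≤ (⟪f, M f⟫_ℂ).re ∧ ⟪f, M f⟫_ℂ = ((⟪f, M f⟫_ℂ).re : ℂ) := by
  have h1 := (ContinuousLinearMap.isPositive_iff_complex M).1 h f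
  have e : ⟪f, M f⟫_ℂ = ⟪M f, f⟫_ℂ := by rw [← inner_conj_symm, ← h1.1]; simp
  rw [e]
  exact ⟨h1.2, h1.1.symm⟩

theorem inner_self_eq_ofReal {E : Type*} [NormedAddCommGroup E] [InnerProductSpace ℂ E] (f : E) :
    ⟪f, f⟫_ℂ = ((‖f‖ ^ 2 : ℝ) : ℂ) := by
  rw [inner_self_eq_norm_sq_to_K]
  exact (Complex.ofReal_pow _ _).symm

/-! ### Quadratic functionals -/

section Quadratic

variable {E : Type*} [NormedAddCommGroup E] [InnerProductSpace ℂ E] {l : ℕ}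

theorem integrable_inner_apply {N : Conf l → E →L[ℂ] E} (hN : ∀ b f, ‖N b f‖ ≤ ‖f‖)
    {F : Conf l → E} (hF : MemLp F 2 volume)
    (hm : AEStronglyMeasurable (fun b => ⟪F b, N b (F b)⟫_ℂ) volume) :
    Integrable fun b => ⟪F b, N b (F b)⟫_ℂ := by
  refine ((memLp_two_iff_integrable_sq_norm hF.1).1 hF).mono' hm (Eventually.of_forall fun b => ?_)
  calc _ ≤ ‖F b‖ * ‖N b (F b)‖ := norm_inner_le_norm _ _
    _ ≤ ‖F b‖ * ‖F b‖ := by gcongr; exact hN _ _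
    _ = _ := (sq _).symm

/-- Exchange F for G in one factor at a time and apply Cauchy–Schwarz. The decomposition F = G + D
is demanded almost everywhere only, as slicing is additive only in that sense. It yields the
continuity in the state vector needed for measurability in the record. -/
theorem norm_integral_inner_sub_le {N : Conf l → E →L[ℂ] E} (hN : ∀ b f, ‖N b f‖ ≤ ‖f‖)
    {F G D : Conf l → E} (hF : MemLp F 2 volume) (hG : MemLp G 2 volume) (hD : MemLp D 2 volume)
    (hFm : AEStronglyMeasurable (fun b => ⟪F b, N b (F b)⟫_ℂ) volume)
    (hGm : AEStronglyMeasurable (fun b => ⟪G b, N b (G b)⟫_ℂ) volume)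
    (he : ∀ᵐ b, F b = G b + D b) :
    ‖(∫ b, ⟪F b, N b (F b)⟫_ℂ) - ∫ b, ⟪G b, N b (G b)⟫_ℂ‖ ≤
      (l2Norm F + l2Norm G) * l2Norm D := by
  rw [← integral_sub (integrable_inner_apply hN hF hFm) (integrable_inner_apply hN hG hGm)]
  have h1 := integral_norm_mul_norm_le hF hD
  have h2 := integral_norm_mul_norm_le hG hD
  calc _ ≤ ∫ b, (‖F b‖ * ‖D b‖ + ‖G b‖ * ‖D b‖) := by
        refine norm_integral_le_of_norm_le (h1.1.add h2.1) ?_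
        filter_upwards [he] with b hb
        have e : ⟪F b, N b (F b)⟫_ℂ - ⟪G b, N b (G b)⟫_ℂ =
            ⟪D b, N b (F b)⟫_ℂ + ⟪G b, N b (D b)⟫_ℂ := by
          have : N b (F b) = N b (G b) + N b (D b) := by rw [hb, map_add]
          rw [this]
          nth_rewrite 1 [hb]
          simp only [inner_add_left, inner_add_right]
          ring
        rw [e]
        refine (norm_add_le _ _).trans (add_le_add ?_ ?_)
        · rw [mul_comm]
          exact (norm_inner_le_norm _ _).trans (by gcongr; exact hN _ _)
        · exact (norm_inner_le_norm _ _).trans (by gcongr; exact hN _ _)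
    _ ≤ _ := by
        rw [integral_add h1.1 h2.1, add_mul]
        exact add_le_add h1.2 h2.2

theorem continuous_of_norm_sub_le {F : Type*} [NormedAddCommGroup F] {Φ : F → ℂ}
    (h : ∀ f g, ‖Φ f - Φ g‖ ≤ (‖f‖ + ‖g‖) * ‖f - g‖) : Continuous Φ := by
  refine continuous_iff_continuousAt.2 fun g => ?_
  refine tendsto_iff_norm_sub_tendsto_zero.2 (squeeze_zero (fun _ => norm_nonneg _)
    (fun f => h f g) ?_)
  have hc : Continuous fun f => (‖f‖ + ‖g‖) * ‖f - g‖ := by fun_prop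
  simpa using hc.tendsto g

end Quadratic

/-! ### The last round -/

/-- The position distribution is, up to the factor π^m, the momentum marginal of the Wigner
function: the marginal formula with zero shift. -/
theorem IsPosFamily.tsum_setIntegral_nonneg {ι : Type*} [Countable ι] {m : ℕ} {ε : ι → ℝ}
    {v : ι → H m} (hv : IsPosFamily ε v) {B : Set (Conf m)} (hB : MeasurableSet B) :
    0 ≤ (∑' k, (ε k : ℂ) * ((∫ x in B, ‖v k x‖ ^ 2 : ℝ) : ℂ)).re := by
  have hw := hv.integrable_famWigner hv.nonneg
  have hC : ∀ b, ‖B.indicator (fun _ => (1 : ℂ)) b‖ ≤ 1 := fun b => by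
    by_cases h : b ∈ B <;> simp [h]
  have h1 := hv.integral_famWigner_mul hw 0 (measurable_const.indicator hB) hC
  have e1 : ∀ k, ∫ b, B.indicator (fun _ => (1 : ℂ)) b * ⟪v k (b + 0), v k (b - 0)⟫_ℂ =
      ((∫ x in B, ‖v k x‖ ^ 2 : ℝ) : ℂ) := fun k => by
    rw [← integral_complex_ofReal, ← integral_indicator hB]
    refine integral_congr_ae (Eventually.of_forall fun b => ?_)
    simp only [add_zero, sub_zero, inner_self_eq_ofReal]
    by_cases h : b ∈ B <;> simp [h]
  have e2 : ∀ z : Phase m, (famWigner ε v z : ℂ) * (B.indicator (fun _ => (1 : ℂ)) z.1 *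
      Complex.exp (-(Complex.I * ((z.2 ⬝ᵥ ((2 : ℝ) • (0 : Conf m)) : ℝ) : ℂ)))) =
      ((famWigner ε v z * B.indicator (fun _ => (1 : ℝ)) z.1 : ℝ) : ℂ) := fun z => by
    by_cases h : z.1 ∈ B <;> simp [h]
  simp only [e1, e2] at h1
  rw [integral_complex_ofReal] at h1
  have h2 := congrArg Complex.re h1
  rw [Complex.ofReal_re, Complex.re_ofReal_mul] at h2
  refine nonneg_of_mul_nonneg_right (a := Real.pi ^ m) ?_ (by positivity)
  rw [← h2]
  exact integral_nonneg fun z => mul_nonneg (hv.nonneg z)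
    (Set.indicator_nonneg (fun _ _ => zero_le_one) _)

theorem integrable_norm_sq {m : ℕ} (f : H m) : Integrable fun x => ‖f x‖ ^ 2 :=
  (memLp_two_iff_integrable_sq_norm (Lp.memLp f).1).1 (Lp.memLp f)

theorem integral_coeFn_norm_sq {m : ℕ} (f : H m) : ∫ x, ‖f x‖ ^ 2 = ‖f‖ ^ 2 := by
  have h := integral_norm_sq f
  simp only [inner_self_eq_ofReal] at h
  rw [integral_complex_ofReal] at h
  exact Complex.ofReal_injective h

section GOCC

variable {m : ℕ} {Y : Type} [MeasurableSpace Y]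

/-- Adjoining the vacuum and applying U preserve the norm, so 1 - M is the effect of the complement
of B and needs no separate argument. -/
theorem isPosEffect_last {k : ℕ} {U : H (m + k) ≃ₗᵢ[ℂ] H (m + k)} (hU : IsGaussianUnitary U)
    {B : Set (Conf (m + k))} (hB : MeasurableSet B) {M : H m →L[ℂ] H m}
    (hM : ∀ f, ⟪f, M f⟫_ℂ = ((∫ x in B, ‖U (tensorVec f (vacuum k)) x‖ ^ 2 : ℝ) : ℂ)) :
    IsPosEffect M := by
  have hM' : ∀ f, ⟪f, (1 - M) f⟫_ℂ =
      ((∫ x in Bᶜ, ‖U (tensorVec f (vacuum k)) x‖ ^ 2 : ℝ) : ℂ) := fun f => by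
    rw [sub_apply, inner_sub_right, hM, one_apply_eq_self,
      inner_self_eq_ofReal, ← Complex.ofReal_sub]
    congr 1
    rw [← norm_tensorVec_vacuum k f, ← U.norm_map, ← integral_coeFn_norm_sq,
      ← integral_add_compl hB (integrable_norm_sq _)]
    ring
  refine ⟨isPositive_of_inner fun f => ⟨_, integral_nonneg fun x => by positivity, hM f⟩,
    isPositive_of_inner fun f => ⟨_, integral_nonneg fun x => by positivity, hM' f⟩,
    fun hv => ?_, fun hv => ?_⟩
  · simp only [hM]
    exact ((hv.tensorVec_vacuum k).gaussianUnitary hU).tsum_setIntegral_nonneg hB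
  · simp only [hM']
    exact ((hv.tensorVec_vacuum k).gaussianUnitary hU).tsum_setIntegral_nonneg hB.compl

theorem IsGaussianUnitaryFamily.stronglyMeasurable {U : Y → H m ≃ₗᵢ[ℂ] H m}
    (hU : IsGaussianUnitaryFamily U) (g : H m) : StronglyMeasurable fun y => U y g :=
  stronglyMeasurable_of_inner fun f => hU.2 f g

theorem measurable_last {k : ℕ} {U : Y → H (m + k) ≃ₗᵢ[ℂ] H (m + k)}
    (hU : IsGaussianUnitaryFamily U) {A : Set (Y × Conf (m + k))} (hA : MeasurableSet A) (f : H m) :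
    Measurable fun y => ((∫ x in {x | (y, x) ∈ A}, ‖U y (tensorVec f (vacuum k)) x‖ ^ 2 : ℝ) : ℂ) := by
  have hAy : ∀ y, MeasurableSet {x | (y, x) ∈ A} := fun y => measurable_prodMk_left hA
  -- The acceptance set as a contraction on ℂ, which brings the last round into the form of the
  -- quadratic functionals above.
  let P : Y → Conf (m + k) → ℂ →L[ℂ] ℂ := fun y x =>
    A.indicator (fun _ => (1 : ℂ)) (y, x) • ContinuousLinearMap.id ℂ ℂ
  have hP : ∀ y x (c : ℂ), ‖P y x c‖ ≤ ‖c‖ := fun y x c => by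
    by_cases h : (y, x) ∈ A <;> simp [P, h]
  have hPm : ∀ g : H (m + k), StronglyMeasurable fun q : Y × Conf (m + k) =>
      ⟪g q.2, P q.1 q.2 (g q.2)⟫_ℂ := fun g => by
    have hg : StronglyMeasurable fun q : Y × Conf (m + k) => g q.2 :=
      (Lp.stronglyMeasurable g).comp_measurable measurable_snd
    have hA1 : StronglyMeasurable (A.indicator fun _ => (1 : ℂ)) :=
      (measurable_const.indicator hA).stronglyMeasurable
    exact hg.inner (hA1.smul hg)
  have e : ∀ y (g : H (m + k)), ((∫ x in {x | (y, x) ∈ A}, ‖g x‖ ^ 2 : ℝ) : ℂ) =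
      ∫ x, ⟪g x, P y x (g x)⟫_ℂ := fun y g => by
    rw [← integral_complex_ofReal, ← integral_indicator (hAy y)]
    refine integral_congr_ae (Eventually.of_forall fun x => ?_)
    by_cases h : (y, x) ∈ A
    · simp only [P, Set.mem_ofPred_eq, h, Set.indicator_of_mem, one_smul,
        ContinuousLinearMap.id_apply, inner_self_eq_ofReal]
    · simp [P, h]
  simp only [e]
  refine (stronglyMeasurable_comp_of_continuous
    (u := fun (g : H (m + k)) y => ∫ x, ⟪g x, P y x (g x)⟫_ℂ) (fun y => ?_) (fun g => ?_)
    (hU.stronglyMeasurable (tensorVec f (vacuum k)))).measurable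
  · have hy : ∀ g : H (m + k), AEStronglyMeasurable (fun x => ⟪g x, P y x (g x)⟫_ℂ) volume :=
      fun g => ((hPm g).comp_measurable measurable_prodMk_left).aestronglyMeasurable
    refine continuous_of_norm_sub_le fun f g => ?_
    rw [← l2Norm_coe f, ← l2Norm_coe g, ← l2Norm_coe (f - g)]
    refine norm_integral_inner_sub_le (hP y) (Lp.memLp f) (Lp.memLp g) (Lp.memLp (f - g)) (hy f)
      (hy g) ?_
    filter_upwards [Lp.coeFn_sub f g] with x hx
    rw [hx, Pi.sub_apply]
    ring
  · exact (hPm g).integral_prod_right'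

/-! ### A round which is followed by others -/

theorem aestronglyMeasurable_inner_slice {m' l n : ℕ} (h : m' + l = n)
    {N : Conf l → H m' →L[ℂ] H m'} (hN : ∀ g, StronglyMeasurable fun b => N b g) (f : H n) :
    AEStronglyMeasurable (fun b => ⟪slice h f b, N b (slice h f b)⟫_ℂ) volume := by
  have hf := aestronglyMeasurable_slice h f
  refine (hf.stronglyMeasurable_mk.inner
    (stronglyMeasurable_clm_apply hN hf.stronglyMeasurable_mk)).aestronglyMeasurable.congr ?_
  filter_upwards [hf.ae_eq_mk] with b hb
  rw [← hb]

/-- After exchanging sum and integral, the integrand at b pairs N b with the sliced family, whose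
Wigner function is non-negative for almost all b. -/
theorem IsPosFamily.tsum_integral_nonneg {ι : Type} [Countable ι] {m' l n : ℕ} (h : m' + l = n)
    {ε : ι → ℝ} {v : ι → H n} (hv : IsPosFamily ε v) {N : Conf l → H m' →L[ℂ] H m'}
    (hN : ∀ g, StronglyMeasurable fun b => N b g) (hb : ∀ b f, ‖N b f‖ ≤ ‖f‖)
    (hp : ∀ b {w : ι → H m'}, IsPosFamily ε w → 0 ≤ (∑' k, (ε k : ℂ) * ⟪w k, N b (w k)⟫_ℂ).re) :
    0 ≤ (∑' k, (ε k : ℂ) * ∫ b, ⟪slice h (v k) b, N b (slice h (v k) b)⟫_ℂ).re := by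
  have hi : ∀ k, Integrable fun b => (ε k : ℂ) * ⟪slice h (v k) b, N b (slice h (v k) b)⟫_ℂ :=
    fun k => (integrable_inner_apply hb (memLp_slice h (v k)).1
      (aestronglyMeasurable_inner_slice h hN (v k))).const_mul _
  have hs : Summable fun k => ∫ b, ‖(ε k : ℂ) * ⟪slice h (v k) b, N b (slice h (v k) b)⟫_ℂ‖ := by
    refine Summable.of_nonneg_of_le (fun k => integral_nonneg fun b => norm_nonneg _) (fun k => ?_)
      hv.summable
    rw [← (memLp_slice h (v k)).2.2]
    refine integral_mono (hi k).norm ((memLp_two_iff_integrable_sq_norm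
      (memLp_slice h (v k)).1.1).1 (memLp_slice h (v k)).1) fun b => ?_
    simp only [norm_mul, Complex.norm_real, Real.norm_eq_abs]
    calc _ ≤ 1 * (‖slice h (v k) b‖ * ‖slice h (v k) b‖) :=
          mul_le_mul (hv.sign k) ((norm_inner_le_norm _ _).trans (by gcongr; exact hb _ _))
            (norm_nonneg _) zero_le_one
      _ = _ := by ring
  have e := integral_tsum_of_summable_integral_norm hi hs
  simp only [integral_const_mul] at e
  rw [e]
  have e2 := integral_re (𝕜 := ℂ) (integrable_tsum hi hs)
  refine le_of_le_of_eq (integral_nonneg_of_ae ?_) e2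
  filter_upwards [hv.ae_slice h] with b hvb
  exact hp b hvb

/-- Since slices preserve the total norm, 1 - M arises from 1 - N by the formula that gives M from
N; one argument settles both. -/
theorem isPosEffect_round {k m' l : ℕ} (h : m' + l = m + k) {U : H (m + k) ≃ₗᵢ[ℂ] H (m + k)}
    (hU : IsGaussianUnitary U) {N : Conf l → H m' →L[ℂ] H m'} (hN : ∀ b, IsPosEffect (N b))
    (hNm : ∀ g, StronglyMeasurable fun b => N b g) {M : H m →L[ℂ] H m}
    (hM : ∀ f, ⟪f, M f⟫_ℂ = ∫ b : Conf l, ⟪slice h (U (tensorVec f (vacuum k))) b,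
      N b (slice h (U (tensorVec f (vacuum k))) b)⟫_ℂ) : IsPosEffect M := by
  have hb : ∀ b f, ‖N b f‖ ≤ ‖f‖ := fun b =>
    norm_apply_le_of_isPositive (hN b).isPositive (hN b).isPositive_sub
  have hb' : ∀ b f, ‖(1 - N b) f‖ ≤ ‖f‖ := fun b =>
    norm_apply_le_of_isPositive (hN b).isPositive_sub (by simpa using (hN b).isPositive)
  have hNm' : ∀ g, StronglyMeasurable fun b => (1 - N b) g := fun g => by
    exact (stronglyMeasurable_const (b := g)).sub (hNm g)
  have hM' : ∀ f, ⟪f, (1 - M) f⟫_ℂ = ∫ b : Conf l, ⟪slice h (U (tensorVec f (vacuum k))) b,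
      (1 - N b) (slice h (U (tensorVec f (vacuum k))) b)⟫_ℂ := fun f => by
    have h1 := inner_slice h (U (tensorVec f (vacuum k))) (U (tensorVec f (vacuum k)))
    simp only [sub_apply, inner_sub_right, hM, one_apply_eq_self]
    rw [integral_sub h1.1 (integrable_inner_apply hb (memLp_slice h _).1
      (aestronglyMeasurable_inner_slice h hNm _)), h1.2, inner_self_eq_ofReal,
      inner_self_eq_ofReal, U.norm_map, norm_tensorVec_vacuum]
  have hpos : ∀ {K : Conf l → H m' →L[ℂ] H m'} {T : H m →L[ℂ] H m}, (∀ b, (K b).IsPositive) →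
      (∀ f, ⟪f, T f⟫_ℂ = ∫ b : Conf l, ⟪slice h (U (tensorVec f (vacuum k))) b,
        K b (slice h (U (tensorVec f (vacuum k))) b)⟫_ℂ) → T.IsPositive := by
    intro K T hK hT
    refine isPositive_of_inner fun f => ⟨∫ b : Conf l, (⟪slice h (U (tensorVec f (vacuum k))) b,
        K b (slice h (U (tensorVec f (vacuum k))) b)⟫_ℂ).re, integral_nonneg fun b =>
          (ContinuousLinearMap_isPositive_inner (hK b) _).1, ?_⟩
    rw [hT, ← integral_complex_ofReal]
    exact integral_congr_ae (Eventually.of_forall fun b =>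
      (ContinuousLinearMap_isPositive_inner (hK b) _).2)
  refine ⟨hpos (fun b => (hN b).isPositive) hM, hpos (fun b => (hN b).isPositive_sub) hM',
    fun hv => ?_, fun hv => ?_⟩
  · simp only [hM]
    have h1 := (hv.tensorVec_vacuum k).gaussianUnitary hU
    exact h1.tsum_integral_nonneg h hNm hb fun b _ hw => (hN b).nonneg hw
  · simp only [hM']
    have h1 := (hv.tensorVec_vacuum k).gaussianUnitary hU
    exact h1.tsum_integral_nonneg h hNm' hb' fun b _ hw => (hN b).nonneg_sub hw

theorem measurable_round {k m' l : ℕ} (h : m' + l = m + k) {U : Y → H (m + k) ≃ₗᵢ[ℂ] H (m + k)}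
    (hU : IsGaussianUnitaryFamily U) {N : Y × Conf l → H m' →L[ℂ] H m'}
    (hN : ∀ q, IsPosEffect (N q)) (hNm : ∀ g, StronglyMeasurable fun q => N q g) (f : H m) :
    Measurable fun y => ∫ b : Conf l, ⟪slice h (U y (tensorVec f (vacuum k))) b,
      N (y, b) (slice h (U y (tensorVec f (vacuum k))) b)⟫_ℂ := by
  have hb : ∀ q f, ‖N q f‖ ≤ ‖f‖ := fun b =>
    norm_apply_le_of_isPositive (hN b).isPositive (hN b).isPositive_sub
  refine (stronglyMeasurable_comp_of_continuous
    (u := fun (g : H (m + k)) y => ∫ b, ⟪slice h g b, N (y, b) (slice h g b)⟫_ℂ)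
    (fun y => ?_) (fun g => ?_) (hU.stronglyMeasurable (tensorVec f (vacuum k)))).measurable
  · have hy : ∀ g, AEStronglyMeasurable (fun b => ⟪slice h g b, N (y, b) (slice h g b)⟫_ℂ) volume :=
      aestronglyMeasurable_inner_slice h fun g => (hNm g).comp_measurable measurable_prodMk_left
    refine continuous_of_norm_sub_le fun f g => ?_
    rw [← (memLp_slice h f).2.1, ← (memLp_slice h g).2.1, ← (memLp_slice h (f - g)).2.1]
    refine norm_integral_inner_sub_le (fun b => hb (y, b)) (memLp_slice h f).1 (memLp_slice h g).1
      (memLp_slice h (f - g)).1 (hy f) (hy g) ?_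
    filter_upwards [slice_add h g (f - g)] with b hb
    rw [← hb, add_sub_cancel]
  · have hg := aestronglyMeasurable_slice h g
    have hs : StronglyMeasurable fun q : Y × Conf l => hg.mk _ q.2 :=
      hg.stronglyMeasurable_mk.comp_measurable measurable_snd
    have hi : StronglyMeasurable fun q : Y × Conf l => ⟪hg.mk _ q.2, N q (hg.mk _ q.2)⟫_ℂ :=
      hs.inner (stronglyMeasurable_clm_apply hNm hs)
    have h1 := hi.integral_prod_right' (ν := (volume : Measure (Conf l)))
    convert h1 using 1
    funext y
    refine integral_congr_ae ?_
    filter_upwards [hg.ae_eq_mk] with b hb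
    simp only [← hb]

/-- The effects of Gaussian protocols respect non-negativity of Wigner functions. -/
theorem GOCCFamily.isPosEffect {R : ℕ} {M : Y → H m →L[ℂ] H m} (hM : GOCCFamily R m Y M) :
    (∀ f, Measurable fun y => ⟪f, M y f⟫_ℂ) ∧ ∀ y, IsPosEffect (M y) := by
  -- Measurability in the record has to be part of the induction: an earlier round integrates the
  -- later effects over its outcome.
  induction hM with
  | last k U hU A hA M hM =>
    refine ⟨fun f => ?_, fun y => isPosEffect_last (hU.1 y) (measurable_prodMk_left hA) (hM y)⟩
    simp only [hM]
    exact measurable_last hU hA f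
  | round k h U hU N hN M hM ih =>
    have hNm := stronglyMeasurable_of_quadraticForm ih.1
    refine ⟨fun f => ?_, fun y => isPosEffect_round h (hU.1 y) (fun b => ih.2 (y, b))
      (fun g => (hNm g).comp_measurable measurable_prodMk_left) (hM y)⟩
    simp only [hM]
    exact measurable_round h hU ih.2 hNm f
  | branch c hc M h ih =>
    refine ⟨fun f s hs => ?_, fun y => (ih (c y)).2 ⟨y, rfl⟩⟩
    -- The record space is a countable union of measurable pieces on which the number of modes is
    -- constant.
    have e : (fun y => ⟪f, M y f⟫_ℂ) ⁻¹' s = ⋃ i : ℕ, Subtype.val ''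
        ((fun y : {y // c y = i} => ⟪f, M y.1 f⟫_ℂ) ⁻¹' s) := by
      ext y
      simp
    rw [e]
    exact MeasurableSet.iUnion fun i => MeasurableSet.subtype_image
      (hc (measurableSet_singleton i)) ((ih i).1 f hs)

end GOCC

/-- All four conditions are closed under strong limits; pairings with families converge by
domination with ‖v k‖². -/
theorem IsPosEffect.of_tendsto {m : ℕ} {P : ℕ → H m →L[ℂ] H m} {M : H m →L[ℂ] H m}
    (hP : ∀ j, IsPosEffect (P j)) (hM : ∀ f, Tendsto (fun j => P j f) atTop (𝓝 (M f))) :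
    IsPosEffect M := by
  have hb : ∀ j f, ‖P j f‖ ≤ ‖f‖ := fun j =>
    norm_apply_le_of_isPositive (hP j).isPositive (hP j).isPositive_sub
  have hb' : ∀ j f, ‖(1 - P j) f‖ ≤ ‖f‖ := fun j =>
    norm_apply_le_of_isPositive (hP j).isPositive_sub (by simpa using (hP j).isPositive)
  have hM' : ∀ f, Tendsto (fun j => (1 - P j) f) atTop (𝓝 ((1 - M) f)) := fun f =>
    (tendsto_const_nhds (x := f)).sub (hM f)
  have hpos : ∀ {Q : ℕ → H m →L[ℂ] H m} {T : H m →L[ℂ] H m}, (∀ j, (Q j).IsPositive) →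
      (∀ f, Tendsto (fun j => Q j f) atTop (𝓝 (T f))) → T.IsPositive := by
    intro Q T hQ hT
    have hlim : ∀ f, Tendsto (fun j => ⟪f, Q j f⟫_ℂ) atTop (𝓝 ⟪f, T f⟫_ℂ) := fun f =>
      tendsto_const_nhds.inner (hT f)
    have hre := fun f => (Complex.continuous_re.tendsto _).comp (hlim f)
    refine isPositive_of_inner fun f => ⟨(⟪f, T f⟫_ℂ).re, ?_, ?_⟩
    · exact ge_of_tendsto (hre f) (Eventually.of_forall fun j =>
        (ContinuousLinearMap_isPositive_inner (hQ j) f).1)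
    · refine tendsto_nhds_unique (hlim f)
        (((Complex.continuous_ofReal.tendsto _).comp (hre f)).congr fun j => ?_)
      exact (ContinuousLinearMap_isPositive_inner (hQ j) f).2.symm
  have hfam : ∀ {Q : ℕ → H m →L[ℂ] H m} {T : H m →L[ℂ] H m} {ι : Type} [Countable ι] {ε : ι → ℝ}
      {v : ι → H m}, (∀ j f, ‖Q j f‖ ≤ ‖f‖) → (∀ f, Tendsto (fun j => Q j f) atTop (𝓝 (T f))) →
      IsPosFamily ε v → (∀ j, 0 ≤ (∑' k, (ε k : ℂ) * ⟪v k, Q j (v k)⟫_ℂ).re) →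
      0 ≤ (∑' k, (ε k : ℂ) * ⟪v k, T (v k)⟫_ℂ).re := by
    intro Q T ι _ ε v hQ hT hv h0
    have h1 := tendsto_tsum_of_dominated_convergence (𝓕 := atTop)
      (f := fun j k => (ε k : ℂ) * ⟪v k, Q j (v k)⟫_ℂ) (g := fun k => (ε k : ℂ) * ⟪v k, T (v k)⟫_ℂ)
      hv.summable (fun k => (tendsto_const_nhds.inner (hT (v k))).const_mul _)
      (Eventually.of_forall fun j k => (hv.norm_le k (C := 1) (X := Q j)
        fun f => by simpa using hQ j f).trans_eq (one_mul _))
    exact ge_of_tendsto ((Complex.continuous_re.tendsto _).comp h1) (Eventually.of_forall h0)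
  exact ⟨hpos (fun j => (hP j).isPositive) hM, hpos (fun j => (hP j).isPositive_sub) hM',
    fun hv => hfam hb hM hv fun j => (hP j).nonneg hv,
    fun hv => hfam hb' hM' hv fun j => (hP j).nonneg_sub hv⟩

/-- The test operators in the definition of W+ are themselves signed families of non-negative Wigner
function; that it is Schwartz plays no role here. -/
theorem IsPosEffect.mem_wPlus {m : ℕ} {M : H m →L[ℂ] H m} (hM : IsPosEffect M) : M ∈ wPlus m := by
  have key : ∀ {φ : 𝓢(Phase m, ℝ)} {T : H m →L[ℂ] H m}, IsSelfAdjointTraceClass T →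
      (∀ z, wigner T z = φ z) → (∀ z, 0 ≤ φ z) →
      ∃ (ε : basisIdx m ⊕ basisIdx m → ℝ) (v : basisIdx m ⊕ basisIdx m → H m), IsPosFamily ε v ∧
        ∀ X : H m →L[ℂ] H m, opTrace (X ∘L T) = ∑' k, (ε k : ℂ) * ⟪v k, X (v k)⟫_ℂ := by
    intro φ T hT hφ h0
    obtain ⟨ε, v, hv, hvT⟩ := hT.exists_represents
    refine ⟨ε, v, ⟨hv, fun z => ?_⟩, hv.opTrace_left hvT⟩
    have h1 := h0 z
    rw [← hφ, hv.wigner_eq hvT] at h1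
    exact nonneg_of_mul_nonneg_right h1 (by positivity)
  refine ⟨hM.isPositive, hM.isPositive_sub, fun φ T hT hφ h0 => ?_, fun φ T hT hφ h0 => ?_⟩
  · obtain ⟨ε, v, hv, h⟩ := key hT hφ h0
    rw [h]
    exact hM.nonneg hv
  · obtain ⟨ε, v, hv, h⟩ := key hT hφ h0
    rw [h]
    exact hM.nonneg_sub hv

theorem gocc_subset_wPlus (m : ℕ) : gocc m ⊆ wPlus m := by
  rintro M ⟨P, hP, hM⟩
  refine (IsPosEffect.of_tendsto (fun j => ?_) hM).mem_wPlus
  obtain ⟨R, hR⟩ := hP j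
  exact hR.isPosEffect.2 ()

/-- The test with empty acceptance set. A witness is needed since the real infimum of the empty set
is 0 by convention, which would spoil its monotonicity. -/
theorem gocc_nonempty (m : ℕ) : (gocc m).Nonempty := by
  refine ⟨0, fun _ => 0, fun _ => ⟨1, ?_⟩, fun f => tendsto_const_nhds⟩
  refine GOCCFamily.last 0 (fun _ => LinearIsometryEquiv.refl ℂ _) ⟨fun _ => ?_, fun f g => ?_⟩ ∅
    MeasurableSet.empty _ fun _ f => ?_
  · exact ⟨LinearMap.id, 0, fun _ _ => rfl, fun z f => by simp [symp]⟩
  · exact measurable_const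
  · simp

/-! ### Comparing error exponents -/

theorem HasEnsemble.opTrace_nonneg {m : ℕ} {ρ M : H m →L[ℂ] H m} (hρ : HasEnsemble ρ)
    (hM : M.IsPositive) : 0 ≤ (opTrace (ρ ∘L M)).re := by
  obtain ⟨ι, hι, v, hv, hvρ, -⟩ := hρ
  rw [hv.opTrace_right hvρ, Complex.re_tsum (hv.summable_inner M)]
  refine tsum_nonneg fun k => ?_
  simpa using (ContinuousLinearMap_isPositive_inner hM (v k)).1

theorem errorProb_nonneg {m : ℕ} {ρ₀ ρ₁ M : H m →L[ℂ] H m} (h₀ : HasEnsemble ρ₀)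
    (h₁ : HasEnsemble ρ₁) (hM : M ∈ wPlus m) : 0 ≤ errorProb ρ₀ ρ₁ M := by
  have := h₀.opTrace_nonneg hM.2.1
  have := h₁.opTrace_nonneg hM.1
  rw [errorProb]
  linarith

theorem rate_antitone (n : ℕ) : Antitone (rate n) := fun a b h =>
  EReal.div_le_div_right_of_nonneg (by positivity)
    (EReal.neg_le_neg_iff.2 (ENNReal.log_monotone (ENNReal.ofReal_le_ofReal h)))

theorem one_sub_distNorm {m : ℕ} (C : Set (H m →L[ℂ] H m)) (ρ₀ ρ₁ : H m →L[ℂ] H m) :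
    1 - distNorm C ρ₀ ρ₁ / 2 = 2 * sInf (errorProb ρ₀ ρ₁ '' C) := by
  rw [distNorm]
  ring

theorem chernoffSeq_gocc_le {m : ℕ} {ρ₀ ρ₁ : H m →L[ℂ] H m} (h₀ : HasEnsemble ρ₀)
    (h₁ : HasEnsemble ρ₁) (n : ℕ) : chernoffSeq gocc ρ₀ ρ₁ n ≤ chernoffSeq wPlus ρ₀ ρ₁ n := by
  obtain ⟨e, -, he⟩ := exists_tensorPow_equiv m n
  refine rate_antitone n ?_
  rw [one_sub_distNorm, one_sub_distNorm]
  refine mul_le_mul_of_nonneg_left (csInf_le_csInf ⟨0, ?_⟩ ((gocc_nonempty _).image _)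
    (Set.image_mono (gocc_subset_wPlus _))) zero_le_two
  rintro _ ⟨M, hM, rfl⟩
  exact errorProb_nonneg (he ρ₀ h₀).1 (he ρ₁ h₁).1 hM

end Bosonic

namespace Bosonic

/-! ### Self-adjoint trace class operators are determined by their Wigner functions -/

theorem measurePreserving_shear (m : ℕ) :
    MeasurePreserving (fun q : Conf m × Conf m => (q.2, q.2 + q.1)) (volume.prod volume)
      (volume.prod volume) :=
  (measurePreserving_prod_add volume volume).comp Measure.measurePreserving_swap

theorem inner_indicatorConstLp_one' {m : ℕ} {s : Set (Conf m)} (hs : MeasurableSet s)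
    (hs' : volume s ≠ ∞) (f : H m) :
    ⟪indicatorConstLp 2 hs hs' (1 : ℂ), f⟫_ℂ = ∫ x, s.indicator (fun _ => (1 : ℂ)) x * f x := by
  rw [L2.inner_indicatorConstLp_one, ← integral_indicator hs]
  refine integral_congr_ae (Eventually.of_forall fun x => ?_)
  by_cases h : x ∈ s <;> simp [h]

theorem eq_zero_of_forall_inner_indicator {m : ℕ} {x : H m}
    (h : ∀ (s : Set (Conf m)) (hs : MeasurableSet s) (hs' : volume s ≠ ∞),
      ⟪indicatorConstLp 2 hs hs' (1 : ℂ), x⟫_ℂ = 0) : x = 0 := by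
  rw [Lp.eq_zero_iff_ae_eq_zero]
  refine Lp.ae_eq_zero_of_forall_setIntegral_eq_zero x two_ne_zero ENNReal.ofNat_ne_top
    (fun s _ hs' => integrableOn_Lp_of_measure_ne_top x fact_one_le_two_ennreal.elim hs'.ne)
    fun s hs hs' => ?_
  rw [← L2.inner_indicatorConstLp_one (𝕜 := ℂ) hs hs'.ne]
  exact h s hs hs'.ne

/-- Fourier inversion in momentum recovers the kernel ∑ ε_k v_k(x) conj(v_k(y)): for each fixed
difference of the arguments, all its bounded averages over the centre vanish. Matrix elements
between indicators are integrals of the kernel, and the shear (r, x) ↦ (x, x + r) arranges them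
along the lines of fixed difference. -/
theorem IsSignedFamily.eq_zero_of_famWigner_eq_zero {ι : Type*} [Countable ι] {m : ℕ} {ε : ι → ℝ}
    {v : ι → H m} (hv : IsSignedFamily ε v) (h0 : ∀ z, famWigner ε v z = 0) {T : H m →L[ℂ] H m}
    (hT : Represents ε v T) : T = 0 := by
  have hint : Integrable (famWigner ε v) := by
    rw [funext h0]
    exact integrable_zero _ _ _
  have hker : ∀ (a : Conf m) {h : Conf m → ℂ}, Measurable h → (∀ b, ‖h b‖ ≤ 1) →
      ∑' k, (ε k : ℂ) * ∫ b, h b * ⟪v k (b + a), v k (b - a)⟫_ℂ = 0 := by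
    intro a h hm hC
    have h1 := hv.integral_famWigner_mul hint a hm hC
    simp only [h0, Complex.ofReal_zero, zero_mul, integral_zero] at h1
    refine (mul_eq_zero.1 h1.symm).resolve_left ?_
    exact_mod_cast (pow_pos Real.pi_pos m).ne'
  have key : ∀ (s t : Set (Conf m)) (hs : MeasurableSet s) (ht : MeasurableSet t)
      (hs' : volume s ≠ ∞) (ht' : volume t ≠ ∞),
      ⟪indicatorConstLp 2 hs hs' (1 : ℂ), T (indicatorConstLp 2 ht ht' 1)⟫_ℂ = 0 := by
    intro s t hs ht hs' ht'
    let S : Conf m → ℂ := s.indicator fun _ => 1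
    let R : Conf m → ℂ := t.indicator fun _ => 1
    have hSm : Measurable S := measurable_const.indicator hs
    have hRm : Measurable R := measurable_const.indicator ht
    have hS1 : ∀ x, ‖S x‖ ≤ 1 := fun x => by by_cases h : x ∈ s <;> simp [S, h]
    have hR1 : ∀ x, ‖R x‖ ≤ 1 := fun x => by by_cases h : x ∈ t <;> simp [R, h]
    have hSL : MemLp S 2 volume := (memLp_indicator_const 2 hs (1 : ℂ) (Or.inr hs'))
    have hRL : MemLp R 2 volume := (memLp_indicator_const 2 ht (1 : ℂ) (Or.inr ht'))
    let F : ι → Conf m × Conf m → ℂ := fun k q =>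
      (S q.1 * v k q.1) * (starRingEnd ℂ) (R q.2 * v k q.2)
    have hi1 : ∀ k, Integrable (fun x => S x * v k x) ∧
        ∫ x, ‖S x * v k x‖ ≤ l2Norm S * ‖v k‖ := fun k => by
      have h := integral_norm_mul_norm_le hSL (Lp.memLp (v k))
      rw [l2Norm_coe] at h
      simp only [← norm_mul] at h
      exact ⟨(integrable_norm_iff (hSm.aestronglyMeasurable.mul
        (Lp.aestronglyMeasurable (v k)))).1 h.1, h.2⟩
    have hi2 : ∀ k, Integrable (fun x => R x * v k x) ∧
        ∫ x, ‖R x * v k x‖ ≤ l2Norm R * ‖v k‖ := fun k => by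
      have h := integral_norm_mul_norm_le hRL (Lp.memLp (v k))
      rw [l2Norm_coe] at h
      simp only [← norm_mul] at h
      exact ⟨(integrable_norm_iff (hRm.aestronglyMeasurable.mul
        (Lp.aestronglyMeasurable (v k)))).1 h.1, h.2⟩
    have hconj : ∀ k, Integrable fun x => (starRingEnd ℂ) (R x * v k x) := fun k =>
      (integrable_norm_iff (Complex.continuous_conj.comp_aestronglyMeasurable
        (hi2 k).1.aestronglyMeasurable)).1 (by simpa using (hi2 k).1.norm)
    have hF : ∀ k, Integrable (F k) (volume.prod volume) := fun k => (hi1 k).1.mul_prod (hconj k)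
    have hFn : ∀ k, ∫ q, ‖F k q‖ ∂(volume.prod volume) ≤ (l2Norm S * l2Norm R) * ‖v k‖ ^ 2 := by
      intro k
      have e : ∀ q, ‖F k q‖ = ‖S q.1 * v k q.1‖ * ‖R q.2 * v k q.2‖ := fun q => by
        rw [norm_mul, RCLike.norm_conj]
      simp only [e]
      rw [integral_prod_mul (fun x => ‖S x * v k x‖) fun x => ‖R x * v k x‖]
      calc _ ≤ (l2Norm S * ‖v k‖) * (l2Norm R * ‖v k‖) :=
            mul_le_mul (hi1 k).2 (hi2 k).2 (integral_nonneg fun _ => norm_nonneg _)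
              (mul_nonneg (l2Norm_nonneg _) (norm_nonneg _))
        _ = _ := by ring
    have hsh := measurePreserving_shear m
    have hmap : ∀ {G : Type} [NormedAddCommGroup G] [NormedSpace ℝ G] (f : Conf m × Conf m → G),
        AEStronglyMeasurable f (volume.prod volume) →
        ∫ q : Conf m × Conf m, f (q.2, q.2 + q.1) ∂(volume.prod volume) =
          ∫ q, f q ∂(volume.prod volume) := by
      intro G _ _ f hf
      have h := integral_map (μ := volume.prod volume) hsh.measurable.aemeasurable (f := f)
        (by rwa [hsh.map_eq])
      rw [hsh.map_eq] at h
      exact h.symm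
    let P : ι → Conf m × Conf m → ℂ := fun k q => (ε k : ℂ) * F k (q.2, q.2 + q.1)
    have hP : ∀ k, Integrable (P k) (volume.prod volume) := fun k =>
      ((hsh.integrable_comp (hF k).aestronglyMeasurable).2 (hF k)).const_mul _
    have hPn : ∀ k, ∫ q, ‖P k q‖ ∂(volume.prod volume) ≤ (l2Norm S * l2Norm R) * ‖v k‖ ^ 2 := by
      intro k
      refine le_trans ?_ (hFn k)
      have hm1 : ∫ q : Conf m × Conf m, ‖F k (q.2, q.2 + q.1)‖ ∂(volume.prod volume) =
          ∫ q, ‖F k q‖ ∂(volume.prod volume) := by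
        exact (hmap (fun q => ‖F k q‖) (hF k).norm.aestronglyMeasurable)
      rw [← hm1]
      refine integral_mono (hP k).norm
        ((hsh.integrable_comp (hF k).aestronglyMeasurable).2 (hF k)).norm fun q => ?_
      simp only [P, norm_mul, Complex.norm_real, Real.norm_eq_abs]
      exact mul_le_of_le_one_left (norm_nonneg _) (hv.sign k)
    -- Centring by x = b - r/2 makes the arguments b ± r/2, so the shift is r/2.
    have hJ : ∀ k r, ∫ x, P k (r, x) = (ε k : ℂ) * ∫ b, (S (b - (2⁻¹ : ℝ) • r) *
        (starRingEnd ℂ) (R (b + (2⁻¹ : ℝ) • r))) *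
          ⟪v k (b + (2⁻¹ : ℝ) • r), v k (b - (2⁻¹ : ℝ) • r)⟫_ℂ := by
      intro k r
      rw [integral_const_mul, ← integral_sub_right_eq_self _ ((2⁻¹ : ℝ) • r)]
      congr 1
      refine integral_congr_ae (Eventually.of_forall fun b => ?_)
      have e : b - (2⁻¹ : ℝ) • r + r = b + (2⁻¹ : ℝ) • r := by
        ext i
        simp only [Pi.add_apply, Pi.sub_apply, Pi.smul_apply, smul_eq_mul]
        ring
      simp only [F, e, map_mul, RCLike.inner_apply]
      ring
    have hJ0 : ∀ r, ∑' k, ∫ x, P k (r, x) = 0 := by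
      intro r
      simp only [hJ]
      refine hker ((2⁻¹ : ℝ) • r) ?_ fun b => ?_
      · exact (hSm.comp (measurable_id.sub_const _)).mul
          (Complex.continuous_conj.measurable.comp (hRm.comp (measurable_id.add_const _)))
      · rw [norm_mul, RCLike.norm_conj]
        exact mul_le_one₀ (hS1 _) (norm_nonneg _) (hR1 _)
    have hzero : ∑' k, ∫ q, P k q ∂(volume.prod volume) = 0 := by
      have hI : ∀ k, ∫ q, P k q ∂(volume.prod volume) = ∫ r, ∫ x, P k (r, x) := fun k =>
        integral_prod _ (hP k)
      simp only [hI]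
      rw [integral_tsum_of_summable_integral_norm (fun k => (hP k).integral_prod_left)]
      · simp only [hJ0, integral_zero]
      · refine Summable.of_nonneg_of_le (fun k => integral_nonneg fun _ => norm_nonneg _)
          (fun k => ?_) (hv.summable.mul_left (l2Norm S * l2Norm R))
        refine le_trans ?_ (hPn k)
        rw [integral_prod _ (hP k).norm]
        exact integral_mono (hP k).integral_prod_left.norm (hP k).norm.integral_prod_left
          fun r => norm_integral_le_integral_norm _
    have hval : ∀ k, (ε k : ℂ) * (⟪indicatorConstLp 2 hs hs' (1 : ℂ), v k⟫_ℂ *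
        ⟪v k, indicatorConstLp 2 ht ht' (1 : ℂ)⟫_ℂ) = ∫ q, P k q ∂(volume.prod volume) := by
      intro k
      rw [integral_const_mul, hmap (F k) (hF k).aestronglyMeasurable,
        integral_prod_mul (fun x => S x * v k x) fun x => (starRingEnd ℂ) (R x * v k x),
        integral_conj, ← inner_conj_symm (v k), inner_indicatorConstLp_one',
        inner_indicatorConstLp_one']
    rw [← (hT _ _).tsum_eq]
    simp only [hval]
    exact hzero
  have hTt : ∀ (t : Set (Conf m)) (ht : MeasurableSet t) (ht' : volume t ≠ ∞),
      T (indicatorConstLp 2 ht ht' 1) = 0 := fun t ht ht' =>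
    eq_zero_of_forall_inner_indicator fun s hs hs' => key s t hs ht hs' ht'
  refine ContinuousLinearMap.adjoint.injective (ContinuousLinearMap.ext fun f => ?_)
  rw [map_zero]
  refine eq_zero_of_forall_inner_indicator fun t ht ht' => ?_
  rw [ContinuousLinearMap.adjoint_inner_right, hTt, inner_zero_left]

theorem IsSelfAdjointTraceClass.ext_wigner {m : ℕ} {S T : H m →L[ℂ] H m}
    (hS : IsSelfAdjointTraceClass S) (hT : IsSelfAdjointTraceClass T)
    (h : ∀ z, wigner S z = wigner T z) : S = T := by
  obtain ⟨ε, v, hv, hvS⟩ := hS.exists_represents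
  obtain ⟨ε', v', hv', hvT⟩ := hT.exists_represents
  refine sub_eq_zero.1 ((hv.sumElim hv').eq_zero_of_famWigner_eq_zero (fun z => ?_)
    (hvS.sub hvT))
  have h1 := h z
  rw [hv.wigner_eq hvS, hv'.wigner_eq hvT] at h1
  have h2 : famWigner ε v z = famWigner ε' v' z :=
    mul_left_cancel₀ (inv_ne_zero (pow_pos Real.pi_pos m).ne') h1
  apply Complex.ofReal_injective
  rw [ofReal_famWigner]
  have hs := hv.summable_inner (displacedParity z)
  have hs' := hv'.summable_inner (displacedParity z)
  have e : (fun k => ((Sum.elim ε (fun k => -ε' k) k : ℝ) : ℂ) *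
      ⟪Sum.elim v v' k, displacedParity z (Sum.elim v v' k)⟫_ℂ) =
      Sum.elim (fun k => (ε k : ℂ) * ⟪v k, displacedParity z (v k)⟫_ℂ)
        fun k => -((ε' k : ℂ) * ⟪v' k, displacedParity z (v' k)⟫_ℂ) := by
    funext k
    cases k <;> simp
  rw [e, (HasSum.sum (f := Sum.elim _ _) hs.hasSum hs'.neg.hasSum).tsum_eq, tsum_neg,
    ← ofReal_famWigner, ← ofReal_famWigner, h2, add_neg_cancel, Complex.ofReal_zero]

/-! ### Signed mixtures -/

section PolOp

variable {α : Type*} [MeasurableSpace α] {m : ℕ}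

/-- The operator `½ ∫ (|v⟩⟨u| + |u⟩⟨v|) dμ`. -/
def polOp (μ : Measure α) (u v : α → H m) : H m →L[ℂ] H m :=
  mixOp μ (fun a => (2⁻¹ : ℂ) • (u a + v a)) (fun a => (2⁻¹ : ℂ) • (u a + v a)) -
    mixOp μ (fun a => (2⁻¹ : ℂ) • (u a - v a)) (fun a => (2⁻¹ : ℂ) • (u a - v a))

variable {μ : Measure α} {u v : α → H m}

theorem memLp_half_add (hu : MemLp u 2 μ) (hv : MemLp v 2 μ) :
    MemLp (fun a => (2⁻¹ : ℂ) • (u a + v a)) 2 μ := by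
  have h := (hu.add hv).const_smul (2⁻¹ : ℂ)
  exact h

theorem memLp_half_sub (hu : MemLp u 2 μ) (hv : MemLp v 2 μ) :
    MemLp (fun a => (2⁻¹ : ℂ) • (u a - v a)) 2 μ := by
  have h := (hu.sub hv).const_smul (2⁻¹ : ℂ)
  exact h

theorem integrable_norm_mul_self (hu : MemLp u 2 μ) : Integrable (fun a => ‖u a‖ * ‖u a‖) μ := by
  simpa only [sq] using (memLp_two_iff_integrable_sq_norm hu.1).1 hu

theorem integrable_inner_apply_of_memLp (hu : MemLp u 2 μ) (hv : MemLp v 2 μ)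
    (X : H m →L[ℂ] H m) : Integrable (fun a => ⟪u a, X (v a)⟫_ℂ) μ := by
  have hXv : MemLp (fun a => X (v a)) 2 μ := X.comp_memLp' hv
  refine (MemLp.integrable_mul hu.norm hXv.norm).mono' (hu.1.inner hXv.1)
    (Eventually.of_forall fun a => norm_inner_le_norm _ _)

theorem isSelfAdjointTraceClass_polOp (hu : MemLp u 2 μ) (hv : MemLp v 2 μ) :
    IsSelfAdjointTraceClass (polOp μ u v) := by
  have hA := memLp_half_add hu hv
  have hB := memLp_half_sub hu hv
  exact ⟨_, _, isPosTraceClass_mixOp hA.1 (integrable_norm_mul_self hA),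
    isPosTraceClass_mixOp hB.1 (integrable_norm_mul_self hB), rfl⟩

theorem opTrace_polOp (hu : MemLp u 2 μ) (hv : MemLp v 2 μ) (X : H m →L[ℂ] H m) :
    opTrace (X ∘L polOp μ u v) = ∫ a, (2⁻¹ : ℂ) * (⟪u a, X (v a)⟫_ℂ + ⟪v a, X (u a)⟫_ℂ) ∂μ ∧
    opTrace (polOp μ u v ∘L X) = ∫ a, (2⁻¹ : ℂ) * (⟪u a, X (v a)⟫_ℂ + ⟪v a, X (u a)⟫_ℂ) ∂μ := by
  have hA := memLp_half_add hu hv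
  have hB := memLp_half_sub hu hv
  have hAi := integrable_norm_mul_self hA
  have hBi := integrable_norm_mul_self hB
  have hAw := inner_mixOp hA.1 hA.1 hAi
  have hBw := inner_mixOp hB.1 hB.1 hBi
  have hval : (∫ a, ⟪(2⁻¹ : ℂ) • (u a + v a), X ((2⁻¹ : ℂ) • (u a + v a))⟫_ℂ ∂μ) -
      ∫ a, ⟪(2⁻¹ : ℂ) • (u a - v a), X ((2⁻¹ : ℂ) • (u a - v a))⟫_ℂ ∂μ =
      ∫ a, (2⁻¹ : ℂ) * (⟪u a, X (v a)⟫_ℂ + ⟪v a, X (u a)⟫_ℂ) ∂μ := by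
    rw [← integral_sub (integrable_inner_apply_of_memLp hA hA X)
      (integrable_inner_apply_of_memLp hB hB X)]
    refine integral_congr_ae (Eventually.of_forall fun a => ?_)
    simp only [map_smul, map_add, map_sub, inner_smul_left, inner_smul_right, inner_add_left,
      inner_add_right, inner_sub_left, inner_sub_right, map_inv₀, Complex.conj_ofNat]
    ring
  constructor
  · have h1 := (hasSum_trace_comp_left hA.1 hA.1 hAi hAw X).sub
      (hasSum_trace_comp_left hB.1 hB.1 hBi hBw X)
    rw [hval] at h1
    rw [← h1.tsum_eq, opTrace]
    refine tsum_congr fun i => ?_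
    simp [polOp, inner_sub_right]
  · have h1 := (hasSum_trace_comp_right hA.1 hA.1 hAi hAw X).sub
      (hasSum_trace_comp_right hB.1 hB.1 hBi hBw X)
    rw [hval] at h1
    rw [← h1.tsum_eq, opTrace]
    refine tsum_congr fun i => ?_
    simp [polOp, inner_sub_right]

theorem wigner_polOp (hu : MemLp u 2 μ) (hv : MemLp v 2 μ) (z : Phase m) :
    wigner (polOp μ u v) z = (Real.pi ^ m)⁻¹ * ∫ a, (⟪u a, displacedParity z (v a)⟫_ℂ).re ∂μ := by
  rw [wigner, (opTrace_polOp hu hv _).2]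
  congr 1
  have hi := integrable_inner_apply_of_memLp hu hv (displacedParity z)
  have e : ∀ a, (2⁻¹ : ℂ) * (⟪u a, displacedParity z (v a)⟫_ℂ +
      ⟪v a, displacedParity z (u a)⟫_ℂ) = (((⟪u a, displacedParity z (v a)⟫_ℂ).re : ℝ) : ℂ) := by
    intro a
    rw [← inner_conj_symm (v a), inner_displacedParity_left, Complex.add_conj]
    push_cast
    ring
  simp only [e]
  rw [integral_complex_ofReal, Complex.ofReal_re]

end PolOp

end Bosonic

namespace Bosonic

/-! ### Gaussians are Schwartz functions -/

theorem hasTemperateGrowth_dotProduct_self {E : Type*} [NormedAddCommGroup E] [NormedSpace ℝ E]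
    {l : ℕ} (L : E →L[ℝ] Conf l) : Function.HasTemperateGrowth fun x => L x ⬝ᵥ L x := by
  simp only [dotProduct]
  refine Function.HasTemperateGrowth.sum fun i _ => ?_
  have h := ((ContinuousLinearMap.proj (R := ℝ) (φ := fun _ : Fin l => ℝ) i).comp
    L).hasTemperateGrowth
  exact h.mul h

theorem norm_sq_le_dotProduct_self {l : ℕ} (x : Conf l) : ‖x‖ ^ 2 ≤ x ⬝ᵥ x := by
  have h : ‖x‖ ≤ Real.sqrt (x ⬝ᵥ x) := by
    refine (pi_norm_le_iff_of_nonneg (Real.sqrt_nonneg _)).2 fun i => ?_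
    rw [Real.norm_eq_abs]
    refine Real.abs_le_sqrt ?_
    rw [sq]
    exact Finset.single_le_sum (f := fun i => x i * x i) (fun j _ => mul_self_nonneg _)
      (Finset.mem_univ i)
  calc ‖x‖ ^ 2 ≤ Real.sqrt (x ⬝ᵥ x) ^ 2 := by gcongr
    _ = _ := Real.sq_sqrt (dotProduct_self_nonneg' x)

/-- The exponential of a function of temperate growth with a quadratic upper bound. -/
theorem exists_schwartz_exp_neg {E : Type*} [NormedAddCommGroup E] [NormedSpace ℝ E] {Q : E → ℝ}
    (hQ : Q.HasTemperateGrowth) {a : ℝ} (ha : 0 < a) (hlow : ∀ x, a * ‖x‖ ^ 2 ≤ Q x) :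
    ∃ φ : 𝓢(E, ℝ), ∀ x, φ x = Real.exp (-Q x) := by
  have hsm : ContDiff ℝ ((⊤ : ℕ∞) : WithTop ℕ∞) fun x => Real.exp (-Q x) := Real.contDiff_exp.comp hQ.1.neg
  have hdec : ∀ K : ℕ, ∃ C, ∀ x : E, (1 + ‖x‖) ^ K * Real.exp (-Q x) ≤ C := by
    intro K
    -- From y^K ≤ K! exp y at y = 1 + ‖x‖, and ‖x‖ ≤ 1/(4a) + a‖x‖², which lets the quadratic lower
    -- bound absorb the linear exponent.
    refine ⟨K.factorial * Real.exp (1 + 1 / (4 * a)), fun x => ?_⟩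
    have h1 := Real.pow_div_factorial_le_exp (1 + ‖x‖) (by positivity) K
    rw [div_le_iff₀ (by positivity)] at h1
    calc _ ≤ (Real.exp (1 + ‖x‖) * K.factorial) * Real.exp (-Q x) := by gcongr
      _ = K.factorial * Real.exp (1 + ‖x‖ - Q x) := by
        rw [mul_comm (Real.exp _), mul_assoc, ← Real.exp_add, sub_eq_add_neg]
      _ ≤ _ := by
        gcongr
        have h2 := hlow x
        have h3 : ‖x‖ ≤ 1 / (4 * a) + a * ‖x‖ ^ 2 := by
          have : 1 / (4 * a) + a * ‖x‖ ^ 2 - ‖x‖ = a * (‖x‖ - 1 / (2 * a)) ^ 2 := by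
            field_simp
            ring
          nlinarith [mul_nonneg ha.le (sq_nonneg (‖x‖ - 1 / (2 * a)))]
        linarith
  refine ⟨⟨fun x => Real.exp (-Q x), hsm, fun k n => ?_⟩, fun x => rfl⟩
  obtain ⟨l, C, hC, hgrowth⟩ := hQ.norm_iteratedFDeriv_le_uniform n
  -- The power k is the Schwartz weight; l n pays for the growth of the derivatives of Q in the
  -- bound for derivatives of a composition.
  obtain ⟨B, hB⟩ := hdec (k + l * n)
  refine ⟨n.factorial * (1 + C) ^ n * B, fun x => ?_⟩
  have hD : ∀ i, 1 ≤ i → i ≤ n → ‖iteratedFDeriv ℝ i (fun y => -Q y) x‖ ≤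
      ((1 + C) * (1 + ‖x‖) ^ l) ^ i := by
    intro i hi hin
    have e : iteratedFDeriv ℝ i (fun y => -Q y) x = -iteratedFDeriv ℝ i Q x := by
      have := iteratedFDeriv_neg_apply (𝕜 := ℝ) (i := i) (f := Q) (x := x)
      exact this
    rw [e, norm_neg]
    have h1 : (1 : ℝ) ≤ (1 + C) * (1 + ‖x‖) ^ l :=
      one_le_mul_of_one_le_of_one_le (by linarith) (one_le_pow₀ (by linarith [norm_nonneg x]))
    calc _ ≤ C * (1 + ‖x‖) ^ l := hgrowth i hin x
      _ ≤ (1 + C) * (1 + ‖x‖) ^ l := by gcongr; linarith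
      _ ≤ _ := le_self_pow₀ h1 (by omega)
  have hE : ∀ i, i ≤ n → ‖iteratedFDeriv ℝ i Real.exp (-Q x)‖ ≤ Real.exp (-Q x) := by
    intro i _
    rw [norm_iteratedFDeriv_eq_norm_iteratedDeriv, iteratedDeriv_eq_iterate, Real.iter_deriv_exp,
      Real.norm_of_nonneg (Real.exp_pos _).le]
  have h := norm_iteratedFDeriv_comp_le (g := Real.exp) (f := fun y => -Q y) (n := n) (N := ((⊤ : ℕ∞) : WithTop ℕ∞))
    Real.contDiff_exp hQ.1.neg (by exact_mod_cast le_top) x hE hD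
  calc ‖x‖ ^ k * ‖iteratedFDeriv ℝ n (fun y => Real.exp (-Q y)) x‖
      ≤ (1 + ‖x‖) ^ k * (n.factorial * Real.exp (-Q x) * ((1 + C) * (1 + ‖x‖) ^ l) ^ n) := by
        gcongr
        · linarith
        · exact h
    _ = n.factorial * (1 + C) ^ n * ((1 + ‖x‖) ^ (k + l * n) * Real.exp (-Q x)) := by
        rw [mul_pow, ← pow_mul, pow_add]
        ring
    _ ≤ _ := by gcongr; exact hB x

/-- The Gaussian on phase space. -/
def phaseGauss {m : ℕ} (α : ℝ) (y : Phase m) : ℝ := gauss α y.1 * gauss α y.2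

theorem phaseGauss_pos {m : ℕ} (α : ℝ) (y : Phase m) : 0 < phaseGauss α y :=
  mul_pos (gauss_pos _ _) (gauss_pos _ _)

theorem continuous_phaseGauss {m : ℕ} (α : ℝ) : Continuous (phaseGauss α : Phase m → ℝ) :=
  ((continuous_gauss α).comp continuous_fst).mul ((continuous_gauss α).comp continuous_snd)

theorem integrable_phaseGauss {m : ℕ} {α : ℝ} (hα : 0 < α) :
    Integrable (phaseGauss α : Phase m → ℝ) :=
  (integrable_gauss hα).mul_prod (integrable_gauss hα)

theorem integral_phaseGauss_pos {m : ℕ} {α : ℝ} (hα : 0 < α) :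
    0 < ∫ y : Phase m, phaseGauss α y := by
  have h : ∫ y : Phase m, phaseGauss α y =
      (∫ p : Conf m, gauss α p) * ∫ p : Conf m, gauss α p :=
    integral_prod_mul (fun p : Conf m => gauss α p) fun p : Conf m => gauss α p
  rw [h, integral_gauss hα]
  have := Real.pi_pos
  positivity

theorem phaseGauss_sq {m : ℕ} (R : ℝ) (y : Phase m) : phaseGauss (R ^ 2) y = phaseGauss 1 (R • y) := by
  simp only [phaseGauss, gauss, Prod.smul_fst, Prod.smul_snd, smul_dotProduct, dotProduct_smul,
    smul_eq_mul]
  congr 3 <;> ring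

theorem exists_schwartz_phaseGauss {m : ℕ} {α : ℝ} (hα : 0 < α) (C : ℝ) (z : Phase m) :
    ∃ φ : 𝓢(Phase m, ℝ), ∀ y, φ y = C * phaseGauss α (y - z) := by
  obtain ⟨φ, hφ⟩ := exists_schwartz_exp_neg
    (Q := fun y : Phase m => α * (y.1 ⬝ᵥ y.1 + y.2 ⬝ᵥ y.2)) (a := α)
    ((Function.HasTemperateGrowth.const α).mul
      ((hasTemperateGrowth_dotProduct_self (ContinuousLinearMap.fst ℝ (Conf m) (Conf m))).add
        (hasTemperateGrowth_dotProduct_self (ContinuousLinearMap.snd ℝ (Conf m) (Conf m))))) hα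
    fun y => by
      gcongr
      have h1 := norm_sq_le_dotProduct_self y.1
      have h2 := norm_sq_le_dotProduct_self y.2
      have h3 := dotProduct_self_nonneg' y.1
      have h4 := dotProduct_self_nonneg' y.2
      rcases max_cases ‖y.1‖ ‖y.2‖ with h | h <;> rw [Prod.norm_def, h.1] <;> linarith
  refine ⟨C • φ.compSubConstCLM ℝ z, fun y => ?_⟩
  rw [smul_apply, SchwartzMap.compSubConstCLM_apply, hφ, smul_eq_mul, phaseGauss, gauss,
    gauss, ← Real.exp_add]
  congr 2
  ring

/-! ### Operators with a Gaussian Wigner function -/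

theorem memLp_gauss {m : ℕ} {κ : ℝ} (hκ : 0 < κ) :
    MemLp (fun y : Conf m => (gauss κ y : ℂ)) 2 volume := by
  have hc : Continuous fun y : Conf m => (gauss κ y : ℂ) :=
    Complex.continuous_ofReal.comp (continuous_gauss κ)
  rw [memLp_two_iff_integrable_sq_norm hc.aestronglyMeasurable]
  refine (integrable_gauss (t := 2 * κ) (by positivity)).congr (Eventually.of_forall fun y => ?_)
  simp only [Complex.norm_real, Real.norm_eq_abs, sq_abs, gauss]
  rw [← Real.exp_nat_mul]
  congr 1
  push_cast
  ring

/-- The unnormalised Gaussian wave function. -/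
def gaussVec {m : ℕ} {κ : ℝ} (hκ : 0 < κ) : H m := (memLp_gauss hκ).toLp _

theorem coeFn_gaussVec {m : ℕ} {κ : ℝ} (hκ : 0 < κ) :
    (gaussVec hκ : H m) =ᵐ[volume] fun y => (gauss κ y : ℂ) := (memLp_gauss hκ).coeFn_toLp

theorem parity_gaussVec {m : ℕ} {κ : ℝ} (hκ : 0 < κ) : parity m (gaussVec hκ) = gaussVec hκ := by
  refine Lp.ext ?_
  filter_upwards [coeFn_parity (gaussVec hκ : H m), coeFn_gaussVec (m := m) hκ,
    ae_neg (coeFn_gaussVec (m := m) hκ)] with y h1 h2 h3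
  rw [h1, h2, h3, gauss_neg]

/-- The reflection undoes the opposite displacements of bra and ket. What remains is an expectation
of the displacement by 2y in one displaced Gaussian, that is, the value for c = 0 times a character
in momentum. -/
theorem inner_displacedParity_gaussVec {m : ℕ} {κ : ℝ} (hκ : 0 < κ) (c : Conf m) (y : Phase m) :
    ⟪displacement (c, 0) (gaussVec hκ), displacedParity y (displacement (-c, 0) (gaussVec hκ))⟫_ℂ =
      Complex.exp (Complex.I * ((c ⬝ᵥ ((2 : ℝ) • y.2) : ℝ) : ℂ)) *
        ((gauss (2 * κ) y.1 * (Real.sqrt (Real.pi / (2 * κ)) ^ m * gauss (1 / (2 * κ)) y.2) : ℝ) :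
          ℂ) := by
  have e1 : ((c, 0) : Phase m) = -(-c, 0) := by simp
  have e2 : displacedParity y (displacement (-c, 0) (gaussVec hκ)) =
      displacement ((2 : ℝ) • y) (displacement (c, 0) (gaussVec hκ)) := by
    rw [displacedParity_eq, parity_displacement, parity_gaussVec, ← e1]
  have e3 : ⟪(gaussVec hκ : H m), displacement ((2 : ℝ) • y) (gaussVec hκ)⟫_ℂ =
      ((gauss (2 * κ) y.1 * (Real.sqrt (Real.pi / (2 * κ)) ^ m * gauss (1 / (2 * κ)) y.2) : ℝ) :
        ℂ) := by
    rw [← corrFT_gauss hκ, ← corrFT_congr (coeFn_gaussVec hκ) (coeFn_gaussVec hκ),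
      ← inner_displacedParity_eq_corrFT, displacedParity_eq, parity_gaussVec]
  rw [e2, e1, inner_displacement_conj, e3]
  congr 3
  simp [symp]

/-- A signed mixture of coherent states with a Gaussian Wigner function of variance below that of
the vacuum. -/
theorem exists_gaussian_wigner (m : ℕ) {α : ℝ} (hα : 1 < α) : ∃ (u v : Conf m → H m) (C : ℝ),
    0 < C ∧ Continuous u ∧ Continuous v ∧ MemLp u 2 volume ∧ MemLp v 2 volume ∧
      ∀ y, (Real.pi ^ m)⁻¹ * ∫ c, (⟪u c, displacedParity y (v c)⟫_ℂ).re = C * phaseGauss α y := by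
  have hα0 : 0 < α := by linarith
  have hα1 : 0 < α ^ 2 - 1 := by nlinarith
  have hκ : 0 < α / 2 := by positivity
  -- At κ = α/2 the Gaussian wave function has a Wigner function with parameters α in position and
  -- 1/α in momentum. Averaging the characters exp(2ic·p) with weight exp(-τ|c|²) multiplies it by
  -- exp(-|p|²/τ), and 1/τ = α - 1/α restores α in momentum. Positivity of τ needs α > 1.
  set τ : ℝ := α / (α ^ 2 - 1) with hτ
  have hτ0 : 0 < τ := by positivity
  let g : H m := gaussVec hκ
  have hc : Continuous fun c : Conf m => displacement (c, 0) g :=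
    (continuous_displacement g).comp (by fun_prop)
  have hc' : Continuous fun c : Conf m => displacement (-c, 0) g :=
    (continuous_displacement g).comp (by fun_prop)
  have hw : Continuous fun c : Conf m => (gauss (τ / 2) c : ℂ) :=
    Complex.continuous_ofReal.comp (continuous_gauss _)
  have hsq : ∀ c : Conf m, gauss (τ / 2) c * gauss (τ / 2) c = gauss τ c := fun c => by
    simp only [gauss]
    rw [← Real.exp_add]
    congr 1
    ring
  have hL : ∀ {f : Conf m → H m}, Continuous f → (∀ c, ‖f c‖ = ‖g‖) →
      MemLp (fun c => (gauss (τ / 2) c : ℂ) • f c) 2 volume := by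
    intro f hf hn
    have hm : AEStronglyMeasurable (fun c => (gauss (τ / 2) c : ℂ) • f c) volume :=
      (hw.smul hf).aestronglyMeasurable
    rw [memLp_two_iff_integrable_sq_norm hm]
    refine ((integrable_gauss hτ0).mul_const (‖g‖ ^ 2)).congr (Eventually.of_forall fun c => ?_)
    simp only [norm_smul, hn, Complex.norm_real, Real.norm_of_nonneg (gauss_pos _ _).le, mul_pow]
    rw [← hsq, sq (gauss _ _)]
  refine ⟨fun c => (gauss (τ / 2) c : ℂ) • displacement (c, 0) g,
    fun c => (gauss (τ / 2) c : ℂ) • displacement (-c, 0) g,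
    (Real.pi ^ m)⁻¹ * (Real.sqrt (Real.pi / α) ^ m * Real.sqrt (Real.pi / τ) ^ m), ?_, hw.smul hc,
    hw.smul hc', hL hc fun c => norm_displacement _ _, hL hc' fun c => norm_displacement _ _,
    fun y => ?_⟩
  · have := Real.pi_pos
    positivity
  · have e : ∀ c : Conf m, ⟪(gauss (τ / 2) c : ℂ) • displacement (c, 0) g,
        displacedParity y ((gauss (τ / 2) c : ℂ) • displacement (-c, 0) g)⟫_ℂ =
        ((gauss α y.1 * (Real.sqrt (Real.pi / α) ^ m * gauss (1 / α) y.2) : ℝ) : ℂ) *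
          ((gauss τ c : ℂ) * Complex.exp (Complex.I * ((c ⬝ᵥ ((2 : ℝ) • y.2) : ℝ) : ℂ))) := by
      intro c
      have h1 := inner_displacedParity_gaussVec hκ c y
      rw [mul_div_cancel₀ α two_ne_zero] at h1
      rw [map_smul, inner_smul_left, inner_smul_right, h1, Complex.conj_ofReal, ← hsq]
      push_cast
      ring
    have hi : Integrable fun c : Conf m => (gauss τ c : ℂ) *
        Complex.exp (Complex.I * ((c ⬝ᵥ ((2 : ℝ) • y.2) : ℝ) : ℂ)) := by
      refine (integrable_gauss hτ0).ofReal.mul_bdd (c := 1)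
        (Continuous.aestronglyMeasurable (by fun_prop)) (Eventually.of_forall fun c => ?_)
      rw [mul_comm, Complex.norm_exp_ofReal_mul_I]
    have h2 : ∫ c : Conf m, (⟪(gauss (τ / 2) c : ℂ) • displacement (c, 0) g,
        displacedParity y ((gauss (τ / 2) c : ℂ) • displacement (-c, 0) g)⟫_ℂ).re =
        (gauss α y.1 * (Real.sqrt (Real.pi / α) ^ m * gauss (1 / α) y.2)) *
          (Real.sqrt (Real.pi / τ) ^ m * gauss (1 / (4 * τ)) ((2 : ℝ) • y.2)) := by
      simp only [e]
      refine (integral_re (hi.const_mul _)).trans ?_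
      rw [integral_const_mul, integral_gauss_mul_cexp hτ0, ← Complex.ofReal_mul]
      exact Complex.ofReal_re _
    rw [h2]
    have h3 : gauss (1 / α) y.2 * gauss (1 / (4 * τ)) ((2 : ℝ) • y.2) = gauss α y.2 := by
      simp only [gauss, smul_dotProduct, dotProduct_smul, smul_eq_mul]
      rw [← Real.exp_add]
      congr 1
      rw [hτ]
      field_simp
      ring
    rw [phaseGauss, ← h3]
    ring

end Bosonic

namespace Bosonic

/-! ### Lower bounds on error probabilities -/

section Symbol

variable {m : ℕ} {u v : Conf m → H m}

theorem memLp_displacement (hc : Continuous u) (hu : MemLp u 2 volume) (z : Phase m) :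
    MemLp (fun c => displacement z (u c)) 2 volume :=
  hu.of_le ((displacement z).continuous.comp hc).aestronglyMeasurable
    (Eventually.of_forall fun _ => (norm_displacement z _).le)

theorem inner_displacement_displacedParity (z z' : Phase m) (f g : H m) :
    ⟪displacement z f, displacedParity z' (displacement z g)⟫_ℂ =
      ⟪f, displacedParity (z' - z) g⟫_ℂ := by
  rw [displacement_displacedParity, inner_displacement]

/-- The expectation of `X` in the displaced signed mixture. -/
def symbol (u v : Conf m → H m) (X : H m →L[ℂ] H m) (z : Phase m) : ℂ :=
  ∫ c, (2⁻¹ : ℂ) * (⟪displacement z (u c), X (displacement z (v c))⟫_ℂ +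
    ⟪displacement z (v c), X (displacement z (u c))⟫_ℂ)

/-- Unitarity of displacements; this constant is the upper bound for the symbols of W+ effects. -/
theorem symbol_one (z : Phase m) : symbol u v 1 z = symbol u v 1 0 := by
  simp only [symbol, one_apply_eq_self, inner_displacement]

/-- The displaced signed mixture. -/
def dispOp (u v : Conf m → H m) (z : Phase m) : H m →L[ℂ] H m :=
  polOp volume (fun c => displacement z (u c)) fun c => displacement z (v c)

theorem opTrace_dispOp (hcu : Continuous u) (hcv : Continuous v) (hu : MemLp u 2 volume)
    (hv : MemLp v 2 volume) (X : H m →L[ℂ] H m) (z : Phase m) :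
    opTrace (X ∘L dispOp u v z) = symbol u v X z :=
  (opTrace_polOp (memLp_displacement hcu hu z) (memLp_displacement hcv hv z) X).1

/-- The displaced mixture is an admissible test operator: its Wigner function is a translated
Gaussian, hence Schwartz and non-negative. The symbol is in effect a Gaussian smoothing of W_M. -/
theorem symbol_nonneg (hcu : Continuous u) (hcv : Continuous v) (hu : MemLp u 2 volume)
    (hv : MemLp v 2 volume) {C α : ℝ} (hC : 0 < C) (hα : 0 < α)
    (hw : ∀ y, (Real.pi ^ m)⁻¹ * ∫ c, (⟪u c, displacedParity y (v c)⟫_ℂ).re = C * phaseGauss α y)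
    {M : H m →L[ℂ] H m} (hM : HasNonnegWigner M) (z : Phase m) : 0 ≤ (symbol u v M z).re := by
  obtain ⟨φ, hφ⟩ := exists_schwartz_phaseGauss hα C z
  have h := hM φ (dispOp u v z) (isSelfAdjointTraceClass_polOp (memLp_displacement hcu hu z)
    (memLp_displacement hcv hv z)) (fun z' => ?_) fun z' => ?_
  · rwa [opTrace_dispOp hcu hcv hu hv] at h
  · rw [hφ, ← hw, dispOp, wigner_polOp (memLp_displacement hcu hu z) (memLp_displacement hcv hv z)]
    simp only [inner_displacement_displacedParity]
  · rw [hφ]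
    exact mul_nonneg hC.le (phaseGauss_pos _ _).le

theorem symbol_sub (hcu : Continuous u) (hcv : Continuous v) (hu : MemLp u 2 volume)
    (hv : MemLp v 2 volume) (M : H m →L[ℂ] H m) (z : Phase m) :
    symbol u v (1 - M) z = symbol u v 1 z - symbol u v M z := by
  have hi : ∀ X : H m →L[ℂ] H m, Integrable fun c => (2⁻¹ : ℂ) *
      (⟪displacement z (u c), X (displacement z (v c))⟫_ℂ +
        ⟪displacement z (v c), X (displacement z (u c))⟫_ℂ) := fun X =>
    ((integrable_inner_apply_of_memLp (memLp_displacement hcu hu z) (memLp_displacement hcv hv z)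
      X).add (integrable_inner_apply_of_memLp (memLp_displacement hcv hv z)
        (memLp_displacement hcu hu z) X)).const_mul _
  rw [symbol, symbol, symbol, ← integral_sub (hi 1) (hi M)]
  refine integral_congr_ae (Eventually.of_forall fun c => ?_)
  simp only [sub_apply, inner_sub_right]
  ring

/-! ### Smoothing of a state -/

theorem memLp_sqrt_smul_displacement (hcu : Continuous u) (hu : MemLp u 2 volume)
    {w : Phase m → ℝ} (hw : Continuous w) (h0 : ∀ z, 0 ≤ w z) (hi : Integrable w) :
    MemLp (fun q : Phase m × Conf m => (Real.sqrt (w q.1) : ℂ) • displacement q.1 (u q.2)) 2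
      (volume.prod volume) := by
  have hc : Continuous fun q : Phase m × Conf m =>
      (Real.sqrt (w q.1) : ℂ) • displacement q.1 (u q.2) :=
    (Complex.continuous_ofReal.comp (Real.continuous_sqrt.comp (hw.comp continuous_fst))).smul
      (continuous_displacement_apply continuous_fst (hcu.comp continuous_snd))
  rw [memLp_two_iff_integrable_sq_norm hc.aestronglyMeasurable]
  refine (hi.mul_prod ((memLp_two_iff_integrable_sq_norm hu.1).1 hu)).congr
    (Eventually.of_forall fun q => ?_)
  simp only [norm_smul, Complex.norm_real, norm_displacement, mul_pow, Real.norm_eq_abs, sq_abs,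
    Real.sq_sqrt (h0 _)]

theorem inner_sqrt_smul {E : Type*} [NormedAddCommGroup E] [InnerProductSpace ℂ E] {r : ℝ}
    (hr : 0 ≤ r) (X : E →L[ℂ] E) (f g : E) :
    ⟪(Real.sqrt r : ℂ) • f, X ((Real.sqrt r : ℂ) • g)⟫_ℂ = (r : ℂ) * ⟪f, X g⟫_ℂ := by
  rw [map_smul, inner_smul_left, inner_smul_right, Complex.conj_ofReal, ← mul_assoc,
    ← Complex.ofReal_mul, Real.mul_self_sqrt hr]

/-- The mixture of the displaced signed mixtures with weights `w`. -/
def weightedOp (w : Phase m → ℝ) (u v : Conf m → H m) : H m →L[ℂ] H m :=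
  polOp (volume.prod volume)
    (fun q : Phase m × Conf m => (Real.sqrt (w q.1) : ℂ) • displacement q.1 (u q.2))
    fun q : Phase m × Conf m => (Real.sqrt (w q.1) : ℂ) • displacement q.1 (v q.2)

theorem opTrace_weightedOp (hcu : Continuous u) (hcv : Continuous v) (hu : MemLp u 2 volume)
    (hv : MemLp v 2 volume) {w : Phase m → ℝ} (hw : Continuous w) (h0 : ∀ z, 0 ≤ w z)
    (hi : Integrable w) (X : H m →L[ℂ] H m) :
    Integrable (fun z => (w z : ℂ) * symbol u v X z) ∧
      opTrace (X ∘L weightedOp w u v) = ∫ z, (w z : ℂ) * symbol u v X z := by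
  have hU := memLp_sqrt_smul_displacement hcu hu hw h0 hi
  have hV := memLp_sqrt_smul_displacement hcv hv hw h0 hi
  have hI := ((integrable_inner_apply_of_memLp hU hV X).add
    (integrable_inner_apply_of_memLp hV hU X)).const_mul (2⁻¹ : ℂ)
  have e : ∀ z, ∫ c, (2⁻¹ : ℂ) *
      (⟪(Real.sqrt (w z) : ℂ) • displacement z (u c),
          X ((Real.sqrt (w z) : ℂ) • displacement z (v c))⟫_ℂ +
        ⟪(Real.sqrt (w z) : ℂ) • displacement z (v c),
          X ((Real.sqrt (w z) : ℂ) • displacement z (u c))⟫_ℂ) = (w z : ℂ) * symbol u v X z := by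
    intro z
    rw [symbol, ← integral_const_mul]
    refine integral_congr_ae (Eventually.of_forall fun c => ?_)
    simp only [inner_sqrt_smul (h0 z)]
    ring
  constructor
  · exact hI.integral_prod_left.congr (Eventually.of_forall e)
  · rw [weightedOp, (opTrace_polOp hU hV X).1]
    exact (integral_prod _ hI).trans (integral_congr_ae (Eventually.of_forall e))

/-- Covariance translates the Gaussian, and Fubini leaves its convolution with w. -/
theorem wigner_weightedOp (hcu : Continuous u) (hcv : Continuous v) (hu : MemLp u 2 volume)
    (hv : MemLp v 2 volume) {C α : ℝ}
    (hwig : ∀ y, (Real.pi ^ m)⁻¹ * ∫ c, (⟪u c, displacedParity y (v c)⟫_ℂ).re =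
      C * phaseGauss α y) {w : Phase m → ℝ} (hw : Continuous w) (h0 : ∀ z, 0 ≤ w z)
    (hi : Integrable w) (z' : Phase m) :
    wigner (weightedOp w u v) z' = ∫ z, w z * (C * phaseGauss α (z' - z)) := by
  have hU := memLp_sqrt_smul_displacement hcu hu hw h0 hi
  have hV := memLp_sqrt_smul_displacement hcv hv hw h0 hi
  have hI := (integrable_inner_apply_of_memLp hU hV (displacedParity z')).re
  rw [weightedOp, wigner_polOp hU hV]
  refine (congrArg _ (integral_prod _ hI)).trans ?_
  rw [← integral_const_mul]
  refine integral_congr_ae (Eventually.of_forall fun z => ?_)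
  simp only [inner_sqrt_smul (h0 z), inner_displacement_displacedParity, ← hwig]
  have e : ∀ c, RCLike.re ((w z : ℂ) * ⟪u c, displacedParity (z' - z) (v c)⟫_ℂ) =
      w z * (⟪u c, displacedParity (z' - z) (v c)⟫_ℂ).re := fun c => Complex.re_ofReal_mul _ _
  simp only [e, integral_const_mul]
  ring

end Symbol

instance isAddHaarMeasure_phase (m : ℕ) : (volume : Measure (Phase m)).IsAddHaarMeasure :=
  Measure.prod.instIsAddHaarMeasure _ _

instance isNegInvariant_phase (m : ℕ) : (volume : Measure (Phase m)).IsNegInvariant :=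
  ⟨((Measure.measurePreserving_neg (volume : Measure (Conf m))).prod
    (Measure.measurePreserving_neg (volume : Measure (Conf m)))).map_eq⟩

/-! ### Averages of a state over displacements -/

section Smooth

variable {ι : Type*} {m : ℕ} {v : ι → H m}

/-- The expectation of `X` in the displaced state. -/
def dispTrace (v : ι → H m) (X : H m →L[ℂ] H m) (ζ : Phase m) : ℂ :=
  ∑' k, ⟪displacement ζ (v k), X (displacement ζ (v k))⟫_ℂ

theorem norm_inner_displacement_le (X : H m →L[ℂ] H m) (ζ : Phase m) (f : H m) :
    ‖⟪displacement ζ f, X (displacement ζ f)⟫_ℂ‖ ≤ ‖X‖ * ‖f‖ ^ 2 := by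
  calc _ ≤ ‖displacement ζ f‖ * (‖X‖ * ‖displacement ζ f‖) :=
        (norm_inner_le_norm _ _).trans (by gcongr; exact X.le_opNorm _)
    _ = _ := by rw [norm_displacement]; ring

theorem continuous_dispTrace (hv : Summable fun k => ‖v k‖ ^ 2) (X : H m →L[ℂ] H m) :
    Continuous (dispTrace v X) ∧ ∀ ζ, ‖dispTrace v X ζ‖ ≤ ‖X‖ * ∑' k, ‖v k‖ ^ 2 := by
  constructor
  · exact continuous_tsum (fun k => (continuous_displacement (v k)).inner
      (X.continuous.comp (continuous_displacement (v k)))) (hv.mul_left ‖X‖)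
      fun k ζ => norm_inner_displacement_le X ζ (v k)
  · intro ζ
    rw [← tsum_mul_left]
    exact tsum_of_norm_bounded (hv.mul_left ‖X‖).hasSum fun k => norm_inner_displacement_le X ζ (v k)

variable [Countable ι]

/-- The smoothing of a state has a representation as an operator of the same Wigner function. -/
theorem exists_smoothed (hv : IsSignedFamily (fun _ => 1) v) {Γ : Phase m → ℝ}
    (hΓ : Continuous Γ) (h0 : ∀ z, 0 ≤ Γ z) (hi : Integrable Γ) :
    ∃ S : H m →L[ℂ] H m, IsSelfAdjointTraceClass S ∧
      (∀ X : H m →L[ℂ] H m, opTrace (X ∘L S) = ∫ ζ, (Γ ζ : ℂ) * dispTrace v X ζ) ∧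
      ∀ z, wigner S z = (Real.pi ^ m)⁻¹ * ∫ ζ, Γ ζ * famWigner (fun _ => 1) v (z - ζ) := by
  let _ : TopologicalSpace ι := ⊥
  have _ : DiscreteTopology ι := ⟨rfl⟩
  let _ : MeasurableSpace ι := ⊤
  have _ : BorelSpace ι := ⟨borel_eq_top_of_discrete.symm⟩
  -- Family index and displacement form one measure space, so that the smoothed state is again an
  -- integral of rank one operators.
  let μ : Measure (ι × Phase m) := Measure.count.prod volume
  let r : ι × Phase m → H m := fun q => (Real.sqrt (Γ q.2) : ℂ) • displacement q.2 (v q.1)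
  have hr : Continuous r :=
    (Complex.continuous_ofReal.comp (Real.continuous_sqrt.comp (hΓ.comp continuous_snd))).smul
      (continuous_displacement_apply continuous_snd
        ((continuous_of_discreteTopology (f := v)).comp continuous_fst))
  have hc : Integrable (fun k => ‖v k‖ ^ 2) Measure.count := integrable_count_iff.2
    (by simpa only [norm_pow, norm_norm] using hv.summable)
  have hrL : MemLp r 2 μ := by
    rw [memLp_two_iff_integrable_sq_norm hr.aestronglyMeasurable]
    refine (hc.mul_prod hi).congr (Eventually.of_forall fun q => ?_)
    simp only [r, norm_smul, Complex.norm_real, norm_displacement, mul_pow, Real.norm_eq_abs,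
      sq_abs, Real.sq_sqrt (h0 _)]
    ring
  have htr : ∀ X : H m →L[ℂ] H m, ∫ q, ⟪r q, X (r q)⟫_ℂ ∂μ = ∫ ζ, (Γ ζ : ℂ) * dispTrace v X ζ := by
    intro X
    have hI := integrable_inner_apply_of_memLp hrL hrL X
    have e : ∀ k ζ, ⟪r (k, ζ), X (r (k, ζ))⟫_ℂ =
        (Γ ζ : ℂ) * ⟪displacement ζ (v k), X (displacement ζ (v k))⟫_ℂ := fun k ζ =>
      inner_sqrt_smul (h0 ζ) X _ _
    rw [integral_prod_symm _ hI]
    refine integral_congr_ae ?_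
    filter_upwards [hI.prod_left_ae] with ζ hζ
    rw [integral_countable hζ, dispTrace, ← tsum_mul_left]
    refine tsum_congr fun k => ?_
    rw [e]
    simp [Measure.real]
  refine ⟨polOp μ r r, isSelfAdjointTraceClass_polOp hrL hrL, fun X => ?_, fun z => ?_⟩
  · rw [(opTrace_polOp hrL hrL X).1, ← htr]
    refine integral_congr_ae (Eventually.of_forall fun q => ?_)
    ring
  · rw [wigner_polOp hrL hrL]
    congr 1
    refine (integral_re (integrable_inner_apply_of_memLp hrL hrL (displacedParity z))).trans ?_
    rw [htr]
    have e : ∀ ζ, (Γ ζ : ℂ) * dispTrace v (displacedParity z) ζ =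
        ((Γ ζ * famWigner (fun _ => 1) v (z - ζ) : ℝ) : ℂ) := fun ζ => by
      rw [Complex.ofReal_mul, ofReal_famWigner, dispTrace]
      congr 1
      refine tsum_congr fun k => ?_
      rw [inner_displacement_displacedParity, Complex.ofReal_one, one_mul]
    simp only [e]
    rw [integral_complex_ofReal]
    exact Complex.ofReal_re _

/-- Averages of the symbol of `X` over the Wigner function of a state. -/
theorem integral_famWigner_mul_symbol {u u' : Conf m → H m} (hcu : Continuous u)
    (hcv : Continuous u') (hu : MemLp u 2 volume) (hu' : MemLp u' 2 volume) {C α : ℝ} (hC : 0 < C)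
    (hα : 0 < α) (hwig : ∀ y, (Real.pi ^ m)⁻¹ * ∫ c, (⟪u c, displacedParity y (u' c)⟫_ℂ).re =
      C * phaseGauss α y) (hv : IsSignedFamily (fun _ => 1) v)
    (h0 : ∀ z, 0 ≤ famWigner (fun _ => 1) v z) (X : H m →L[ℂ] H m) :
    Integrable (fun z => (famWigner (fun _ => 1) v z : ℂ) * symbol u u' X z) ∧
    ∫ z, (famWigner (fun _ => 1) v z : ℂ) * symbol u u' X z =
      ((Real.pi ^ m * C : ℝ) : ℂ) * ∫ ζ, (phaseGauss α ζ : ℂ) * dispTrace v X ζ := by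
  have hi := hv.integrable_famWigner h0
  have hc := hv.continuous_famWigner
  have h1 := opTrace_weightedOp hcu hcv hu hu' hc h0 hi X
  refine ⟨h1.1, ?_⟩
  have hΓc : Continuous fun ζ : Phase m => Real.pi ^ m * C * phaseGauss α ζ :=
    (continuous_phaseGauss α).const_mul _
  obtain ⟨S, hS, hST, hSW⟩ := exists_smoothed hv hΓc
    (fun z => mul_nonneg (by positivity) (phaseGauss_pos α z).le)
    ((integrable_phaseGauss hα).const_mul _)
  have hU := memLp_sqrt_smul_displacement hcu hu hc h0 hi
  have hV := memLp_sqrt_smul_displacement hcv hu' hc h0 hi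
  -- One operator spreads the Gaussian with the Wigner function as weight, the other spreads the
  -- state with a Gaussian weight. Both have the same convolution as Wigner function, so they
  -- coincide.
  have hLS : weightedOp (famWigner (fun _ => 1) v) u u' = S := by
    refine (isSelfAdjointTraceClass_polOp hU hV).ext_wigner hS fun z => ?_
    refine (wigner_weightedOp hcu hcv hu hu' hwig hc h0 hi z).trans ?_
    rw [hSW, ← integral_const_mul, ← integral_sub_left_eq_self _ volume z]
    refine integral_congr_ae (Eventually.of_forall fun ζ => ?_)
    have : Real.pi ^ m ≠ 0 := (pow_pos Real.pi_pos m).ne'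
    simp only [sub_sub_cancel]
    field_simp
  rw [← h1.2, hLS, hST, ← integral_const_mul]
  refine integral_congr_ae (Eventually.of_forall fun ζ => ?_)
  simp only [Complex.ofReal_mul]
  ring

end Smooth

/-- Rescaling by j + 2 turns the narrowing Gaussians into a fixed one, and the Jacobians cancel in
the ratio. The offset 2 keeps the parameter above 1, as `exists_gaussian_wigner` requires. -/
theorem tendsto_integral_phaseGauss_mul {m : ℕ} {T : Phase m → ℂ} (hT : Continuous T) {B : ℝ}
    (hB : ∀ ζ, ‖T ζ‖ ≤ B) :
    Tendsto (fun j : ℕ => (∫ ζ, (phaseGauss (((j : ℝ) + 2) ^ 2) ζ : ℂ) * T ζ) /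
      ((∫ ζ : Phase m, phaseGauss (((j : ℝ) + 2) ^ 2) ζ : ℝ) : ℂ)) atTop (𝓝 (T 0)) := by
  have hI : 0 < ∫ ζ : Phase m, phaseGauss 1 ζ := integral_phaseGauss_pos one_pos
  have hlim : Tendsto (fun j : ℕ => ∫ s : Phase m, (phaseGauss 1 s : ℂ) * T (((j : ℝ) + 2)⁻¹ • s))
      atTop (𝓝 (∫ s : Phase m, (phaseGauss 1 s : ℂ) * T 0)) := by
    refine tendsto_integral_of_dominated_convergence (fun s => phaseGauss 1 s * B) (fun j => ?_)
      ((integrable_phaseGauss one_pos).mul_const B) (fun j => Eventually.of_forall fun s => ?_)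
      (Eventually.of_forall fun s => ?_)
    · exact ((Complex.continuous_ofReal.comp (continuous_phaseGauss 1)).mul
        (hT.comp (continuous_const_smul _))).aestronglyMeasurable
    · rw [norm_mul, Complex.norm_real, Real.norm_of_nonneg (phaseGauss_pos _ _).le]
      exact mul_le_mul_of_nonneg_left (hB _) (phaseGauss_pos _ _).le
    · refine Tendsto.const_mul _ ?_
      have h1 : Tendsto (fun j : ℕ => ((j : ℝ) + 2)⁻¹ • s) atTop (𝓝 ((0 : ℝ) • s)) := by
        refine Tendsto.smul_const ?_ s
        exact tendsto_inv_atTop_zero.comp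
          (tendsto_atTop_add_const_right _ _ tendsto_natCast_atTop_atTop)
      rw [zero_smul] at h1
      exact (hT.tendsto 0).comp h1
  have hlim2 := hlim.div_const ((∫ ζ : Phase m, phaseGauss 1 ζ : ℝ) : ℂ)
  rw [integral_mul_const, integral_complex_ofReal, mul_div_assoc, mul_comm, div_mul_cancel₀] at hlim2
  · refine hlim2.congr fun j => ?_
    have hj : (0 : ℝ) < (j : ℝ) + 2 := by positivity
    have hsc : ∀ {F : Type} [NormedAddCommGroup F] [NormedSpace ℝ F] (f : Phase m → F),
        ∫ ζ, f (((j : ℝ) + 2) • ζ) =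
          |(((j : ℝ) + 2) ^ Module.finrank ℝ (Phase m))⁻¹| • ∫ ζ, f ζ := fun f =>
      Measure.integral_comp_smul volume f _
    have h1 := hsc fun s => (phaseGauss 1 s : ℂ) * T (((j : ℝ) + 2)⁻¹ • s)
    have h2 := hsc fun s : Phase m => phaseGauss 1 s
    simp only [inv_smul_smul₀ hj.ne', ← phaseGauss_sq] at h1 h2
    rw [h1, h2, Complex.real_smul, smul_eq_mul, Complex.ofReal_mul, mul_div_mul_left]
    exact_mod_cast (abs_pos.2 (by positivity)).ne'
  · exact_mod_cast hI.ne'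

/-- For an effect of non-negative Wigner function, the error probabilities are limits of averages
over the Wigner functions of the states. -/
theorem exists_tendsto_integral_mul {m : ℕ} {M : H m →L[ℂ] H m} (hM : M ∈ wPlus m) :
    ∃ μ : ℕ → Phase m → ℝ, (∀ j z, 0 ≤ μ j z ∧ μ j z ≤ 1) ∧ ∀ ρ : H m →L[ℂ] H m, HasEnsemble ρ →
      (∀ z, 0 ≤ wigner ρ z) → (∀ j, Integrable fun z => wigner ρ z * μ j z) ∧
        Tendsto (fun j => ∫ z, wigner ρ z * μ j z) atTop (𝓝 (opTrace (ρ ∘L M)).re) := by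
  have hα1 : ∀ j : ℕ, (1 : ℝ) < ((j : ℝ) + 2) ^ 2 := fun j => by
    have : (0 : ℝ) ≤ j := j.cast_nonneg
    nlinarith
  have hα : ∀ j : ℕ, (0 : ℝ) < ((j : ℝ) + 2) ^ 2 := fun j => by positivity
  choose u u' C hC hcu hcv hu hv hwig using fun j => exists_gaussian_wigner m (hα1 j)
  have hpos : ∀ j z, 0 ≤ (symbol (u j) (u' j) M z).re := fun j =>
    symbol_nonneg (hcu j) (hcv j) (hu j) (hv j) (hC j) (hα j) (hwig j) hM.2.2.1
  -- The symbol of 1 - M is non-negative too, and that of 1 is constant.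
  have hpos' : ∀ j z, (symbol (u j) (u' j) M z).re ≤ (symbol (u j) (u' j) 1 0).re := fun j z => by
    have h := symbol_nonneg (hcu j) (hcv j) (hu j) (hv j) (hC j) (hα j) (hwig j) hM.2.2.2 z
    rw [symbol_sub (hcu j) (hcv j) (hu j) (hv j), Complex.sub_re, symbol_one] at h
    linarith
  -- These tests depend on M alone, so the same functions serve both states.
  refine ⟨fun j z => (symbol (u j) (u' j) M z).re / (symbol (u j) (u' j) 1 0).re, fun j z =>
    ⟨div_nonneg (hpos j z) ((hpos j z).trans (hpos' j z)),
      div_le_one_of_le₀ (hpos' j z) ((hpos j z).trans (hpos' j z))⟩, fun ρ hρ h0 => ?_⟩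
  obtain ⟨ι, hι, v, hvs, hvρ, hv1⟩ := hρ
  have hW : ∀ z, wigner ρ z = (Real.pi ^ m)⁻¹ * famWigner (fun _ => 1) v z := hvs.wigner_eq hvρ
  have hf0 : ∀ z, 0 ≤ famWigner (fun _ => 1) v z := fun z => by
    have h := h0 z
    rw [hW] at h
    exact nonneg_of_mul_nonneg_right h (by have := Real.pi_pos; positivity)
  have hpi : (Real.pi ^ m : ℝ) ≠ 0 := (pow_pos Real.pi_pos m).ne'
  have hav := fun j X => integral_famWigner_mul_symbol (hcu j) (hcv j) (hu j) (hv j) (hC j) (hα j)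
    (hwig j) hvs hf0 X
  have hre : ∀ j X, Integrable (fun z => famWigner (fun _ => 1) v z *
      (symbol (u j) (u' j) X z).re) ∧
      ∫ z, famWigner (fun _ => 1) v z * (symbol (u j) (u' j) X z).re = Real.pi ^ m * C j *
        (∫ ζ, (phaseGauss (((j : ℝ) + 2) ^ 2) ζ : ℂ) * dispTrace v X ζ).re := fun j X => by
    have h1 := (hav j X).1.re
    have h2 := (integral_re (hav j X).1).trans (congrArg RCLike.re (hav j X).2)
    have e : ∀ z, RCLike.re ((famWigner (fun _ => 1) v z : ℂ) * symbol (u j) (u' j) X z) =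
        famWigner (fun _ => 1) v z * (symbol (u j) (u' j) X z).re := fun z =>
      Complex.re_ofReal_mul _ _
    simp only [e] at h1 h2
    refine ⟨h1, h2.trans ?_⟩
    exact Complex.re_ofReal_mul _ _
  -- The normalisation is read off from the averaging identity at X = 1, where displaced copies of
  -- the state have trace one.
  have ht0 : ∀ j, (symbol (u j) (u' j) 1 0).re =
      C j * ∫ ζ : Phase m, phaseGauss (((j : ℝ) + 2) ^ 2) ζ := fun j => by
    have h := (hre j 1).2
    have e1 : ∀ ζ, (phaseGauss (((j : ℝ) + 2) ^ 2) ζ : ℂ) * dispTrace v 1 ζ =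
        ((phaseGauss (((j : ℝ) + 2) ^ 2) ζ : ℝ) : ℂ) := fun ζ => by
      have : dispTrace v 1 ζ = 1 := by
        simp only [dispTrace, one_apply_eq_self, inner_self_eq_ofReal, norm_displacement]
        rw [← Complex.ofReal_tsum, hv1, Complex.ofReal_one]
      rw [this, mul_one]
    have hint := hvs.integral_famWigner (hvs.integrable_famWigner hf0)
    simp only [one_mul, hv1, mul_one] at hint
    simp only [symbol_one, e1] at h
    rw [integral_mul_const, hint, integral_complex_ofReal, Complex.ofReal_re, mul_assoc] at h
    exact mul_left_cancel₀ hpi h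
  have heq : ∀ j, (fun z => wigner ρ z * ((symbol (u j) (u' j) M z).re /
      (symbol (u j) (u' j) 1 0).re)) = fun z =>
      ((Real.pi ^ m)⁻¹ * ((symbol (u j) (u' j) 1 0).re)⁻¹) *
        (famWigner (fun _ => 1) v z * (symbol (u j) (u' j) M z).re) := fun j => by
    funext z
    rw [hW]
    ring
  simp only [heq]
  refine ⟨fun j => (hre j M).1.const_mul _, ?_⟩
  have hT := continuous_dispTrace hvs.summable M
  have hlim := (Complex.continuous_re.tendsto _).comp (tendsto_integral_phaseGauss_mul hT.1 hT.2)
  have hT0 : dispTrace v M 0 = opTrace (ρ ∘L M) := by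
    rw [hvs.opTrace_right hvρ]
    simp only [dispTrace, displacement_zero, Complex.ofReal_one, one_mul]
  rw [hT0] at hlim
  refine hlim.congr fun j => ?_
  have hI := integral_phaseGauss_pos (m := m) (hα j)
  rw [integral_const_mul, (hre j M).2, ht0, Function.comp, Complex.div_ofReal_re]
  have := (hC j).ne'
  field_simp

theorem HasEnsemble.isProbDensity {m : ℕ} {ρ : H m →L[ℂ] H m} (hρ : HasEnsemble ρ)
    (h0 : ∀ z, 0 ≤ wigner ρ z) : IsProbDensity (wigner ρ) := by
  obtain ⟨ι, hι, v, hvs, hvρ, hv1⟩ := hρ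
  have hW : wigner ρ = fun z => (Real.pi ^ m)⁻¹ * famWigner (fun _ => 1) v z :=
    funext (hvs.wigner_eq hvρ)
  have hf0 : ∀ z, 0 ≤ famWigner (fun _ => 1) v z := fun z => by
    have h := h0 z
    rw [hW] at h
    exact nonneg_of_mul_nonneg_right h (by have := Real.pi_pos; positivity)
  have hi := hvs.integrable_famWigner hf0
  refine ⟨h0, ?_, ?_⟩
  · rw [hW]
    exact hi.const_mul _
  · rw [hW, integral_const_mul, hvs.integral_famWigner hi]
    simp only [one_mul, hv1, mul_one]
    exact inv_mul_cancel₀ (pow_pos Real.pi_pos m).ne'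

theorem HasEnsemble.opTrace_one_sub {m : ℕ} {ρ : H m →L[ℂ] H m} (hρ : HasEnsemble ρ)
    (M : H m →L[ℂ] H m) : opTrace (ρ ∘L (1 - M)) = 1 - opTrace (ρ ∘L M) := by
  obtain ⟨ι, hι, v, hvs, hvρ, hv1⟩ := hρ
  have e : ∀ k, (((1 : ℝ) : ℂ) * ⟪v k, (1 - M) (v k)⟫_ℂ) =
      ((‖v k‖ ^ 2 : ℝ) : ℂ) - ((1 : ℝ) : ℂ) * ⟪v k, M (v k)⟫_ℂ := fun k => by
    rw [sub_apply, inner_sub_right, one_apply_eq_self, inner_self_eq_ofReal]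
    push_cast
    ring
  rw [hvs.opTrace_right hvρ, hvs.opTrace_right hvρ]
  simp only [e]
  have hs : Summable fun k => ((‖v k‖ ^ 2 : ℝ) : ℂ) := Complex.ofRealCLM.summable hvs.summable
  rw [Summable.tsum_sub hs (hvs.summable_inner M),
    ← Complex.ofReal_tsum, hv1, Complex.ofReal_one]

/-- The error probabilities are bounded from below by those of the discrimination of the Wigner
functions. -/
theorem errorProb_ge {m : ℕ} {ρ₀ ρ₁ M : H m →L[ℂ] H m} (h₀ : HasEnsemble ρ₀) (h₁ : HasEnsemble ρ₁)
    (hW₀ : ∀ z, 0 ≤ wigner ρ₀ z) (hW₁ : ∀ z, 0 ≤ wigner ρ₁ z) (hM : M ∈ wPlus m) :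
    1 - (∫ z, |wigner ρ₀ z - wigner ρ₁ z|) / 2 ≤ 2 * errorProb ρ₀ ρ₁ M := by
  obtain ⟨μ, hμ, h⟩ := exists_tendsto_integral_mul hM
  obtain ⟨hi₀, ht₀⟩ := h ρ₀ h₀ hW₀
  obtain ⟨hi₁, ht₁⟩ := h ρ₁ h₁ hW₁
  obtain ⟨-, hp₀, hp₀'⟩ := h₀.isProbDensity hW₀
  obtain ⟨-, hp₁, hp₁'⟩ := h₁.isProbDensity hW₁
  have hd : Integrable fun z => wigner ρ₀ z - wigner ρ₁ z := hp₀.sub hp₁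
  have hda : Integrable fun z => |wigner ρ₀ z - wigner ρ₁ z| := hd.abs
  -- A test with values in [0, 1] gains at most the integral of the positive part of W₀ - W₁, which
  -- is half the `L¹` distance because both densities integrate to one.
  have key : ∀ j, (∫ z, wigner ρ₀ z * μ j z) - ∫ z, wigner ρ₁ z * μ j z ≤
      (∫ z, |wigner ρ₀ z - wigner ρ₁ z|) / 2 := by
    intro j
    have e : (∫ z, |wigner ρ₀ z - wigner ρ₁ z|) / 2 =
        ∫ z, (|wigner ρ₀ z - wigner ρ₁ z| + (wigner ρ₀ z - wigner ρ₁ z)) / 2 := by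
      rw [integral_div, integral_add hda hd, integral_sub hp₀ hp₁, hp₀',
        hp₁']
      ring
    rw [e, ← integral_sub (hi₀ j) (hi₁ j)]
    refine integral_mono ((hi₀ j).sub (hi₁ j))
      ((hda.add hd).div_const 2) fun z => ?_
    obtain ⟨h2, h3⟩ := hμ j z
    simp only
    rcases le_total 0 (wigner ρ₀ z - wigner ρ₁ z) with h4 | h4
    · rw [abs_of_nonneg h4]
      nlinarith
    · rw [abs_of_nonpos h4]
      nlinarith
  have hlim := le_of_tendsto (ht₀.sub ht₁) (Eventually.of_forall key)
  rw [errorProb, h₀.opTrace_one_sub, Complex.sub_re, Complex.one_re]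
  linarith

theorem chernoffSeq_wPlus_le {m : ℕ} {ρ₀ ρ₁ : H m →L[ℂ] H m} (h₀ : HasEnsemble ρ₀)
    (h₁ : HasEnsemble ρ₁) (hW₀ : ∀ z, 0 ≤ wigner ρ₀ z) (hW₁ : ∀ z, 0 ≤ wigner ρ₁ z) (n : ℕ) :
    chernoffSeq wPlus ρ₀ ρ₁ n ≤ classicalChernoffSeq (wigner ρ₀) (wigner ρ₁) n := by
  obtain ⟨e, he, h⟩ := exists_tensorPow_equiv m n
  have hp₀ := h ρ₀ h₀
  have hp₁ := h ρ₁ h₁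
  refine rate_antitone n ?_
  have hint : ∫ z : Fin n → Phase m, |∏ i, wigner ρ₀ (z i) - ∏ i, wigner ρ₁ (z i)| =
      ∫ z, |wigner (tensorPow ρ₀ n) z - wigner (tensorPow ρ₁ n) z| := by
    rw [← he.integral_comp e.measurableEmbedding]
    simp only [hp₀.2, hp₁.2]
  rw [hint, one_sub_distNorm]
  have hne : (errorProb (tensorPow ρ₀ n) (tensorPow ρ₁ n) '' wPlus (m * n)).Nonempty :=
    ((gocc_nonempty _).mono (gocc_subset_wPlus _)).image _
  have hle : (1 - (∫ z, |wigner (tensorPow ρ₀ n) z - wigner (tensorPow ρ₁ n) z|) / 2) / 2 ≤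
      sInf (errorProb (tensorPow ρ₀ n) (tensorPow ρ₁ n) '' wPlus (m * n)) := by
    refine le_csInf hne ?_
    rintro _ ⟨M, hM, rfl⟩
    have h1 := errorProb_ge hp₀.1 hp₁.1
      (fun z => by rw [hp₀.2]; exact Finset.prod_nonneg fun i _ => hW₀ _)
      (fun z => by rw [hp₁.2]; exact Finset.prod_nonneg fun i _ => hW₁ _) hM
    linarith
  linarith

end Bosonic

namespace Bosonic


/-! ### Chernoff's theorem -/

section Chernoff

variable {X : Type*}

/-- The integrand `p ^ s * q ^ (1 - s)` of the Chernoff coefficient. -/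
def geomMean (p q : X → ℝ) (s : ℝ) (x : X) : ℝ := p x ^ s * q x ^ (1 - s)

theorem geomMean_nonneg {p q : X → ℝ} {x : X} (hp : 0 ≤ p x) (hq : 0 ≤ q x) (s : ℝ) :
    0 ≤ geomMean p q s x :=
  mul_nonneg (Real.rpow_nonneg hp _) (Real.rpow_nonneg hq _)

theorem geomMean_le_add {p q : X → ℝ} {x : X} (hp : 0 ≤ p x) (hq : 0 ≤ q x) {s : ℝ}
    (hs : s ∈ Set.Icc (0 : ℝ) 1) : geomMean p q s x ≤ p x + q x := by
  have h := Real.geom_mean_le_arith_mean2_weighted hs.1 (sub_nonneg.2 hs.2) hp hq (by ring)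
  have h1 := mul_le_of_le_one_left hp hs.2
  have h2 : (1 - s) * q x ≤ q x := mul_le_of_le_one_left hq (by linarith [hs.1])
  exact h.trans (add_le_add h1 h2)

theorem geomMean_eq_exp {p q : X → ℝ} {x : X} (hp : 0 < p x) (hq : 0 < q x) (s : ℝ) :
    geomMean p q s x = Real.exp (s * Real.log (p x) + (1 - s) * Real.log (q x)) := by
  rw [geomMean, Real.rpow_def_of_pos hp, Real.rpow_def_of_pos hq, ← Real.exp_add]
  ring_nf

theorem measurable_geomMean [MeasurableSpace X] {p q : X → ℝ} (hp : Measurable p)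
    (hq : Measurable q) (s : ℝ) : Measurable (geomMean p q s) :=
  (hp.pow_const s).mul (hq.pow_const (1 - s))

theorem min_le_rpow_mul_rpow {a b s : ℝ} (ha : 0 ≤ a) (hb : 0 ≤ b) (hs : s ∈ Set.Ioo (0 : ℝ) 1) :
    min a b ≤ a ^ s * b ^ (1 - s) := by
  have h0 : 0 ≤ min a b := le_min ha hb
  calc min a b = min a b ^ s * min a b ^ (1 - s) := by
        rw [← Real.rpow_add_of_nonneg h0 hs.1.le (by linarith [hs.2])]; simp
    _ ≤ _ := mul_le_mul (Real.rpow_le_rpow h0 (min_le_left _ _) hs.1.le)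
        (Real.rpow_le_rpow h0 (min_le_right _ _) (by linarith [hs.2])) (Real.rpow_nonneg h0 _)
        (Real.rpow_nonneg ha _)

/-- Here L stands for a log-likelihood ratio, and the minimum is that of the two densities divided
by their geometric mean. Where sL ≤ δ and -(1 - s)L ≤ δ it is at least exp(-δ); elsewhere one of the
subtracted exponentials is at least 1 and the left side is not positive. This is Markov's inequality
in pointwise form. -/
theorem exp_mul_one_sub_le_min {s δ η L : ℝ} (hη : 0 < η) :
    Real.exp (-δ) * (1 - Real.exp (η * (s * L - δ)) - Real.exp (η * (-(1 - s) * L - δ))) ≤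
      min (Real.exp ((1 - s) * L)) (Real.exp (-s * L)) := by
  have e0 := Real.exp_pos (-δ)
  have e1 := Real.exp_pos (η * (s * L - δ))
  have e2 := Real.exp_pos (η * (-(1 - s) * L - δ))
  by_cases h1 : s * L ≤ δ
  · by_cases h2 : -(1 - s) * L ≤ δ
    · have : Real.exp (-δ) *
          (1 - Real.exp (η * (s * L - δ)) - Real.exp (η * (-(1 - s) * L - δ))) ≤ Real.exp (-δ) := by
        nlinarith
      refine this.trans (le_min ?_ ?_) <;> apply Real.exp_le_exp.2 <;> linarith
    · have : 1 ≤ Real.exp (η * (-(1 - s) * L - δ)) :=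
        Real.one_le_exp (mul_nonneg hη.le (by linarith))
      exact (mul_nonpos_of_nonneg_of_nonpos e0.le (by linarith)).trans
        (le_min (Real.exp_pos _).le (Real.exp_pos _).le)
  · have : 1 ≤ Real.exp (η * (s * L - δ)) := Real.one_le_exp (mul_nonneg hη.le (by linarith))
    exact (mul_nonpos_of_nonneg_of_nonpos e0.le (by linarith)).trans
      (le_min (Real.exp_pos _).le (Real.exp_pos _).le)

/-- The preceding inequality times the geometric mean of the products: the exponentials move the
exponent s to s + ηs and to s - η(1 - s). Every term on the left is a product over coordinates and
integrates to an n-th power, so no tilted measure and no law of large numbers is needed. -/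
theorem prod_indicator_le_min {p q : X → ℝ} (hp : ∀ x, 0 ≤ p x) (hq : ∀ x, 0 ≤ q x) {A : Set X}
    (hpA : ∀ x ∈ A, 0 < p x) (hqA : ∀ x ∈ A, 0 < q x) {s δ η : ℝ} (hη : 0 < η) {n : ℕ}
    (x : Fin n → X) :
    Real.exp (-δ) ^ n * (∏ i, A.indicator (geomMean p q s) (x i)
        - Real.exp (-(η * δ)) ^ n * ∏ i, A.indicator (geomMean p q (s + η * s)) (x i)
        - Real.exp (-(η * δ)) ^ n * ∏ i, A.indicator (geomMean p q (s - η * (1 - s))) (x i)) ≤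
      min (∏ i, p (x i)) (∏ i, q (x i)) := by
  by_cases hx : ∀ i, x i ∈ A
  · have key : ∀ t, ∏ i, A.indicator (geomMean p q t) (x i) =
        Real.exp (t * ∑ i, Real.log (p (x i)) + (1 - t) * ∑ i, Real.log (q (x i))) := by
      intro t
      rw [Finset.mul_sum, Finset.mul_sum, ← Finset.sum_add_distrib, Real.exp_sum]
      refine Finset.prod_congr rfl fun i _ => ?_
      rw [Set.indicator_of_mem (hx i), geomMean_eq_exp (hpA _ (hx i)) (hqA _ (hx i))]
    have kp : ∏ i, p (x i) = Real.exp (∑ i, Real.log (p (x i))) := by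
      rw [Real.exp_sum]
      exact Finset.prod_congr rfl fun i _ => (Real.exp_log (hpA _ (hx i))).symm
    have kq : ∏ i, q (x i) = Real.exp (∑ i, Real.log (q (x i))) := by
      rw [Real.exp_sum]
      exact Finset.prod_congr rfl fun i _ => (Real.exp_log (hqA _ (hx i))).symm
    rw [key, key, key, kp, kq]
    set P := ∑ i, Real.log (p (x i))
    set Q := ∑ i, Real.log (q (x i))
    have h := mul_le_mul_of_nonneg_left
      (exp_mul_one_sub_le_min (s := s) (δ := n * δ) (L := P - Q) hη)
      (Real.exp_pos (s * P + (1 - s) * Q)).le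
    rw [mul_min_of_nonneg _ _ (Real.exp_pos _).le, ← Real.exp_add, ← Real.exp_add] at h
    rw [← Real.exp_nat_mul, ← Real.exp_nat_mul]
    convert! h using 1
    · simp only [mul_sub, mul_one, ← Real.exp_add]
      ring_nf
    · ring_nf
  · push Not at hx
    obtain ⟨i, hi⟩ := hx
    have key : ∀ t, ∏ i, A.indicator (geomMean p q t) (x i) = 0 := fun t =>
      Finset.prod_eq_zero (Finset.mem_univ i) (Set.indicator_of_notMem hi _)
    rw [key, key, key]
    simpa using ⟨Finset.prod_nonneg fun i _ => hp _, Finset.prod_nonneg fun i _ => hq _⟩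

/-- From cosh y ≤ exp(y²/2) with y = a(log p - log q). The exponent s + a may leave [0, 1], and is
controlled by its reflection s - a. -/
theorem geomMean_add_le {p q : X → ℝ} {x : X} (hp : 0 < p x) (hq : 0 < q x) {K η : ℝ}
    (hK : |Real.log (p x) - Real.log (q x)| ≤ K) {s a : ℝ} (ha : |a| ≤ η) :
    geomMean p q (s + a) x ≤
      2 * Real.exp ((η * K) ^ 2 / 2) * geomMean p q s x - geomMean p q (s - a) x := by
  have h := Real.cosh_le_exp_half_sq (a * (Real.log (p x) - Real.log (q x)))
  rw [Real.cosh_eq] at h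
  have h2 : (a * (Real.log (p x) - Real.log (q x))) ^ 2 ≤ (η * K) ^ 2 := by
    rw [← sq_abs, abs_mul]
    exact pow_le_pow_left₀ (by positivity)
      (mul_le_mul ha hK (abs_nonneg _) ((abs_nonneg _).trans ha)) 2
  have h3 : Real.exp ((a * (Real.log (p x) - Real.log (q x))) ^ 2 / 2) ≤
      Real.exp ((η * K) ^ 2 / 2) := Real.exp_le_exp.2 (by linarith)
  have h4 := mul_le_mul_of_nonneg_left (h.trans h3) (geomMean_nonneg hp.le hq.le s)
  have h5 : geomMean p q (s + a) x =
      geomMean p q s x * Real.exp (a * (Real.log (p x) - Real.log (q x))) := by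
    rw [geomMean_eq_exp hp hq, geomMean_eq_exp hp hq, ← Real.exp_add]; ring_nf
  have h6 : geomMean p q (s - a) x =
      geomMean p q s x * Real.exp (-(a * (Real.log (p x) - Real.log (q x)))) := by
    rw [geomMean_eq_exp hp hq, geomMean_eq_exp hp hq, ← Real.exp_add]; ring_nf
  rw [h5, h6]
  linarith

variable [MeasureSpace X] {p q : X → ℝ}

theorem integrable_geomMean (hp0 : ∀ x, 0 ≤ p x) (hq0 : ∀ x, 0 ≤ q x) (hpm : Measurable p)
    (hqm : Measurable q) (hp : Integrable p) (hq : Integrable q) {s : ℝ}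
    (hs : s ∈ Set.Icc (0 : ℝ) 1) : Integrable (geomMean p q s) :=
  (hp.add hq).mono' (measurable_geomMean hpm hqm s).aestronglyMeasurable
    (Eventually.of_forall fun x => by
      rw [Real.norm_of_nonneg (geomMean_nonneg (hp0 x) (hq0 x) s)]
      exact geomMean_le_add (hp0 x) (hq0 x) hs)

theorem continuousOn_setIntegral_geomMean (hp0 : ∀ x, 0 ≤ p x) (hq0 : ∀ x, 0 ≤ q x)
    (hpm : Measurable p) (hqm : Measurable q) (hp : Integrable p) (hq : Integrable q) {A : Set X}
    (hA : MeasurableSet A) (hpA : ∀ x ∈ A, 0 < p x) (hqA : ∀ x ∈ A, 0 < q x) :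
    ContinuousOn (fun s => ∫ x in A, geomMean p q s x) (Set.Icc 0 1) := by
  refine continuousOn_of_dominated (bound := fun x => p x + q x)
    (fun s _ => (measurable_geomMean hpm hqm s).aestronglyMeasurable) (fun s hs => ?_)
    (hp.add hq).integrableOn ?_
  · exact Eventually.of_forall fun x => by
      rw [Real.norm_of_nonneg (geomMean_nonneg (hp0 x) (hq0 x) s)]
      exact geomMean_le_add (hp0 x) (hq0 x) hs
  · refine (ae_restrict_iff' hA).2 (Eventually.of_forall fun x hx => Continuous.continuousOn ?_)
    simp_rw [geomMean_eq_exp (hpA x hx) (hqA x hx)]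
    fun_prop

theorem integrableOn_geomMean_add (hp0 : ∀ x, 0 ≤ p x) (hq0 : ∀ x, 0 ≤ q x)
    (hpm : Measurable p) (hqm : Measurable q) (hp : Integrable p) (hq : Integrable q) {A : Set X}
    (hA : MeasurableSet A) (hpA : ∀ x ∈ A, 0 < p x) (hqA : ∀ x ∈ A, 0 < q x) {K η : ℝ}
    (hK : ∀ x ∈ A, |Real.log (p x) - Real.log (q x)| ≤ K) {s a : ℝ}
    (hs : s ∈ Set.Icc (0 : ℝ) 1) (ha : |a| ≤ η) (hsa : s - a ∈ Set.Icc (0 : ℝ) 1) :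
    IntegrableOn (geomMean p q (s + a)) A := by
  have hi := fun {t} ht => integrable_geomMean hp0 hq0 hpm hqm hp hq (s := t) ht
  refine Integrable.mono' (((hi hs).const_mul (2 * Real.exp ((η * K) ^ 2 / 2))).sub
    (hi hsa)).integrableOn (measurable_geomMean hpm hqm _).aestronglyMeasurable ?_
  refine (ae_restrict_iff' hA).2 (Eventually.of_forall fun x hx => ?_)
  rw [Real.norm_of_nonneg (geomMean_nonneg (hp0 x) (hq0 x) _)]
  exact geomMean_add_le (hpA x hx) (hqA x hx) (hK x hx) ha

/-- Minimality of s is invoked only at the reflected exponent s - a. Minima at the end points of [0,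
1], where no derivative need vanish, are thus included. -/
theorem setIntegral_geomMean_add_le (hp0 : ∀ x, 0 ≤ p x) (hq0 : ∀ x, 0 ≤ q x)
    (hpm : Measurable p) (hqm : Measurable q) (hp : Integrable p) (hq : Integrable q) {A : Set X}
    (hA : MeasurableSet A) (hpA : ∀ x ∈ A, 0 < p x) (hqA : ∀ x ∈ A, 0 < q x) {K η : ℝ}
    (hK : ∀ x ∈ A, |Real.log (p x) - Real.log (q x)| ≤ K) {s a : ℝ}
    (hs : s ∈ Set.Icc (0 : ℝ) 1) (ha : |a| ≤ η) (hsa : s - a ∈ Set.Icc (0 : ℝ) 1)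
    (hmin : ∫ x in A, geomMean p q s x ≤ ∫ x in A, geomMean p q (s - a) x) :
    ∫ x in A, geomMean p q (s + a) x ≤
      (2 * Real.exp ((η * K) ^ 2 / 2) - 1) * ∫ x in A, geomMean p q s x := by
  have hi := fun {t} ht => (integrable_geomMean hp0 hq0 hpm hqm hp hq (s := t) ht).integrableOn
    (s := A)
  have h : ∫ x in A, geomMean p q (s + a) x ≤
      ∫ x in A, (2 * Real.exp ((η * K) ^ 2 / 2) * geomMean p q s x - geomMean p q (s - a) x) :=
    setIntegral_mono_on
      (integrableOn_geomMean_add hp0 hq0 hpm hqm hp hq hA hpA hqA hK hs ha hsa)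
      (((hi hs).const_mul _).sub (hi hsa)) hA
      fun x hx => geomMean_add_le (hpA x hx) (hqA x hx) (hK x hx) ha
  rw [integral_sub ((hi hs).const_mul _) (hi hsa), integral_const_mul] at h
  linarith

variable [SigmaFinite (volume : Measure X)]

/-- The minimal total error probability of discriminating `p^{⊗ n}` and `q^{⊗ n}`. -/
theorem one_sub_integral_abs_sub_eq (hp : Integrable p) (hq : Integrable q) (hp1 : ∫ x, p x = 1)
    (hq1 : ∫ x, q x = 1) (n : ℕ) :
    1 - (∫ x : Fin n → X, |∏ i, p (x i) - ∏ i, q (x i)|) / 2 =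
      ∫ x : Fin n → X, min (∏ i, p (x i)) (∏ i, q (x i)) := by
  have ip : Integrable fun x : Fin n → X => ∏ i, p (x i) := Integrable.fintype_prod fun _ => hp
  have iq : Integrable fun x : Fin n → X => ∏ i, q (x i) := Integrable.fintype_prod fun _ => hq
  have e : ∀ x : Fin n → X, min (∏ i, p (x i)) (∏ i, q (x i)) =
      (∏ i, p (x i) + ∏ i, q (x i) - |∏ i, p (x i) - ∏ i, q (x i)|) / 2 := fun x => by
    rcases le_total (∏ i, p (x i)) (∏ i, q (x i)) with h | h
    · rw [min_eq_left h, abs_of_nonpos (by linarith)]; ring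
    · rw [min_eq_right h, abs_of_nonneg (by linarith)]; ring
  have h := integral_sub (ip.add iq) (ip.sub iq).abs
  simp only [Pi.add_apply, Pi.sub_apply] at h
  simp_rw [e]
  rw [integral_div, h, integral_add ip iq,
    integral_fintype_prod_volume_eq_pow, integral_fintype_prod_volume_eq_pow, hp1, hq1]
  simp only [one_pow]
  ring

theorem integral_min_prod_le_pow (hp0 : ∀ x, 0 ≤ p x) (hq0 : ∀ x, 0 ≤ q x) (hpm : Measurable p)
    (hqm : Measurable q) (hp : Integrable p) (hq : Integrable q) {s : ℝ}
    (hs : s ∈ Set.Ioo (0 : ℝ) 1) (n : ℕ) :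
    ∫ x : Fin n → X, min (∏ i, p (x i)) (∏ i, q (x i)) ≤ (∫ x, geomMean p q s x) ^ n := by
  have hi := integrable_geomMean hp0 hq0 hpm hqm hp hq ⟨hs.1.le, hs.2.le⟩
  have h := integral_fintype_prod_volume_eq_pow (ι := Fin n) (geomMean p q s)
  rw [Fintype.card_fin] at h
  rw [← h]
  refine integral_mono ((Integrable.fintype_prod fun _ => hp).inf
    (Integrable.fintype_prod fun _ => hq)) (Integrable.fintype_prod fun _ => hi) fun x => ?_
  refine (min_le_rpow_mul_rpow (Finset.prod_nonneg fun i _ => hp0 _)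
    (Finset.prod_nonneg fun i _ => hq0 _) hs).trans_eq ?_
  rw [← Real.finsetProd_rpow _ _ fun i _ => hp0 _, ← Real.finsetProd_rpow _ _ fun i _ => hq0 _,
    ← Finset.prod_mul_distrib]
  rfl

theorem pow_le_integral_min_prod_of_bounded (hp0 : ∀ x, 0 ≤ p x) (hq0 : ∀ x, 0 ≤ q x)
    (hpm : Measurable p) (hqm : Measurable q) (hp : Integrable p) (hq : Integrable q) {A : Set X}
    (hA : MeasurableSet A) (hpA : ∀ x ∈ A, 0 < p x) (hqA : ∀ x ∈ A, 0 < q x) {K : ℝ}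
    (hK : ∀ x ∈ A, |Real.log (p x) - Real.log (q x)| ≤ K) {c : ℝ} (hc : 0 < c)
    (hcA : ∀ s ∈ Set.Icc (0 : ℝ) 1, c < ∫ x in A, geomMean p q s x) :
    ∀ᶠ n in atTop, c ^ n ≤ ∫ x : Fin n → X, min (∏ i, p (x i)) (∏ i, q (x i)) := by
  obtain ⟨s, hs, hmin⟩ := isCompact_Icc.exists_isMinOn (Set.nonempty_Icc.2 zero_le_one)
    (continuousOn_setIntegral_geomMean hp0 hq0 hpm hqm hp hq hA hpA hqA)
  rw [isMinOn_iff] at hmin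
  set Φ := ∫ x in A, geomMean p q s x with hΦ
  have hcΦ : c < Φ := hcA s hs
  have hΦ0 : 0 < Φ := hc.trans hcΦ
  obtain ⟨δ, hδ0, hδ1, hδ⟩ : ∃ δ : ℝ, 0 < δ ∧ δ ≤ 1 ∧ c < Real.exp (-δ) * Φ := by
    have hl : 0 < Real.log (Φ / c) := Real.log_pos ((one_lt_div hc).2 hcΦ)
    refine ⟨min 1 (Real.log (Φ / c) / 2), lt_min one_pos (half_pos hl), min_le_left _ _, ?_⟩
    have h1 : min 1 (Real.log (Φ / c) / 2) < Real.log (Φ / c) :=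
      (min_le_right _ _).trans_lt (half_lt_self hl)
    have h2 := (Real.lt_log_iff_exp_lt (div_pos hΦ0 hc)).1 h1
    rw [lt_div_iff₀ hc] at h2
    rw [Real.exp_neg, inv_mul_eq_div, lt_div_iff₀ (Real.exp_pos _)]
    linarith
  have hK1 : 0 < K ^ 2 + 1 := by positivity
  -- So small that ηK² < δ: the relative size r of the corrections is then at most exp(η(ηK² - δ)) <
  -- 1, using 2 exp(y/2) - 1 ≤ exp y.
  set η := δ / (K ^ 2 + 1) with hη
  have hη0 : 0 < η := div_pos hδ0 hK1
  have hη1 : η ≤ 1 := (div_le_one hK1).2 (by nlinarith [sq_nonneg K])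
  have hηK : η * K ^ 2 < δ := by
    rw [hη, div_mul_eq_mul_div, div_lt_iff₀ hK1]; nlinarith
  set r := Real.exp (-(η * δ)) * (2 * Real.exp ((η * K) ^ 2 / 2) - 1) with hr
  have hr0 : 0 ≤ r := mul_nonneg (Real.exp_pos _).le (by
    linarith [Real.one_le_exp (show 0 ≤ (η * K) ^ 2 / 2 by positivity)])
  have hr1 : r < 1 := by
    have h1 : 2 * Real.exp ((η * K) ^ 2 / 2) - 1 ≤ Real.exp ((η * K) ^ 2) := by
      have : Real.exp ((η * K) ^ 2) = Real.exp ((η * K) ^ 2 / 2) ^ 2 := by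
        rw [← Real.exp_nat_mul]; push_cast; ring_nf
      nlinarith [sq_nonneg (Real.exp ((η * K) ^ 2 / 2) - 1)]
    calc r ≤ Real.exp (-(η * δ)) * Real.exp ((η * K) ^ 2) :=
          mul_le_mul_of_nonneg_left h1 (Real.exp_pos _).le
      _ = Real.exp (η * (η * K ^ 2 - δ)) := by rw [← Real.exp_add]; ring_nf
      _ < 1 := Real.exp_lt_one_iff.2 (mul_neg_of_pos_of_neg hη0 (by linarith))
  have hs0 := hs.1
  have hs1 := hs.2
  have ha : |η * s| ≤ η := by
    rw [abs_of_nonneg (by positivity)]; exact mul_le_of_le_one_right hη0.le hs1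
  have hb : |-(η * (1 - s))| ≤ η := by
    rw [abs_neg, abs_of_nonneg (mul_nonneg hη0.le (by linarith))]
    exact mul_le_of_le_one_right hη0.le (by linarith)
  -- The reflected exponents are convex combinations of s with 0 and with 1.
  have hsa : s - η * s ∈ Set.Icc (0 : ℝ) 1 := ⟨by nlinarith, by nlinarith⟩
  have hsb : s - -(η * (1 - s)) ∈ Set.Icc (0 : ℝ) 1 := ⟨by nlinarith, by nlinarith⟩
  have ia := integrableOn_geomMean_add hp0 hq0 hpm hqm hp hq hA hpA hqA hK hs ha hsa
  have ib := integrableOn_geomMean_add hp0 hq0 hpm hqm hp hq hA hpA hqA hK hs hb hsb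
  have la := setIntegral_geomMean_add_le hp0 hq0 hpm hqm hp hq hA hpA hqA hK hs ha hsa
    (hmin _ hsa)
  have lb := setIntegral_geomMean_add_le hp0 hq0 hpm hqm hp hq hA hpA hqA hK hs hb hsb
    (hmin _ hsb)
  rw [← sub_eq_add_neg] at ib lb
  have is := (integrable_geomMean hp0 hq0 hpm hqm hp hq hs).integrableOn (s := A)
  have hpow : ∀ t n, ∫ x : Fin n → X, ∏ i, A.indicator (geomMean p q t) (x i) =
      (∫ x in A, geomMean p q t x) ^ n := fun t n => by
    rw [integral_fintype_prod_volume_eq_pow, integral_indicator hA, Fintype.card_fin]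
  have hint : ∀ {t} (n : ℕ), IntegrableOn (geomMean p q t) A →
      Integrable fun x : Fin n → X => ∏ i, A.indicator (geomMean p q t) (x i) := fun n h =>
    Integrable.fintype_prod fun _ => (integrable_indicator_iff hA).2 h
  have hbound : ∀ t n, ∫ x in A, geomMean p q t x ≤
      (2 * Real.exp ((η * K) ^ 2 / 2) - 1) * Φ →
      Real.exp (-(η * δ)) ^ n * (∫ x in A, geomMean p q t x) ^ n ≤ r ^ n * Φ ^ n := by
    intro t n h
    rw [← mul_pow, ← mul_pow]
    refine pow_le_pow_left₀ (mul_nonneg (Real.exp_pos _).le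
      (setIntegral_nonneg hA fun x _ => geomMean_nonneg (hp0 x) (hq0 x) t)) ?_ n
    rw [hr, mul_assoc]
    exact mul_le_mul_of_nonneg_left h (Real.exp_pos _).le
  -- The integrated pointwise inequality: a main term and two corrections of relative size at most
  -- r^n.
  have hlow : ∀ n : ℕ, (Real.exp (-δ) * Φ) ^ n * (1 - 2 * r ^ n) ≤
      ∫ x : Fin n → X, min (∏ i, p (x i)) (∏ i, q (x i)) := by
    intro n
    have h := integral_mono ((((hint n is).sub ((hint n ia).const_mul (Real.exp (-(η * δ)) ^ n))).sub
      ((hint n ib).const_mul (Real.exp (-(η * δ)) ^ n))).const_mul (Real.exp (-δ) ^ n))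
      ((Integrable.fintype_prod fun _ => hp).inf (Integrable.fintype_prod fun _ => hq))
      (fun x => prod_indicator_le_min hp0 hq0 hpA hqA (s := s) (δ := δ) hη0 x)
    refine le_trans ?_ h
    rw [integral_const_mul, integral_sub' ((hint n is).sub ((hint n ia).const_mul _))
      ((hint n ib).const_mul _), integral_sub' (hint n is) ((hint n ia).const_mul _),
      integral_const_mul, integral_const_mul, hpow, hpow, hpow, mul_pow, mul_assoc]
    refine mul_le_mul_of_nonneg_left ?_ (pow_nonneg (Real.exp_pos _).le n)
    have h1 := hbound _ n la
    have h2 := hbound _ n lb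
    linarith
  have hE : 0 < Real.exp (-δ) * Φ := hc.trans hδ
  have t1 := tendsto_pow_atTop_nhds_zero_of_lt_one (div_nonneg hc.le hE.le) ((div_lt_one hE).2 hδ)
  have t2 : Tendsto (fun n => 1 - 2 * r ^ n) atTop (𝓝 1) := by
    simpa using ((tendsto_pow_atTop_nhds_zero_of_lt_one hr0 hr1).const_mul 2).const_sub 1
  filter_upwards [t1.eventually_lt t2 one_pos] with n h1
  refine le_trans ?_ (hlow n)
  rw [div_pow, div_lt_iff₀ (pow_pos hE n)] at h1
  linarith

end Chernoff

end Bosonic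

namespace Bosonic


/-! ### Removal of the truncation, and the limit in Chernoff's theorem -/

section ChernoffLimit

variable {X : Type*} [MeasureSpace X] [SigmaFinite (volume : Measure X)] {p q : X → ℝ}

/-- On the sets of log-likelihood ratio at most k the integrals of the geometric means increase to
those over {p, q > 0}. By Dini's theorem they do so uniformly in s, so a single truncation keeps all
of them above c. -/
theorem pow_le_integral_min_prod (hp0 : ∀ x, 0 ≤ p x) (hq0 : ∀ x, 0 ≤ q x)
    (hpm : Measurable p) (hqm : Measurable q) (hp : Integrable p) (hq : Integrable q) {c d : ℝ}
    (hc : 0 < c) (hcd : c < d) (hd : ∀ s ∈ Set.Ioo (0 : ℝ) 1, d ≤ ∫ x, geomMean p q s x) :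
    ∀ᶠ n in atTop, c ^ n ≤ ∫ x : Fin n → X, min (∏ i, p (x i)) (∏ i, q (x i)) := by
  set A : ℕ → Set X := fun k => {x | 0 < p x ∧ 0 < q x ∧
    |Real.log (p x) - Real.log (q x)| ≤ k} with hAdef
  set S : Set X := {x | 0 < p x ∧ 0 < q x} with hSdef
  have mS : MeasurableSet S :=
    (measurableSet_lt measurable_const hpm).inter (measurableSet_lt measurable_const hqm)
  have mA : ∀ k, MeasurableSet (A k) := fun k =>
    (measurableSet_lt measurable_const hpm).inter ((measurableSet_lt measurable_const hqm).inter
      (measurableSet_le (_root_.continuous_abs.measurable.comp (hpm.log.sub hqm.log))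
        measurable_const))
  have hmono : Monotone A := fun k l hkl x hx =>
    ⟨hx.1, hx.2.1, hx.2.2.trans (by exact_mod_cast hkl)⟩
  have hU : ⋃ k, A k = S := by
    ext x
    simp only [Set.mem_iUnion]
    refine ⟨fun ⟨k, hk⟩ => ⟨hk.1, hk.2.1⟩, fun h => ?_⟩
    obtain ⟨k, hk⟩ := exists_nat_ge |Real.log (p x) - Real.log (q x)|
    exact ⟨k, h.1, h.2, hk⟩
  have hi := fun {t} ht (B : Set X) =>
    (integrable_geomMean hp0 hq0 hpm hqm hp hq (s := t) ht).integrableOn (s := B)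
  have cS := continuousOn_setIntegral_geomMean hp0 hq0 hpm hqm hp hq mS (fun x hx => hx.1)
    (fun x hx => hx.2)
  -- At s = 0 and s = 1 the integral over the whole space may exceed that over S, as 0⁰ = 1. The
  -- latter is continuous up to the end points, which extends the bound from the open interval.
  have hdS : ∀ s ∈ Set.Icc (0 : ℝ) 1, d ≤ ∫ x in S, geomMean p q s x := by
    rw [← closure_Ioo zero_ne_one] at cS ⊢
    refine fun s hs => le_on_closure (fun s hs => ?_) continuousOn_const cS hs
    rw [setIntegral_eq_integral_of_forall_compl_eq_zero]
    · exact hd s hs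
    · intro x hx
      rcases (hp0 x).eq_or_lt with h | h
      · rw [geomMean, ← h, Real.zero_rpow hs.1.ne', zero_mul]
      · rcases (hq0 x).eq_or_lt with h' | h'
        · rw [geomMean, ← h', Real.zero_rpow (by linarith [hs.2]), mul_zero]
        · exact absurd ⟨h, h'⟩ hx
  have hdini : TendstoUniformlyOn (fun k s => ∫ x in A k, geomMean p q s x)
      (fun s => ∫ x in S, geomMean p q s x) atTop (Set.Icc 0 1) := by
    refine Monotone.tendstoUniformlyOn_of_forall_tendsto isCompact_Icc (fun k =>
      continuousOn_setIntegral_geomMean hp0 hq0 hpm hqm hp hq (mA k) (fun x hx => hx.1)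
        (fun x hx => hx.2.1)) (fun s hs k l hkl => ?_) cS (fun s hs => ?_)
    · exact setIntegral_mono_set (hi hs _)
        (Eventually.of_forall fun x => geomMean_nonneg (hp0 x) (hq0 x) s)
        (Eventually.of_forall (hmono hkl))
    · rw [← hU]
      exact tendsto_setIntegral_of_monotone mA hmono (hi hs _)
  obtain ⟨k, hk⟩ := (Metric.tendstoUniformlyOn_iff.1 hdini (d - c) (by linarith)).exists
  refine pow_le_integral_min_prod_of_bounded hp0 hq0 hpm hqm hp hq (mA k) (fun x hx => hx.1)
    (fun x hx => hx.2.1) (fun x hx => hx.2.2) hc fun s hs => ?_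
  have h1 := hk s hs
  rw [Real.dist_eq] at h1
  have h2 := hdS s hs
  have h3 := (abs_lt.1 h1).2
  linarith

end ChernoffLimit

theorem rate_pow {n : ℕ} (hn : n ≠ 0) {c : ℝ} (hc : 0 ≤ c) :
    rate n (c ^ n) = -ENNReal.log (ENNReal.ofReal c) := by
  have h0 : (0 : EReal) < ((n : ℝ) : EReal) := by
    exact_mod_cast Nat.pos_of_ne_zero hn
  rw [rate, ENNReal.ofReal_pow hc, ENNReal.log_pow, ← mul_neg,
    EReal.div_eq_iff (EReal.coe_ne_bot _) (EReal.coe_ne_top _) h0.ne', mul_comm]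
  rfl

/-- **Chernoff's theorem** for two probability densities. -/
theorem tendsto_classicalChernoffSeq {m : ℕ} {p q : Phase m → ℝ} (hp : IsProbDensity p)
    (hq : IsProbDensity q) (hpm : Measurable p) (hqm : Measurable q) :
    Tendsto (classicalChernoffSeq p q) atTop (𝓝 (chernoffCoeff p q)) := by
  obtain ⟨hp0, hpi, hp1⟩ := hp
  obtain ⟨hq0, hqi, hq1⟩ := hq
  have hseq : ∀ n, classicalChernoffSeq p q n =
      rate n (∫ x : Fin n → Phase m, min (∏ i, p (x i)) (∏ i, q (x i))) := fun n => by
    rw [classicalChernoffSeq, one_sub_integral_abs_sub_eq hpi hqi hp1 hq1]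
  have hφ : ∀ s ∈ Set.Ioo (0 : ℝ) 1, ∫⁻ z, ENNReal.ofReal (p z ^ s * q z ^ (1 - s)) =
      ENNReal.ofReal (∫ z, geomMean p q s z) := fun s hs =>
    (ofReal_integral_eq_lintegral_ofReal (integrable_geomMean hp0 hq0 hpm hqm hpi hqi
      ⟨hs.1.le, hs.2.le⟩) (Eventually.of_forall fun x => geomMean_nonneg (hp0 x) (hq0 x) s)).symm
  have hφ0 : ∀ s, 0 ≤ ∫ z, geomMean p q s z := fun s =>
    integral_nonneg fun x => geomMean_nonneg (hp0 x) (hq0 x) s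
  refine tendsto_order.2 ⟨fun a ha => ?_, fun b hb => ?_⟩
  -- One exponent s with integral below exp(-a) suffices, for all n > 0 at once.
  · rw [chernoffCoeff, EReal.lt_neg_comm, ← EReal.log_exp (-a), ENNReal.log_lt_log_iff] at ha
    simp only [iInf_lt_iff] at ha
    obtain ⟨s, hs, hsa⟩ := ha
    rw [hφ s hs, ← ENNReal.log_lt_log_iff, EReal.log_exp, ← EReal.lt_neg_comm] at hsa
    filter_upwards [eventually_ne_atTop 0] with n hn
    rw [hseq]
    refine hsa.trans_le ?_
    rw [← rate_pow hn (hφ0 s)]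
    exact rate_antitone n (integral_min_prod_le_pow hp0 hq0 hpm hqm hpi hqi hs n)
  -- With exp(-b) < c < d below the infimum, the error eventually exceeds c^n; d leaves the room
  -- that the truncation uses up, and c > 0 holds automatically.
  · rw [gt_iff_lt, chernoffCoeff, EReal.neg_lt_comm, ← EReal.log_exp (-b), ENNReal.log_lt_log_iff] at hb
    obtain ⟨c, hbc, hc⟩ := exists_between hb
    obtain ⟨d, hcd, hd⟩ := exists_between hc
    have hd' : d ≠ ⊤ := hd.ne_top
    have hc' : c ≠ ⊤ := hc.ne_top
    have hc0 : 0 < c := bot_le.trans_lt hbc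
    rw [← ENNReal.log_lt_log_iff, EReal.log_exp, EReal.neg_lt_comm] at hbc
    have h := pow_le_integral_min_prod hp0 hq0 hpm hqm hpi hqi (ENNReal.toReal_pos hc0.ne' hc')
      ((ENNReal.toReal_lt_toReal hc' hd').2 hcd) fun s hs => by
        have : d ≤ ENNReal.ofReal (∫ z, geomMean p q s z) := by
          rw [← hφ s hs]; exact hd.le.trans (iInf₂_le s hs)
        rw [← ENNReal.toReal_ofReal (hφ0 s)]
        exact ENNReal.toReal_mono ENNReal.ofReal_ne_top this
    filter_upwards [eventually_ne_atTop 0, h] with n hn hcn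
    rw [hseq]
    refine lt_of_le_of_lt ?_ hbc
    have := rate_antitone n hcn
    rwa [rate_pow hn ENNReal.toReal_nonneg, ENNReal.ofReal_toReal hc'] at this

theorem HasEnsemble.measurable_wigner {m : ℕ} {ρ : H m →L[ℂ] H m} (h : HasEnsemble ρ) :
    Measurable (wigner ρ) := by
  obtain ⟨ι, _, v, hvs, hvρ, -⟩ := h
  rw [funext (hvs.wigner_eq hvρ)]
  exact (hvs.continuous_famWigner.const_mul _).measurable

end Bosonic

end

theorem corollary1 (m : ℕ) (ρ₀ ρ₁ : H m →L[ℂ] H m)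
    (hρ₀ : IsDensityOperator ρ₀) (hρ₁ : IsDensityOperator ρ₁)
    (hW₀ : ∀ z, 0 ≤ wigner ρ₀ z) (hW₁ : ∀ z, 0 ≤ wigner ρ₁ z) :
    (IsProbDensity (wigner ρ₀) ∧ IsProbDensity (wigner ρ₁)) ∧
    limsup (chernoffSeq gocc ρ₀ ρ₁) atTop ≤ limsup (chernoffSeq wPlus ρ₀ ρ₁) atTop ∧
    liminf (chernoffSeq gocc ρ₀ ρ₁) atTop ≤ liminf (chernoffSeq wPlus ρ₀ ρ₁) atTop ∧
    limsup (chernoffSeq wPlus ρ₀ ρ₁) atTop ≤ chernoffCoeff (wigner ρ₀) (wigner ρ₁) ∧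
    Tendsto (classicalChernoffSeq (wigner ρ₀) (wigner ρ₁)) atTop
      (𝓝 (chernoffCoeff (wigner ρ₀) (wigner ρ₁))) := by
  have h₀ := hρ₀.hasEnsemble
  have h₁ := hρ₁.hasEnsemble
  have hp₀ := h₀.isProbDensity hW₀
  have hp₁ := h₁.isProbDensity hW₁
  have hT := tendsto_classicalChernoffSeq hp₀ hp₁ h₀.measurable_wigner h₁.measurable_wigner
  have hle := Eventually.of_forall (f := atTop) (chernoffSeq_gocc_le h₀ h₁)
  refine ⟨⟨hp₀, hp₁⟩, limsup_le_limsup hle, liminf_le_liminf hle, ?_, hT⟩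
  rw [← hT.limsup_eq]
  exact limsup_le_limsup (Eventually.of_forall (chernoffSeq_wPlus_le h₀ h₁ hW₀ hW₁))
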